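/- Let $\mathbb K=\mathbb R$ or $\mathbb C$. For a Hermitian (symmetric if $\mathbb K=\mathbb R$) $n\times n$ matrix $M$ write $\lambda_1(M)\ge\cdots\ge\lambda_n(M)$ for its ordered eigenvalues. On a common probability space, for each $n$ let $X_n$ be a random Hermitian $n\times n$ matrix over $\mathbb K$. Assume that almost surely the empirical eigenvalue distributions $\mu_{X_n}=\frac1n\sum_{j=1}^n\delta_{\lambda_j(X_n)}$ converge weakly to a non-random compactly supported probability measure $\mu_X$ on $\mathbb R$, and that almost surely $\lambda_n(X_n)\to a$ and $\lambda_1(X_n)\to b$, where $a$ and $b$ are the infimum and the supremum of the support of $\mu_X$. Let $r\ge1$ and let $\theta_1\ge\cdots\ge\theta_r$ be non-zero real numbers not depending on $n$. For each $n\ge r$ let $P_n$ be a random Hermitian $n\times n$ matrix over $\mathbb K$ of rank $r$ whose non-zero eigenvalues, counted with multiplicity, are almost surely $\theta_1,\dots,\theta_r$. Assume that for each $n\ge r$ the matrices $X_n$ and $P_n$ are independent and that the law of $X_n$ or the law of $P_n$ is invariant under conjugation by every orthogonal (if $\mathbb K=\mathbb R$) or unitary (if $\mathbb K=\mathbb C$)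 matrix. Put $\widetilde X_n=X_n+P_n$. Let $G_{\mu_X}(z)=\int\frac{d\mu_X(t)}{z-t}$ be the Cauchy transform, and let $G_{\mu_X}(a^-)=\lim_{z\uparrow a}G_{\mu_X}(z)\in[-\infty,0)$ and $G_{\mu_X}(b^+)=\lim_{z\downarrow b}G_{\mu_X}(z)\in(0,+\infty]$. Let $i_0\in\{1,\dots,r\}$ be such that $1/\theta_{i_0}\in(G_{\mu_X}(a^-),G_{\mu_X}(b^+))$. For $n\ge r$ put $\widetilde\lambda_{i_0}=\lambda_{i_0}(\widetilde X_n)$ if $\theta_{i_0}>0$ and $\widetilde\lambda_{i_0}=\lambda_{n-r+i_0}(\widetilde X_n)$ if $\theta_{i_0}<0$, and let $\widetilde u=\widetilde u^{(n)}$ be any unit-norm eigenvector of $\widetilde X_n$ associated with $\widetilde\lambda_{i_0}$. For a subspace $F$ of $\mathbb K^n$ let $\langle x,F\rangle$ denote the norm of the orthogonal projection of $x$ onto $F$. Then there is exactly one $\rho\in\mathbb R\setminus[a,b]$ with $G_{\mu_X}(\rho)=1/\theta_{i_0}$; the function $G_{\mu_X}$ is differentiable at $\rho$ with $G_{\mu_X}'(\rho)\neq0$;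 almost surely $\widetilde\lambda_{i_0}\to\rho$; and, as $n\to\infty$, (a) $\displaystyle \langle\widetilde u,\ker(\theta_{i_0}I_n-P_n)\rangle^2\longrightarrow\frac{-1}{\theta_{i_0}^2\,G_{\mu_X}'(\rho)}$ almost surely; (b) $\displaystyle \Big\langle\widetilde u,\ \bigoplus_{\theta\in\{\theta_1,\dots,\theta_r\}\setminus\{\theta_{i_0}\}}\ker(\theta I_n-P_n)\Big\rangle\longrightarrow0$ almost surely. -/

import Mathlib

open MeasureTheory ProbabilityTheory Filter Topology
open scoped BoundedContinuousFunction

noncomputable section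

namespace SpikedModel

/-- `lam hA k` is the `k`-th largest eigenvalue `λ_k(A)` of a Hermitian `n × n` matrix, counted with
multiplicity, for `1 ≤ k ≤ n` (so `λ_1(A) ≥ ⋯ ≥ λ_n(A)`); it is `0` for other `k`. -/
def lam {𝕜 : Type*} [RCLike 𝕜] {n : ℕ} {A : Matrix (Fin n) (Fin n) 𝕜} (hA : A.IsHermitian)
    (k : ℕ) : ℝ :=
  if h : 1 ≤ k ∧ k ≤ n then hA.eigenvalues₀ ⟨k - 1, by rw [Fintype.card_fin]; omega⟩ else 0

/-- The empirical eigenvalue distribution `(1/n) ∑_j δ_{λ_j(A)}`. -/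
def empiricalSpectral {𝕜 : Type*} [RCLike 𝕜] {n : ℕ} {A : Matrix (Fin n) (Fin n) 𝕜}
    (hA : A.IsHermitian) : Measure ℝ :=
  (n : ENNReal)⁻¹ • ∑ j ∈ Finset.Icc 1 n, Measure.dirac (lam hA j)

/-- Weak convergence of a sequence of finite measures on the line. -/
def WeaklyConverges (ν : ℕ → Measure ℝ) (μ : Measure ℝ) : Prop :=
  ∀ f : ℝ →ᵇ ℝ, Tendsto (fun n => ∫ t, f t ∂(ν n)) atTop (𝓝 (∫ t, f t ∂μ))

/-- Infimum of the support. -/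
def edgeInf (μ : Measure ℝ) : ℝ := sInf μ.support

/-- Supremum of the support. -/
def edgeSup (μ : Measure ℝ) : ℝ := sSup μ.support

/-- The Cauchy transform at real points (meaningful off the support). -/
def cauchyG (μ : Measure ℝ) (z : ℝ) : ℝ := ∫ t, 1 / (z - t) ∂μ

/-- `G_μ(a⁻)`, in the extended reals, with `a` the infimum of the support. -/
def cauchyAtInf (μ : Measure ℝ) : EReal :=
  Function.leftLim (fun z => (cauchyG μ z : EReal)) (edgeInf μ)

/-- `G_μ(b⁺)`, in the extended reals, with `b` the supremum of the support. -/
def cauchyAtSup (μ : Measure ℝ) : EReal :=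
  Function.rightLim (fun z => (cauchyG μ z : EReal)) (edgeSup μ)

/-- Matrices carry the product σ-algebra of their entries (the Borel one). -/
instance matrixMeasurableSpace {m n α : Type*} [MeasurableSpace α] :
    MeasurableSpace (Matrix m n α) :=
  inferInstanceAs (MeasurableSpace (m → n → α))

/-- The law of the random matrix `Y` is invariant under conjugation by the orthogonal group
(`𝕜 = ℝ`) or the unitary group (`𝕜 = ℂ`). -/
def ConjInvariant {𝕜 : Type*} [RCLike 𝕜] {n : ℕ} {Ω : Type*} [MeasurableSpace Ω] (Pr : Measure Ω)
    (Y : Ω → Matrix (Fin n) (Fin n) 𝕜) : Prop :=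
  ∀ U ∈ Matrix.unitaryGroup (Fin n) 𝕜, Pr.map (fun ω => U * Y ω * star U) = Pr.map Y

/-- The nonzero eigenvalues of `A`, counted with multiplicity, are exactly `θ_1, …, θ_r`
(for nonzero `θ_i` this forces `A` to have rank `r`). -/
def NonzeroEigenvaluesAre {𝕜 : Type*} [RCLike 𝕜] {n r : ℕ} {A : Matrix (Fin n) (Fin n) 𝕜}
    (hA : A.IsHermitian) (θ : Fin r → ℝ) : Prop :=
  (Finset.univ.val.map hA.eigenvalues).filter (fun x => x ≠ 0) = Finset.univ.val.map θ

/-- `ker (t I - A)` as a subspace of `𝕜ⁿ` with its standard inner product. -/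
def eigKer {𝕜 : Type*} [RCLike 𝕜] {n : ℕ} (A : Matrix (Fin n) (Fin n) 𝕜) (t : ℝ) :
    Submodule 𝕜 (EuclideanSpace 𝕜 (Fin n)) :=
  LinearMap.ker (Matrix.toEuclideanLin ((t : 𝕜) • (1 : Matrix (Fin n) (Fin n) 𝕜) - A))

/-- `⟨x, F⟩`: the norm of the orthogonal projection of `x` onto the subspace `F`. -/
def projNorm {𝕜 : Type*} [RCLike 𝕜] {n : ℕ} (x : EuclideanSpace 𝕜 (Fin n))
    (F : Submodule 𝕜 (EuclideanSpace 𝕜 (Fin n))) : ℝ :=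
  ‖F.starProjection x‖

/-- The (1-based) position in the ordered spectrum of an `n × n` matrix of the outlier that
corresponds to `θ_i`: position `i` if `θ_i > 0`, and `n - r + i` if `θ_i < 0`. Here `i : Fin r`
is 0-based, so `i + 1` is the 1-based index. -/
def outlierPos (n : ℕ) {r : ℕ} (θ : Fin r → ℝ) (i : Fin r) : ℕ :=
  if 0 < θ i then (i : ℕ) + 1 else n - r + ((i : ℕ) + 1)

end SpikedModel

end

/-! Write P = Σ θ_j v_j v_j* with orthonormal v_j. Everything rests on one almost sure fact: for z
outside [a,b], the r × r matrix ⟨v_i, (z - X)⁻¹ v_j⟩ converges to G(z) times the identity, and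
likewise with (z - X)⁻² and ∫ (z - t)⁻² dμ(t).

The randomness is used only to get this fact. By invariance and independence a Haar unitary can be
inserted between X and P. A fourth moment bound for centered quadratic forms at Haar-rotated vectors
then makes E `compression` of order n⁻², hence summable. The bound comes from transitivity on
spheres: the vector may be replaced by a scaled sign vector, and averaging over the signs gives a
Rademacher chaos of order two (`signSum_quadratic_pow_four_le`). `compression` is an explicit
function of X and P, so no measurable choice of the v_j is needed. Its denominator replaces moment
assumptions on X; almost surely it converges, so it does no harm on a fixed path. Powers of X, then
polynomials, then continuous functions near [a,b] follow by Weierstrass approximation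
(`tendsto_inner_fn`).

The rest is deterministic (`IsSpikedPath`). For y beyond the edge, y - X is positive and can be
compared with P as a quadratic form. On the span of the vectors (y - X)⁻¹ v_j the comparison reduces
to that of θ_j G(y) with 1. This gives subspaces of the right dimension on which X + P is above or
below y, and Courant–Fischer locates the outlier (`tendsto_outlier`).

For the eigenvector, (X + P)u = wu reads u = (w - X)⁻¹ P u, with w → ρ. Pairing with v_i gives (1 -
θ_i G(ρ))⟨v_i, u⟩ → 0, which kills the components with θ_i ≠ θ_{i₀} and proves (b). Taking norms
gives 1 = ⟨Pu, (w - X)⁻² Pu⟩, whose right side is asymptotically -G'(ρ) Σ θ_j² |⟨v_j, u⟩|². Only the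
terms with θ_j = θ_{i₀} survive, which proves (a). -/

noncomputable section

/-! ### Fourth moments of Rademacher chaos -/

namespace SpikedModel

/-- The sum of `f` over the vertices of the cube `{-1, 1}ⁿ`. -/
def signSum (n : ℕ) (f : (Fin n → ℝ) → ℝ) : ℝ :=
  ∑ s : Fin n → Bool, f (fun i => if s i then 1 else -1)

theorem signSum_zero (f : (Fin 0 → ℝ) → ℝ) : signSum 0 f = f ![] := by
  simp only [signSum, Finset.univ_unique, Finset.sum_singleton]
  congr 1
  exact Subsingleton.elim _ _

theorem signSum_succ (n : ℕ) (f : (Fin (n + 1) → ℝ) → ℝ) :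
    signSum (n + 1) f =
      signSum n (fun x => f (Fin.cons 1 x)) + signSum n (fun x => f (Fin.cons (-1) x)) := by
  unfold signSum
  rw [← (Fin.consEquiv (fun _ => Bool)).sum_comp, Fintype.sum_prod_type, Fintype.sum_bool]
  congr 1 <;>
  · refine Finset.sum_congr rfl fun s _ => ?_
    congr 1
    funext i
    refine Fin.cases ?_ (fun j => ?_) i <;> simp [Fin.consEquiv]

theorem signSum_add (n : ℕ) (f g : (Fin n → ℝ) → ℝ) :
    signSum n (fun x => f x + g x) = signSum n f + signSum n g :=
  Finset.sum_add_distrib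

theorem signSum_const_mul (n : ℕ) (c : ℝ) (f : (Fin n → ℝ) → ℝ) :
    signSum n (fun x => c * f x) = c * signSum n f :=
  (Finset.mul_sum _ _ _).symm

theorem signSum_const (n : ℕ) (c : ℝ) : signSum n (fun _ => c) = 2 ^ n * c := by
  simp [signSum]

theorem signSum_nonneg (n : ℕ) {f : (Fin n → ℝ) → ℝ} (hf : ∀ x, 0 ≤ f x) : 0 ≤ signSum n f :=
  Finset.sum_nonneg fun _ _ => hf _

theorem signSum_mul_sq_le (n : ℕ) (f g : (Fin n → ℝ) → ℝ) :
    signSum n (fun x => f x * g x) ^ 2 ≤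
      signSum n (fun x => f x ^ 2) * signSum n (fun x => g x ^ 2) :=
  Finset.sum_mul_sq_le_sq_mul_sq _ _ _

theorem signSum_linear_sq (n : ℕ) (b : Fin n → ℝ) :
    signSum n (fun x => (∑ i, b i * x i) ^ 2) = 2 ^ n * ∑ i, b i ^ 2 := by
  induction n with
  | zero => simp [signSum_zero]
  | succ n ih =>
    rw [signSum_succ, ← signSum_add]
    simp only [Fin.sum_univ_succ, Fin.cons_zero, Fin.cons_succ]
    have h : ∀ x : Fin n → ℝ, (b 0 * 1 + ∑ i : Fin n, b i.succ * x i) ^ 2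
        + (b 0 * -1 + ∑ i : Fin n, b i.succ * x i) ^ 2
        = 2 * (∑ i : Fin n, b i.succ * x i) ^ 2 + 2 * b 0 ^ 2 := fun x => by ring
    simp only [h]
    rw [signSum_add, signSum_const_mul, ih (fun i => b i.succ), signSum_const]
    ring

/-- Bonami's induction in degree one: separating the first sign kills the odd powers. The constant 9
is not sharp; it is the one that fits the degree-two induction below. -/
theorem signSum_linear_pow_four_le (n : ℕ) (b : Fin n → ℝ) :
    signSum n (fun x => (∑ i, b i * x i) ^ 4) ≤ 2 ^ n * (9 * (∑ i, b i ^ 2) ^ 2) := by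
  induction n with
  | zero => simp [signSum_zero]
  | succ n ih =>
    rw [signSum_succ, ← signSum_add]
    simp only [Fin.sum_univ_succ, Fin.cons_zero, Fin.cons_succ]
    have h : ∀ x : Fin n → ℝ, (b 0 * 1 + ∑ i : Fin n, b i.succ * x i) ^ 4
        + (b 0 * -1 + ∑ i : Fin n, b i.succ * x i) ^ 4
        = 2 * (∑ i : Fin n, b i.succ * x i) ^ 4
          + ((12 * b 0 ^ 2) * (∑ i : Fin n, b i.succ * x i) ^ 2 + 2 * b 0 ^ 4) := fun x => by ring
    simp only [h]
    rw [signSum_add, signSum_const_mul, signSum_add, signSum_const_mul, signSum_const,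
      signSum_linear_sq]
    have h1 := ih (fun i => b i.succ)
    have h2 : 0 ≤ ∑ i : Fin n, b i.succ ^ 2 := Finset.sum_nonneg fun _ _ => sq_nonneg _
    set m := ∑ i : Fin n, b i.succ ^ 2
    have h3 : (0 : ℝ) < 2 ^ n := by positivity
    have h4 : 0 ≤ 2 ^ n * (12 * m * b 0 ^ 2 * 2 + 16 * b 0 ^ 4) := by positivity
    rw [pow_succ (2 : ℝ) n]
    nlinarith [h1, h4, mul_nonneg h3.le (mul_nonneg h2 (sq_nonneg (b 0)))]

/-- The fourth moment of a homogeneous Rademacher chaos of order two. -/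
theorem signSum_quadratic_pow_four_le (n : ℕ) (B : Fin n → Fin n → ℝ) :
    signSum n (fun x => (∑ i, ∑ j, B i j * x i * x j - ∑ i, B i i) ^ 4) ≤
      2 ^ n * (81 * (2 * ∑ i, ∑ j, B i j ^ 2) ^ 2) := by
  induction n with
  | zero => simp [signSum_zero]
  | succ n ih =>
    rw [signSum_succ, ← signSum_add]
    simp only [Fin.sum_univ_succ, Fin.cons_zero, Fin.cons_succ, Finset.sum_add_distrib]
    -- With the first sign x₀ split off, the chaos is Q + x₀ L: Q is the chaos in the remaining
    -- signs and L is linear. The term B 0 0 x₀² cancels against the subtracted diagonal, and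
    -- summing over x₀ = ±1 leaves only even powers of L.
    set Q : (Fin n → ℝ) → ℝ := fun x =>
      ∑ i : Fin n, ∑ j : Fin n, B i.succ j.succ * x i * x j - ∑ i : Fin n, B i.succ i.succ with hQ
    set c : Fin n → ℝ := fun j => B 0 j.succ + B j.succ 0 with hc
    set L : (Fin n → ℝ) → ℝ := fun x => ∑ j, c j * x j with hL
    have hLx : ∀ x, L x = ∑ j : Fin n, B 0 j.succ * x j + ∑ j : Fin n, B j.succ 0 * x j := by
      intro x
      simp only [hL, hc, ← Finset.sum_add_distrib]
      exact Finset.sum_congr rfl fun _ _ => by ring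
    have h : ∀ x : Fin n → ℝ,
        (B 0 0 * 1 * 1 + ∑ i : Fin n, B i.succ 0 * x i * 1 +
          (∑ j : Fin n, B 0 j.succ * 1 * x j
            + ∑ i : Fin n, ∑ j : Fin n, B i.succ j.succ * x i * x j) -
          (B 0 0 + ∑ i : Fin n, B i.succ i.succ)) ^ 4
        + (B 0 0 * -1 * -1 + ∑ i : Fin n, B i.succ 0 * x i * -1 +
          (∑ j : Fin n, B 0 j.succ * -1 * x j
            + ∑ i : Fin n, ∑ j : Fin n, B i.succ j.succ * x i * x j) -
          (B 0 0 + ∑ i : Fin n, B i.succ i.succ)) ^ 4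
        = 2 * Q x ^ 4 + (12 * (Q x ^ 2 * L x ^ 2) + 2 * L x ^ 4) := by
      intro x
      have e1 : ∑ j : Fin n, B 0 j.succ * -1 * x j = - ∑ j : Fin n, B 0 j.succ * x j := by
        rw [← Finset.sum_neg_distrib]; exact Finset.sum_congr rfl fun _ _ => by ring
      have e2 : ∑ j : Fin n, B j.succ 0 * x j * -1 = - ∑ j : Fin n, B j.succ 0 * x j := by
        rw [← Finset.sum_neg_distrib]; exact Finset.sum_congr rfl fun _ _ => by ring
      rw [e1, e2, hLx]
      simp only [mul_one, hQ]
      ring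
    simp only [h]
    rw [signSum_add, signSum_const_mul, signSum_add, signSum_const_mul, signSum_const_mul]
    have hq := ih (fun i j => B i.succ j.succ)
    have hl := signSum_linear_pow_four_le n c
    have hcs := signSum_mul_sq_le n (fun x => Q x ^ 2) (fun x => L x ^ 2)
    simp only [← pow_mul] at hcs
    norm_num only at hcs
    set m' := ∑ i : Fin n, ∑ j : Fin n, B i.succ j.succ ^ 2
    have hm' : 0 ≤ m' := Finset.sum_nonneg fun _ _ => Finset.sum_nonneg fun _ _ => sq_nonneg _
    set l := ∑ i, c i ^ 2 with hldef
    have hl0 : 0 ≤ l := Finset.sum_nonneg fun _ _ => sq_nonneg _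
    have hll : l ≤ 2 * (∑ j : Fin n, B 0 j.succ ^ 2 + ∑ j : Fin n, B j.succ 0 ^ 2) := by
      rw [hldef, ← Finset.sum_add_distrib, Finset.mul_sum]
      refine Finset.sum_le_sum fun j _ => ?_
      simp only [hc]
      nlinarith [sq_nonneg (B 0 j.succ - B j.succ 0)]
    have hN : (0 : ℝ) < 2 ^ n := by positivity
    have hA0 : 0 ≤ signSum n fun x => Q x ^ 4 := signSum_nonneg n fun x => by positivity
    have hB0 : 0 ≤ signSum n fun x => L x ^ 4 := signSum_nonneg n fun x => by positivity
    -- Cauchy–Schwarz with the two fourth moment bounds: 54² = 81 · 2² · 9.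
    have hcross : signSum n (fun x => Q x ^ 2 * L x ^ 2) ≤ 2 ^ n * (54 * m' * l) := by
      refine abs_le_of_sq_le_sq' ?_ (by positivity) |>.2
      refine hcs.trans ((mul_le_mul hq hl hB0 (by positivity)).trans (le_of_eq ?_))
      ring
    set D := ∑ j : Fin n, B 0 j.succ ^ 2 + ∑ j : Fin n, B j.succ 0 ^ 2 with hD
    -- The cross term 6 · 54 m' l equals 2 · 81 · (2m') · l, so the left side lies below 81 times a
    -- perfect square.
    have key : 81 * (2 * m') ^ 2 + 6 * (54 * m' * l) + 9 * l ^ 2 ≤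
        81 * (2 * (B 0 0 ^ 2 + D + m')) ^ 2 := by
      have h1 : 81 * (2 * m') ^ 2 + 6 * (54 * m' * l) + 9 * l ^ 2 ≤ 81 * (2 * m' + l) ^ 2 := by
        nlinarith [sq_nonneg l]
      refine h1.trans ?_
      have h2 : 2 * m' + l ≤ 2 * (B 0 0 ^ 2 + D + m') := by nlinarith [sq_nonneg (B 0 0)]
      gcongr
    have key2 := mul_le_mul_of_nonneg_left key hN.le
    have e : B 0 0 ^ 2 + ∑ j : Fin n, B j.succ 0 ^ 2 + (∑ j : Fin n, B 0 j.succ ^ 2 + m')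
        = B 0 0 ^ 2 + D + m' := by rw [hD]; ring
    rw [e, pow_succ (2 : ℝ) n]
    linarith

end SpikedModel

end

/-! ### Haar measure on the unitary group and invariants of conjugation -/

noncomputable section

namespace SpikedModel

open Matrix

variable {𝕜 : Type*} [RCLike 𝕜] {n : ℕ}

instance : BorelSpace (Matrix (Fin n) (Fin n) 𝕜) :=
  inferInstanceAs (BorelSpace (Fin n → Fin n → 𝕜))

instance : SecondCountableTopology (Matrix (Fin n) (Fin n) 𝕜) :=
  inferInstanceAs (SecondCountableTopology (Fin n → Fin n → 𝕜))

instance : BorelSpace (unitaryGroup (Fin n) 𝕜) := Subtype.borelSpace _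

instance : SecondCountableTopology (unitaryGroup (Fin n) 𝕜) :=
  TopologicalSpace.Subtype.secondCountableTopology _

instance : CompactSpace (unitaryGroup (Fin n) 𝕜) := by
  refine isCompact_iff_compactSpace.mp ?_
  have hK : IsCompact (Set.pi Set.univ fun _ : Fin n => Set.pi Set.univ fun _ : Fin n =>
      Metric.closedBall (0 : 𝕜) 1) :=
    isCompact_univ_pi fun _ => isCompact_univ_pi fun _ => isCompact_closedBall _ _
  refine hK.of_isClosed_subset (isClosed_unitary (R := Matrix (Fin n) (Fin n) 𝕜)) ?_
  intro U hU i _ j _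
  simpa using entry_norm_bound_of_unitary hU i j

/-- The Haar probability measure of the unitary (or orthogonal) group. -/
def haarUnitary (𝕜 : Type*) [RCLike 𝕜] (n : ℕ) : Measure (unitaryGroup (Fin n) 𝕜) :=
  Measure.haarMeasure ⊤

instance : IsProbabilityMeasure (haarUnitary 𝕜 n) :=
  ⟨by simpa [haarUnitary] using
        Measure.haarMeasure_self
          (K₀ := (⊤ : TopologicalSpace.PositiveCompacts (unitaryGroup (Fin n) 𝕜)))⟩

instance : (haarUnitary 𝕜 n).IsMulLeftInvariant := by unfold haarUnitary; infer_instance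

theorem integrable_haarUnitary {f : unitaryGroup (Fin n) 𝕜 → ℝ} (hf : Continuous f) :
    Integrable f (haarUnitary 𝕜 n) :=
  hf.integrable_of_hasCompactSupport (HasCompactSupport.of_compactSpace f)

/-- The squared Hilbert–Schmidt norm. -/
def hsSq (M : Matrix (Fin n) (Fin n) 𝕜) : ℝ := ∑ i, ∑ j, ‖M i j‖ ^ 2

theorem hsSq_nonneg (M : Matrix (Fin n) (Fin n) 𝕜) : 0 ≤ hsSq M :=
  Finset.sum_nonneg fun _ _ => Finset.sum_nonneg fun _ _ => sq_nonneg _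

theorem hsSq_eq_trace (M : Matrix (Fin n) (Fin n) 𝕜) :
    ((hsSq M : ℝ) : 𝕜) = (M * star M).trace := by
  simp [hsSq, trace, Matrix.mul_apply, star_apply, RCLike.mul_conj]

theorem hsSq_conj {U : Matrix (Fin n) (Fin n) 𝕜} (hU : U ∈ unitaryGroup (Fin n) 𝕜)
    (M : Matrix (Fin n) (Fin n) 𝕜) : hsSq (U * M * star U) = hsSq M := by
  have h1 : star U * U = 1 := mem_unitaryGroup_iff'.mp hU
  apply RCLike.ofReal_injective (K := 𝕜)
  rw [hsSq_eq_trace, hsSq_eq_trace]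
  have : U * M * star U * star (U * M * star U) = U * (M * star M * star U) := by
    simp only [star_mul, star_star]
    calc _ = U * M * (star U * U) * (star M * star U) := by simp only [mul_assoc]
      _ = _ := by rw [h1]; simp only [mul_assoc, mul_one]
  rw [this, trace_mul_comm, mul_assoc, mul_assoc, h1, mul_one]

theorem continuous_hsSq : Continuous (hsSq : Matrix (Fin n) (Fin n) 𝕜 → ℝ) := by
  unfold hsSq
  fun_prop

/-- The matrix `A` minus its normalized trace. -/
def centered (A : Matrix (Fin n) (Fin n) 𝕜) : Matrix (Fin n) (Fin n) 𝕜 :=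
  A - (A.trace / (n : 𝕜)) • (1 : Matrix (Fin n) (Fin n) 𝕜)

theorem continuous_centered :
    Continuous (centered : Matrix (Fin n) (Fin n) 𝕜 → Matrix (Fin n) (Fin n) 𝕜) := by
  unfold centered
  fun_prop

theorem trace_conj {U : Matrix (Fin n) (Fin n) 𝕜} (hU : U ∈ unitaryGroup (Fin n) 𝕜)
    (A : Matrix (Fin n) (Fin n) 𝕜) : (U * A * star U).trace = A.trace := by
  rw [mul_assoc, trace_mul_comm, mul_assoc, mem_unitaryGroup_iff'.mp hU, mul_one]

theorem centered_conj {U : Matrix (Fin n) (Fin n) 𝕜} (hU : U ∈ unitaryGroup (Fin n) 𝕜)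
    (A : Matrix (Fin n) (Fin n) 𝕜) : centered (U * A * star U) = U * centered A * star U := by
  unfold centered
  rw [trace_conj hU, mul_sub, sub_mul, Matrix.mul_smul, Matrix.smul_mul, mul_one,
    mem_unitaryGroup_iff.mp hU]

theorem pow_conj {U : Matrix (Fin n) (Fin n) 𝕜} (hU : U ∈ unitaryGroup (Fin n) 𝕜)
    (A : Matrix (Fin n) (Fin n) 𝕜) (k : ℕ) : (U * A * star U) ^ k = U * A ^ k * star U := by
  induction k with
  | zero => simp [mem_unitaryGroup_iff.mp hU]
  | succ k ih =>
    rw [pow_succ, ih, pow_succ]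
    calc _ = U * A ^ k * (star U * U) * A * star U := by simp only [mul_assoc]
      _ = _ := by rw [mem_unitaryGroup_iff'.mp hU]; simp only [mul_assoc, one_mul]

theorem isHermitian_centered {A : Matrix (Fin n) (Fin n) 𝕜} (hA : A.IsHermitian) :
    (centered A).IsHermitian := by
  unfold centered
  refine hA.sub ?_
  unfold IsHermitian
  rw [conjTranspose_smul, conjTranspose_one]
  congr 1
  have : star A.trace = A.trace := by rw [← trace_conjTranspose, hA.eq]
  simp only [star_div₀, star_natCast, this]

/-- The real part of the sesquilinear form of a matrix. -/
def reForm (M : Matrix (Fin n) (Fin n) 𝕜) (x : Fin n → 𝕜) : ℝ :=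
  RCLike.re (star x ⬝ᵥ M *ᵥ x)

theorem reForm_mulVec (V M : Matrix (Fin n) (Fin n) 𝕜) (x : Fin n → 𝕜) :
    reForm M (V *ᵥ x) = reForm (star V * M * V) x := by
  unfold reForm
  rw [star_mulVec, ← dotProduct_mulVec, mulVec_mulVec, mulVec_mulVec]
  rfl

theorem exists_unitary_mulVec_single {n : ℕ} [NeZero n] (x : EuclideanSpace 𝕜 (Fin n))
    (hx : ‖x‖ = 1) :
    ∃ V ∈ unitaryGroup (Fin n) 𝕜, V *ᵥ (Pi.single 0 1) = x.ofLp := by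
  have hc : Module.finrank 𝕜 (EuclideanSpace 𝕜 (Fin n)) = Fintype.card (Fin n) := by simp
  have ho : Orthonormal 𝕜 (({0} : Set (Fin n)).domRestrict fun _ => x) := by
    constructor
    · intro i; simpa using hx
    · intro i j hij; exact absurd (Subsingleton.elim i j) hij
  obtain ⟨b, hb⟩ := ho.exists_orthonormalBasis_extension_of_card_eq hc
  refine ⟨_, (EuclideanSpace.basisFun (Fin n) 𝕜).toMatrix_orthonormalBasis_mem_unitary b, ?_⟩
  ext i
  simp [Module.Basis.toMatrix_apply, hb 0 rfl]

/-- Both vectors are unitary images of the same multiple of the first coordinate vector.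
Transitivity on spheres allows a Haar average at one vector to be moved to any vector of the same
norm, in particular to a scaled sign vector. -/
theorem exists_unitary_mulVec_eq (x y : EuclideanSpace 𝕜 (Fin n)) (h : ‖x‖ = ‖y‖) :
    ∃ V ∈ unitaryGroup (Fin n) 𝕜, V *ᵥ x.ofLp = y.ofLp := by
  by_cases hx : x = 0
  · have hy : y = 0 := by rw [← norm_eq_zero, ← h, hx, norm_zero]
    exact ⟨1, one_mem _, by simp [hx, hy]⟩
  have hn : NeZero n := ⟨by
    rintro rfl
    exact hx (Subsingleton.elim _ _)⟩
  have key : ∀ z : EuclideanSpace 𝕜 (Fin n), ‖z‖ = ‖x‖ → ∃ V ∈ unitaryGroup (Fin n) 𝕜,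
      V *ᵥ (((‖x‖ : ℝ) : 𝕜) • Pi.single 0 1) = z.ofLp := by
    intro z hz
    have hx0 : ‖x‖ ≠ 0 := norm_ne_zero_iff.mpr hx
    have hx1 : ((‖x‖ : ℝ) : 𝕜) ≠ 0 := RCLike.ofReal_ne_zero.mpr hx0
    obtain ⟨V, hV, h1⟩ := exists_unitary_mulVec_single ((((‖x‖ : ℝ) : 𝕜)⁻¹) • z)
      (by rw [norm_smul, norm_inv, RCLike.norm_ofReal, abs_norm, hz, inv_mul_cancel₀ hx0])
    refine ⟨V, hV, ?_⟩
    rw [mulVec_smul, h1, WithLp.ofLp_smul]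
    simp [smul_smul, hx1]
  obtain ⟨V, hV, h1⟩ := key x rfl
  obtain ⟨W, hW, h2⟩ := key y h.symm
  refine ⟨W * star V, mul_mem hW (Unitary.star_mem hV), ?_⟩
  rw [← h1, mulVec_mulVec, mul_assoc, mem_unitaryGroup_iff'.mp hV, mul_one, h2]

end SpikedModel

end

/-! ### Fourth moments of Haar-rotated sesquilinear forms -/

noncomputable section

namespace SpikedModel

open Matrix

variable {𝕜 : Type*} [RCLike 𝕜] {n : ℕ}

theorem continuous_reForm (x : Fin n → 𝕜) :
    Continuous fun M : Matrix (Fin n) (Fin n) 𝕜 => reForm M x := by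
  unfold reForm
  fun_prop

theorem continuous_unitary_conj (C : Matrix (Fin n) (Fin n) 𝕜) :
    Continuous fun U : unitaryGroup (Fin n) 𝕜 =>
      (U : Matrix (Fin n) (Fin n) 𝕜) * C * star (U : Matrix (Fin n) (Fin n) 𝕜) := by
  fun_prop

/-- Left invariance of Haar measure under U ↦ V* U. -/
theorem integral_haarUnitary_conj_mul {V : Matrix (Fin n) (Fin n) 𝕜}
    (hV : V ∈ unitaryGroup (Fin n) 𝕜) (C : Matrix (Fin n) (Fin n) 𝕜)
    (f : Matrix (Fin n) (Fin n) 𝕜 → ℝ) :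
    ∫ U : unitaryGroup (Fin n) 𝕜, f (star V * (U.1 * C * star U.1) * V)
        ∂(haarUnitary 𝕜 n) =
      ∫ U : unitaryGroup (Fin n) 𝕜, f (U.1 * C * star U.1) ∂(haarUnitary 𝕜 n) := by
  conv_rhs => rw [← integral_mul_left_eq_self _
    (⟨star V, Unitary.star_mem hV⟩ : unitaryGroup (Fin n) 𝕜)]
  refine integral_congr_ae (Eventually.of_forall fun U => ?_)
  simp [mul_assoc]

/-- At a vector with entries ±c the diagonal of M contributes exactly c² tr M, whatever the signs.
The vector has squared norm c² n, so removing the normalized trace shifts the form by the same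
amount: the signs enter only through a chaos without diagonal. -/
theorem reForm_centered_sign (M : Matrix (Fin n) (Fin n) 𝕜) (hn : n ≠ 0) (c : ℝ) (s : Fin n → ℝ)
    (hs : ∀ i, s i ^ 2 = 1) :
    reForm (centered M) (fun i => ((c * s i : ℝ) : 𝕜)) =
      c ^ 2 * (∑ i, ∑ j, RCLike.re (M i j) * s i * s j - ∑ i, RCLike.re (M i i)) := by
  have h1 : star (fun i => ((c * s i : ℝ) : 𝕜)) = fun i => ((c * s i : ℝ) : 𝕜) := by
    ext i; simp
  have hn' : (n : 𝕜) ≠ 0 := Nat.cast_ne_zero.mpr hn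
  have h2 : (fun i => ((c * s i : ℝ) : 𝕜)) ⬝ᵥ (fun i => ((c * s i : ℝ) : 𝕜))
      = ((c ^ 2 : ℝ) : 𝕜) * n := by
    simp only [dotProduct, ← RCLike.ofReal_mul]
    rw [← RCLike.ofReal_sum]
    have : ∀ i, c * s i * (c * s i) = c ^ 2 := fun i => by
      calc _ = c ^ 2 * s i ^ 2 := by ring
        _ = _ := by rw [hs, mul_one]
    simp [this, mul_comm]
  unfold reForm centered
  rw [h1, sub_mulVec, dotProduct_sub, smul_mulVec, one_mulVec, dotProduct_smul, h2, smul_eq_mul]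
  have h3 : M.trace / (n : 𝕜) * (((c ^ 2 : ℝ) : 𝕜) * n) = ((c ^ 2 : ℝ) : 𝕜) * M.trace := by
    field_simp
  rw [h3, map_sub, RCLike.re_ofReal_mul, mul_sub]
  congr 1
  · simp only [dotProduct, mulVec, map_sum, Finset.mul_sum, RCLike.re_ofReal_mul,
      RCLike.re_mul_ofReal]
    refine Finset.sum_congr rfl fun i _ => Finset.sum_congr rfl fun j _ => by ring
  · simp [trace]

theorem signSum_reForm_centered_le (M : Matrix (Fin n) (Fin n) 𝕜) (hn : n ≠ 0) (c : ℝ) :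
    ∑ s : Fin n → Bool, reForm (centered M)
        (fun i => ((c * (if s i then 1 else -1) : ℝ) : 𝕜)) ^ 4 ≤
      2 ^ n * (324 * c ^ 8 * hsSq M ^ 2) := by
  have h := signSum_quadratic_pow_four_le n (fun i j => RCLike.re (M i j))
  have hle : ∑ i, ∑ j, RCLike.re (M i j) ^ 2 ≤ hsSq M := by
    refine Finset.sum_le_sum fun i _ => Finset.sum_le_sum fun j _ => ?_
    exact sq_le_sq' (by linarith [(abs_le.mp (RCLike.abs_re_le_norm (M i j))).1])
      (RCLike.re_le_norm _)
  have h0 : 0 ≤ ∑ i, ∑ j, RCLike.re (M i j) ^ 2 :=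
    Finset.sum_nonneg fun _ _ => Finset.sum_nonneg fun _ _ => sq_nonneg _
  unfold signSum at h
  calc _ = c ^ 8 * ∑ s : Fin n → Bool, (∑ i, ∑ j, RCLike.re (M i j) * (if s i then 1 else -1)
          * (if s j then 1 else -1) - ∑ i, RCLike.re (M i i)) ^ 4 := by
        rw [Finset.mul_sum]
        refine Finset.sum_congr rfl fun s _ => ?_
        rw [reForm_centered_sign M hn c (fun i => if s i then 1 else -1)
          (fun i => by split_ifs <;> norm_num)]
        ring
    _ ≤ c ^ 8 * (2 ^ n * (81 * (2 * ∑ i, ∑ j, RCLike.re (M i j) ^ 2) ^ 2)) := by gcongr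
    _ ≤ c ^ 8 * (2 ^ n * (81 * (2 * hsSq M) ^ 2)) := by gcongr
    _ = _ := by ring

theorem norm_toLp_sq (x : Fin n → 𝕜) : ‖WithLp.toLp 2 x‖ ^ 2 = ∑ i, ‖x i‖ ^ 2 := by
  rw [EuclideanSpace.norm_sq_eq]

/-- Fourth moment of a centered quadratic form at a Haar-rotated vector. -/
theorem integral_reForm_pow_four_le (A : Matrix (Fin n) (Fin n) 𝕜) (x : Fin n → 𝕜) :
    ∫ U : unitaryGroup (Fin n) 𝕜, reForm (U.1 * centered A * star U.1) x ^ 4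
        ∂(haarUnitary 𝕜 n) ≤
      324 * (∑ i, ‖x i‖ ^ 2) ^ 4 * (hsSq A ^ 2 / (n : ℝ) ^ 4) := by
  rcases eq_or_ne n 0 with rfl | hn
  · simp [reForm]
  have hn' : (n : ℝ) ≠ 0 := Nat.cast_ne_zero.mpr hn
  set N := ∑ i, ‖x i‖ ^ 2 with hN
  have hN0 : 0 ≤ N := Finset.sum_nonneg fun _ _ => sq_nonneg _
  -- Chosen so that every vector with entries ±c has the norm of x; then c⁸ = N⁴ / n⁴ supplies the
  -- decay in n.
  set c := Real.sqrt (N / n) with hc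
  have hc2 : c ^ 2 = N / n := Real.sq_sqrt (by positivity)
  have hcs : ∀ s : Fin n → Bool,
      ∫ U : unitaryGroup (Fin n) 𝕜, reForm (U.1 * centered A * star U.1) x ^ 4
        ∂(haarUnitary 𝕜 n) =
      ∫ U : unitaryGroup (Fin n) 𝕜, reForm (centered (U.1 * A * star U.1))
        (fun i => ((c * (if s i then 1 else -1) : ℝ) : 𝕜)) ^ 4 ∂(haarUnitary 𝕜 n) := by
    intro s
    obtain ⟨V, hV, h1⟩ := exists_unitary_mulVec_eq (WithLp.toLp 2 x)
      (WithLp.toLp 2 fun i => ((c * (if s i then 1 else -1) : ℝ) : 𝕜)) (by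
        rw [← sq_eq_sq₀ (norm_nonneg _) (norm_nonneg _), norm_toLp_sq, norm_toLp_sq, ← hN]
        have : ∀ i, ‖((c * (if s i then 1 else -1) : ℝ) : 𝕜)‖ ^ 2 = c ^ 2 := by
          intro i
          rw [RCLike.norm_ofReal, sq_abs, mul_pow]
          split_ifs <;> norm_num
        simp only [this, hc2]
        simp
        field_simp)
    have h2 := integral_haarUnitary_conj_mul hV (centered A) (fun M => reForm M x ^ 4)
    rw [← h2]
    refine integral_congr_ae (Eventually.of_forall fun U => ?_)
    simp only at h1 ⊢
    rw [← h1, reForm_mulVec, centered_conj U.2]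
  -- The Haar integral is the same at all 2ⁿ sign vectors, so it may be averaged over them under the
  -- integral sign. The chaos bound depends on U A U* only through its Hilbert–Schmidt norm, hence
  -- not on U.
  have hsum : 2 ^ n * ∫ U : unitaryGroup (Fin n) 𝕜, reForm (U.1 * centered A * star U.1) x ^ 4
        ∂(haarUnitary 𝕜 n) ≤ 2 ^ n * (324 * c ^ 8 * hsSq A ^ 2) := by
    calc _ = ∑ s : Fin n → Bool, ∫ U : unitaryGroup (Fin n) 𝕜,
          reForm (U.1 * centered A * star U.1) x ^ 4 ∂(haarUnitary 𝕜 n) := by simp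
      _ = ∑ s : Fin n → Bool, ∫ U : unitaryGroup (Fin n) 𝕜,
          reForm (centered (U.1 * A * star U.1))
            (fun i => ((c * (if s i then 1 else -1) : ℝ) : 𝕜)) ^ 4 ∂(haarUnitary 𝕜 n) :=
        Finset.sum_congr rfl fun s _ => hcs s
      _ = ∫ U : unitaryGroup (Fin n) 𝕜, ∑ s : Fin n → Bool,
          reForm (centered (U.1 * A * star U.1))
            (fun i => ((c * (if s i then 1 else -1) : ℝ) : 𝕜)) ^ 4 ∂(haarUnitary 𝕜 n) := by
        rw [integral_finsetSum]
        intro s _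
        exact integrable_haarUnitary (((continuous_reForm _).comp
          (continuous_centered.comp (continuous_unitary_conj A))).pow 4)
      _ ≤ ∫ U : unitaryGroup (Fin n) 𝕜, 2 ^ n * (324 * c ^ 8 * hsSq A ^ 2) ∂(haarUnitary 𝕜 n) := by
        refine integral_mono ?_ (integrable_const _) fun U => ?_
        · refine integrable_haarUnitary (continuous_finsetSum _ fun s _ => ?_)
          exact ((continuous_reForm _).comp
            (continuous_centered.comp (continuous_unitary_conj A))).pow 4
        · have := signSum_reForm_centered_le (U.1 * A * star U.1) hn c
          rwa [hsSq_conj U.2] at this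
      _ = _ := by simp
  refine (le_of_mul_le_mul_left hsum (by positivity)).trans (le_of_eq ?_)
  have : c ^ 8 = (N / n) ^ 4 := by rw [← hc2]; ring
  rw [this]
  field_simp

theorem re_dotProduct_eq {B : Matrix (Fin n) (Fin n) 𝕜} (hB : B.IsHermitian) (x y : Fin n → 𝕜) :
    RCLike.re (star x ⬝ᵥ B *ᵥ y) = (reForm B (x + y) - reForm B (x - y)) / 4 := by
  have h : RCLike.re (star y ⬝ᵥ B *ᵥ x) = RCLike.re (star x ⬝ᵥ B *ᵥ y) := by
    rw [← RCLike.conj_re (star y ⬝ᵥ B *ᵥ x)]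
    congr 1
    change star (star y ⬝ᵥ B *ᵥ x) = _
    rw [star_dotProduct, star_star, star_mulVec, ← dotProduct_mulVec, hB.eq]
  unfold reForm
  simp only [star_add, star_sub, mulVec_add, mulVec_sub, dotProduct_add, dotProduct_sub,
    add_dotProduct, sub_dotProduct, map_add, map_sub, h]
  ring

/-- Polarization: x ± y give the real part and x ± Iy the imaginary part. Over ℝ, where `RCLike.I`
is 0, the last two terms only add something nonnegative. -/
theorem norm_dotProduct_pow_four_le {B : Matrix (Fin n) (Fin n) 𝕜} (hB : B.IsHermitian)
    (x y : Fin n → 𝕜) :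
    ‖star x ⬝ᵥ B *ᵥ y‖ ^ 4 ≤ (reForm B (x + y) ^ 4 + reForm B (x - y) ^ 4
      + reForm B (x + (RCLike.I : 𝕜) • y) ^ 4 + reForm B (x - (RCLike.I : 𝕜) • y) ^ 4) / 16 := by
  have h1 := re_dotProduct_eq hB x y
  have h2 := re_dotProduct_eq hB x ((RCLike.I : 𝕜) • y)
  rw [mulVec_smul, dotProduct_smul, smul_eq_mul, RCLike.I_mul_re] at h2
  set z := star x ⬝ᵥ B *ᵥ y
  have h3 : ‖z‖ ^ 2 = RCLike.re z ^ 2 + RCLike.im z ^ 2 := by rw [RCLike.norm_sq_eq_def]; ring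
  have h4 : ‖z‖ ^ 4 = (RCLike.re z ^ 2 + RCLike.im z ^ 2) ^ 2 := by rw [← h3]; ring
  have h5 : RCLike.im z ^ 2 = ((reForm B (x + (RCLike.I : 𝕜) • y)
    - reForm B (x - (RCLike.I : 𝕜) • y)) / 4) ^ 2 := by rw [← h2]; ring
  rw [h4, h1, h5]
  have q : ∀ a b : ℝ, ((a - b) / 4) ^ 4 ≤ (a ^ 4 + b ^ 4) / 32 := fun a b => by
    nlinarith [sq_nonneg (a ^ 2 - b ^ 2), sq_nonneg (a + b), sq_nonneg ((a + b) ^ 2),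
      mul_nonneg (sq_nonneg (a + b)) (sq_nonneg (a - b)), sq_nonneg (a * b)]
  have q1 := q (reForm B (x + y)) (reForm B (x - y))
  have q2 := q (reForm B (x + (RCLike.I : 𝕜) • y)) (reForm B (x - (RCLike.I : 𝕜) • y))
  generalize (reForm B (x + y) - reForm B (x - y)) / 4 = a at *
  generalize (reForm B (x + (RCLike.I : 𝕜) • y) - reForm B (x - (RCLike.I : 𝕜) • y)) / 4 = b at *
  nlinarith [sq_nonneg (a ^ 2 - b ^ 2)]

theorem sum_norm_sq_le_four {x y : Fin n → 𝕜} (hx : ∑ i, ‖x i‖ ^ 2 ≤ 1)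
    (hy : ∑ i, ‖y i‖ ^ 2 ≤ 1) (c : 𝕜) (hc : ‖c‖ ≤ 1) : ∑ i, ‖(x + c • y) i‖ ^ 2 ≤ 4 := by
  have : ∀ i, ‖(x + c • y) i‖ ^ 2 ≤ 2 * ‖x i‖ ^ 2 + 2 * ‖y i‖ ^ 2 := by
    intro i
    have h1 : ‖(x + c • y) i‖ ≤ ‖x i‖ + ‖y i‖ := by
      refine (norm_add_le _ _).trans ?_
      gcongr
      rw [Pi.smul_apply, norm_smul]
      exact mul_le_of_le_one_left (norm_nonneg _) hc
    nlinarith [sq_nonneg (‖x i‖ - ‖y i‖), norm_nonneg ((x + c • y) i)]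
  calc _ ≤ ∑ i, (2 * ‖x i‖ ^ 2 + 2 * ‖y i‖ ^ 2) := Finset.sum_le_sum fun i _ => this i
    _ = 2 * ∑ i, ‖x i‖ ^ 2 + 2 * ∑ i, ‖y i‖ ^ 2 := by
      rw [Finset.sum_add_distrib, Finset.mul_sum, Finset.mul_sum]
    _ ≤ 4 := by linarith

theorem integral_norm_dotProduct_pow_four_le {A : Matrix (Fin n) (Fin n) 𝕜} (hA : A.IsHermitian)
    {x y : Fin n → 𝕜} (hx : ∑ i, ‖x i‖ ^ 2 ≤ 1) (hy : ∑ i, ‖y i‖ ^ 2 ≤ 1) :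
    ∫ U : unitaryGroup (Fin n) 𝕜, ‖star x ⬝ᵥ (U.1 * centered A * star U.1) *ᵥ y‖ ^ 4
        ∂(haarUnitary 𝕜 n) ≤ 20736 * (hsSq A ^ 2 / (n : ℝ) ^ 4) := by
  have hInt : ∀ w : Fin n → 𝕜, Integrable (fun U : unitaryGroup (Fin n) 𝕜 =>
      reForm (U.1 * centered A * star U.1) w ^ 4) (haarUnitary 𝕜 n) := fun w =>
    integrable_haarUnitary (((continuous_reForm w).comp (continuous_unitary_conj _)).pow 4)
  -- 82944 = 324 · 4⁴, since each polarized vector has squared norm at most 4. The four terms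
  -- divided by 16 then give 20736.
  have hb : ∀ c : 𝕜, ‖c‖ ≤ 1 → ∫ U : unitaryGroup (Fin n) 𝕜,
      reForm (U.1 * centered A * star U.1) (x + c • y) ^ 4 ∂(haarUnitary 𝕜 n) ≤
        82944 * (hsSq A ^ 2 / (n : ℝ) ^ 4) := by
    intro c hc
    refine (integral_reForm_pow_four_le A _).trans ?_
    have h0 : 0 ≤ ∑ i, ‖(x + c • y) i‖ ^ 2 := Finset.sum_nonneg fun _ _ => sq_nonneg _
    have : (∑ i, ‖(x + c • y) i‖ ^ 2) ^ 4 ≤ 4 ^ 4 :=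
      pow_le_pow_left₀ h0 (sum_norm_sq_le_four hx hy c hc) 4
    have h1 : 0 ≤ hsSq A ^ 2 / (n : ℝ) ^ 4 := by positivity
    nlinarith
  have hI : ‖(RCLike.I : 𝕜)‖ ≤ 1 := by
    by_cases h : (RCLike.I : 𝕜) = 0
    · simp [h]
    · exact (RCLike.norm_I_of_ne_zero h).le
  have e1 := hb 1 (by simp)
  have e2 := hb (-1) (by simp)
  have e3 := hb RCLike.I hI
  have e4 := hb (-RCLike.I) (by simpa using hI)
  simp only [one_smul, neg_smul, ← sub_eq_add_neg] at e1 e2 e3 e4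
  calc _ ≤ ∫ U : unitaryGroup (Fin n) 𝕜,
        (reForm (U.1 * centered A * star U.1) (x + y) ^ 4
        + reForm (U.1 * centered A * star U.1) (x - y) ^ 4
        + reForm (U.1 * centered A * star U.1) (x + (RCLike.I : 𝕜) • y) ^ 4
        + reForm (U.1 * centered A * star U.1) (x - (RCLike.I : 𝕜) • y) ^ 4) / 16
          ∂(haarUnitary 𝕜 n) := by
        refine integral_mono (integrable_haarUnitary ?_)
          (((((hInt _).add (hInt _)).add (hInt _)).add (hInt _)).div_const 16) fun U => ?_
        · have := continuous_unitary_conj (centered A)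
          fun_prop
        · refine norm_dotProduct_pow_four_le ?_ x y
          exact isHermitian_mul_mul_conjTranspose _ (isHermitian_centered hA)
    _ ≤ _ := by
        have hadd : ∀ f₁ f₂ f₃ f₄ : unitaryGroup (Fin n) 𝕜 → ℝ, Integrable f₁ (haarUnitary 𝕜 n) →
            Integrable f₂ (haarUnitary 𝕜 n) → Integrable f₃ (haarUnitary 𝕜 n) →
            Integrable f₄ (haarUnitary 𝕜 n) →
            ∫ U, (f₁ U + f₂ U + f₃ U + f₄ U) / 16 ∂(haarUnitary 𝕜 n) =
              (∫ U, f₁ U ∂(haarUnitary 𝕜 n) + ∫ U, f₂ U ∂(haarUnitary 𝕜 n)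
                + ∫ U, f₃ U ∂(haarUnitary 𝕜 n) + ∫ U, f₄ U ∂(haarUnitary 𝕜 n)) / 16 := by
          intro f₁ f₂ f₃ f₄ h₁ h₂ h₃ h₄
          rw [integral_div, integral_add (f := fun U => f₁ U + f₂ U + f₃ U) ((h₁.add h₂).add h₃) h₄,
            integral_add (f := fun U => f₁ U + f₂ U) (h₁.add h₂) h₃, integral_add h₁ h₂]
        rw [hadd _ _ _ _ (hInt _) (hInt _) (hInt _) (hInt _)]
        linarith

end SpikedModel

end

/-! ### Almost sure decay of the compressed centered powers -/

noncomputable section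

namespace SpikedModel

open Matrix

variable {𝕜 : Type*} [RCLike 𝕜] {n : ℕ}

theorem hsSq_diagonal_mul_mul (d : Fin n → ℝ) (B : Matrix (Fin n) (Fin n) 𝕜) :
    hsSq (diagonal (fun i => (d i : 𝕜)) * B * diagonal (fun i => (d i : 𝕜))) =
      ∑ q : Fin n × Fin n, (d q.1 ^ 2 * d q.2 ^ 2) * ‖B q.1 q.2‖ ^ 2 := by
  rw [Fintype.sum_prod_type]
  refine Finset.sum_congr rfl fun i _ => Finset.sum_congr rfl fun j _ => ?_
  rw [mul_diagonal, diagonal_mul, norm_mul, norm_mul, RCLike.norm_ofReal, RCLike.norm_ofReal,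
    mul_pow, mul_pow, sq_abs, sq_abs]
  ring

theorem sum_norm_single_sq (k : Fin n) : ∑ i, ‖(Pi.single k (1 : 𝕜) : Fin n → 𝕜) i‖ ^ 2 ≤ 1 := by
  rw [Finset.sum_eq_single k] <;> simp +contextual

/-- The squared norm is a sum of squared entries with weights d_i² d_j². Cauchy–Schwarz with these
weights reduces its square to fourth moments of single entries, which are forms at coordinate
vectors. -/
theorem integral_hsSq_diagonal_le {A : Matrix (Fin n) (Fin n) 𝕜} (hA : A.IsHermitian)
    (d : Fin n → ℝ) :
    ∫ U : unitaryGroup (Fin n) 𝕜, hsSq (diagonal (fun i => (d i : 𝕜)) *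
        ((U : Matrix (Fin n) (Fin n) 𝕜) * centered A * star (U : Matrix (Fin n) (Fin n) 𝕜)) *
        diagonal (fun i => (d i : 𝕜))) ^ 2 ∂(haarUnitary 𝕜 n) ≤
      20736 * (∑ i, d i ^ 2) ^ 4 * (hsSq A ^ 2 / (n : ℝ) ^ 4) := by
  set B : unitaryGroup (Fin n) 𝕜 → Matrix (Fin n) (Fin n) 𝕜 := fun U =>
    (U : Matrix (Fin n) (Fin n) 𝕜) * centered A * star (U : Matrix (Fin n) (Fin n) 𝕜) with hB
  have hBc : Continuous B := continuous_unitary_conj _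
  have hentry : ∀ q : Fin n × Fin n, ∫ U, ‖B U q.1 q.2‖ ^ 4 ∂(haarUnitary 𝕜 n) ≤
      20736 * (hsSq A ^ 2 / (n : ℝ) ^ 4) := by
    intro q
    have h := integral_norm_dotProduct_pow_four_le hA (sum_norm_single_sq (𝕜 := 𝕜) q.1)
      (sum_norm_single_sq (𝕜 := 𝕜) q.2)
    refine le_trans (le_of_eq ?_) h
    refine integral_congr_ae (Eventually.of_forall fun U => ?_)
    have : star (Pi.single q.1 (1 : 𝕜) : Fin n → 𝕜) = Pi.single q.1 1 := by
      rw [Pi.star_single, star_one]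
    simp [hB, this]
  have hci : ∀ q : Fin n × Fin n, Integrable (fun U => ‖B U q.1 q.2‖ ^ 4) (haarUnitary 𝕜 n) :=
    fun q => integrable_haarUnitary (by fun_prop)
  have hsum : ∑ q : Fin n × Fin n, d q.1 ^ 2 * d q.2 ^ 2 = (∑ i, d i ^ 2) ^ 2 := by
    rw [Fintype.sum_prod_type, sq, Finset.sum_mul_sum]
  have hpt : ∀ U, hsSq (diagonal (fun i => (d i : 𝕜)) * B U * diagonal (fun i => (d i : 𝕜))) ^ 2 ≤
      ∑ q : Fin n × Fin n, ((∑ i, d i ^ 2) ^ 2 * (d q.1 ^ 2 * d q.2 ^ 2)) * ‖B U q.1 q.2‖ ^ 4 := by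
    intro U
    rw [hsSq_diagonal_mul_mul]
    have := Finset.sum_sq_le_sum_mul_sum_of_sq_le_mul (Finset.univ : Finset (Fin n × Fin n))
      (r := fun q => (d q.1 ^ 2 * d q.2 ^ 2) * ‖B U q.1 q.2‖ ^ 2)
      (f := fun q => d q.1 ^ 2 * d q.2 ^ 2)
      (g := fun q => (d q.1 ^ 2 * d q.2 ^ 2) * ‖B U q.1 q.2‖ ^ 4)
      (fun q _ => by positivity) (fun q _ => by positivity) (fun q _ => le_of_eq (by ring))
    refine this.trans (le_of_eq ?_)
    rw [hsum, Finset.mul_sum]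
    exact Finset.sum_congr rfl fun q _ => by ring
  calc _ ≤ ∫ U, ∑ q : Fin n × Fin n,
        ((∑ i, d i ^ 2) ^ 2 * (d q.1 ^ 2 * d q.2 ^ 2)) * ‖B U q.1 q.2‖ ^ 4 ∂(haarUnitary 𝕜 n) := by
        refine integral_mono (integrable_haarUnitary ?_)
          (integrable_finsetSum _ fun q _ => (hci q).const_mul _) hpt
        exact (continuous_hsSq.comp ((continuous_const.mul hBc).mul continuous_const)).pow 2
    _ = ∑ q : Fin n × Fin n, ((∑ i, d i ^ 2) ^ 2 * (d q.1 ^ 2 * d q.2 ^ 2)) *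
        ∫ U, ‖B U q.1 q.2‖ ^ 4 ∂(haarUnitary 𝕜 n) := by
        rw [integral_finsetSum _ fun q _ => (hci q).const_mul _]
        exact Finset.sum_congr rfl fun q _ => integral_const_mul _ _
    _ ≤ ∑ q : Fin n × Fin n, ((∑ i, d i ^ 2) ^ 2 * (d q.1 ^ 2 * d q.2 ^ 2)) *
        (20736 * (hsSq A ^ 2 / (n : ℝ) ^ 4)) := by
        refine Finset.sum_le_sum fun q _ => ?_
        exact mul_le_mul_of_nonneg_left (hentry q) (by positivity)
    _ = _ := by
        rw [← Finset.sum_mul, ← Finset.mul_sum, hsum]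
        ring

/-- Diagonalize p: its eigenvector unitary is absorbed partly by the Haar average and partly by the
invariance of `hsSq`. -/
theorem integral_hsSq_sandwich_le {A p : Matrix (Fin n) (Fin n) 𝕜} (hA : A.IsHermitian)
    (hp : p.IsHermitian) :
    ∫ U : unitaryGroup (Fin n) 𝕜, hsSq (p *
        ((U : Matrix (Fin n) (Fin n) 𝕜) * centered A * star (U : Matrix (Fin n) (Fin n) 𝕜)) *
        p) ^ 2 ∂(haarUnitary 𝕜 n) ≤
      20736 * (∑ i, hp.eigenvalues i ^ 2) ^ 4 * (hsSq A ^ 2 / (n : ℝ) ^ 4) := by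
  refine le_trans (le_of_eq ?_) (integral_hsSq_diagonal_le hA hp.eigenvalues)
  set W : Matrix (Fin n) (Fin n) 𝕜 := (hp.eigenvectorUnitary : Matrix (Fin n) (Fin n) 𝕜)
  have hW : W ∈ unitaryGroup (Fin n) 𝕜 := hp.eigenvectorUnitary.2
  set D : Matrix (Fin n) (Fin n) 𝕜 := diagonal (fun i => (hp.eigenvalues i : 𝕜))
  have hpD : p = W * D * star W := by
    have := hp.spectral_theorem
    rwa [Unitary.conjStarAlgAut_apply] at this
  rw [← integral_haarUnitary_conj_mul hW (centered A) (fun M => hsSq (D * M * D) ^ 2)]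
  refine integral_congr_ae (Eventually.of_forall fun U => ?_)
  simp only
  rw [← hsSq_conj hW (D * _ * D)]
  conv_lhs => rw [hpD]
  simp only [mul_assoc]

theorem sum_eigenvalues_sq {r : ℕ} {p : Matrix (Fin n) (Fin n) 𝕜} (hp : p.IsHermitian)
    {θ : Fin r → ℝ} (h : NonzeroEigenvaluesAre hp θ) :
    ∑ i, hp.eigenvalues i ^ 2 = ∑ j, θ j ^ 2 := by
  have h2 := congrArg (fun m : Multiset ℝ => (m.map (· ^ 2)).sum) h
  simp only [Multiset.map_map, Multiset.filter_map] at h2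
  have h3 : ∑ j, θ j ^ 2 = (Finset.univ.val.map ((· ^ 2) ∘ θ)).sum := rfl
  rw [h3, ← h2]
  have h4 : (Multiset.map ((· ^ 2) ∘ hp.eigenvalues)
      (Multiset.filter ((fun x => x ≠ 0) ∘ hp.eigenvalues) Finset.univ.val)).sum =
      ∑ i with hp.eigenvalues i ≠ 0, hp.eigenvalues i ^ 2 := rfl
  rw [h4, Finset.sum_filter]
  refine Finset.sum_congr rfl fun i _ => ?_
  split_ifs with hi
  · rfl
  · rw [not_not.mp hi]; norm_num

/-- The normalized size of the compression to the range of `p` of the centered power `x ^ k`. -/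
def compression (k : ℕ) (x p : Matrix (Fin n) (Fin n) 𝕜) : ℝ :=
  hsSq (p * centered (x ^ k) * p) ^ 2 / (1 + (hsSq (x ^ k) / n) ^ 2)

theorem compression_nonneg (k : ℕ) (x p : Matrix (Fin n) (Fin n) 𝕜) : 0 ≤ compression k x p := by
  unfold compression; positivity

theorem continuous_compression (k : ℕ) :
    Continuous fun q : Matrix (Fin n) (Fin n) 𝕜 × Matrix (Fin n) (Fin n) 𝕜 =>
      compression k q.1 q.2 := by
  unfold compression
  have h1 : Continuous fun q : Matrix (Fin n) (Fin n) 𝕜 × Matrix (Fin n) (Fin n) 𝕜 => q.1 ^ k := by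
    fun_prop
  have h2 := continuous_hsSq.comp h1
  have h3 := continuous_hsSq.comp ((continuous_snd.mul (continuous_centered.comp h1)).mul
    continuous_snd)
  refine (h3.pow 2).div (continuous_const.add ((h2.div_const _).pow 2)) fun q => ?_
  positivity

theorem continuous_compression_conj (k : ℕ) : Continuous fun z : unitaryGroup (Fin n) 𝕜 ×
      (Matrix (Fin n) (Fin n) 𝕜 × Matrix (Fin n) (Fin n) 𝕜) =>
      compression k ((z.1 : Matrix (Fin n) (Fin n) 𝕜) * z.2.1 *
        star (z.1 : Matrix (Fin n) (Fin n) 𝕜)) z.2.2 := by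
  have hpair : Continuous fun z : unitaryGroup (Fin n) 𝕜 ×
      (Matrix (Fin n) (Fin n) 𝕜 × Matrix (Fin n) (Fin n) 𝕜) =>
      ((z.1 : Matrix (Fin n) (Fin n) 𝕜) * z.2.1 * star z.1.1, z.2.2) := by
    fun_prop
  have h := (continuous_compression (𝕜 := 𝕜) (n := n) k).comp hpair
  simp only [Function.comp_def] at h
  exact h

theorem compression_conj {U : Matrix (Fin n) (Fin n) 𝕜} (hU : U ∈ unitaryGroup (Fin n) 𝕜) (k : ℕ)
    (x p : Matrix (Fin n) (Fin n) 𝕜) :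
    compression k (U * x * star U) (U * p * star U) = compression k x p := by
  unfold compression
  rw [pow_conj hU, hsSq_conj hU, centered_conj hU, ← hsSq_conj hU (p * centered (x ^ k) * p)]
  congr 3
  calc _ = U * p * (star U * U) * centered (x ^ k) * (star U * U) * p * star U := by
        simp only [mul_assoc]
    _ = _ := by rw [mem_unitaryGroup_iff'.mp hU]; simp only [mul_assoc, one_mul]

/-- The raw bound is of order n⁻² (hsSq (x ^ k) / n)². Dividing by the denominator of `compression`,
which is unchanged by conjugation, removes the dependence on x, so no integrability of the random
matrix is required later. -/
theorem integral_compression_le {x p : Matrix (Fin n) (Fin n) 𝕜} (hx : x.IsHermitian)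
    (hp : p.IsHermitian) (k : ℕ) :
    ∫ U : unitaryGroup (Fin n) 𝕜, compression k
        ((U : Matrix (Fin n) (Fin n) 𝕜) * x * star (U : Matrix (Fin n) (Fin n) 𝕜)) p
        ∂(haarUnitary 𝕜 n) ≤
      20736 * (∑ i, hp.eigenvalues i ^ 2) ^ 4 / (n : ℝ) ^ 2 := by
  have h := integral_hsSq_sandwich_le (hx.pow k) hp
  have e : ∀ U : unitaryGroup (Fin n) 𝕜, compression k
        ((U : Matrix (Fin n) (Fin n) 𝕜) * x * star (U : Matrix (Fin n) (Fin n) 𝕜)) p =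
      hsSq (p * ((U : Matrix (Fin n) (Fin n) 𝕜) * centered (x ^ k) *
        star (U : Matrix (Fin n) (Fin n) 𝕜)) * p) ^ 2 / (1 + (hsSq (x ^ k) / n) ^ 2) := by
    intro U
    unfold compression
    rw [pow_conj U.2, hsSq_conj U.2, centered_conj U.2]
  simp only [e]
  rw [integral_div, div_le_iff₀ (by positivity)]
  refine h.trans ?_
  rcases eq_or_ne n 0 with rfl | hn
  · simp
  have hn' : (0 : ℝ) < n := Nat.cast_pos.mpr (Nat.pos_of_ne_zero hn)
  set T := (∑ i, hp.eigenvalues i ^ 2) ^ 4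
  have hT : 0 ≤ T := by positivity
  have h5 : 20736 * T / (n : ℝ) ^ 2 * (1 + (hsSq (x ^ k) / n) ^ 2) =
      20736 * T / (n : ℝ) ^ 2 + 20736 * T * (hsSq (x ^ k) ^ 2 / (n : ℝ) ^ 4) := by
    field_simp
  rw [h5]
  have : 0 ≤ 20736 * T / (n : ℝ) ^ 2 := by positivity
  linarith

variable {Ω : Type*} [MeasurableSpace Ω]

/-- By independence the joint law is the product of the marginals. If the law of X is invariant, the
rotated marginal is replaced directly. If that of P is, conjugating both arguments by U* transfers
the rotation from X to P. -/
theorem lintegral_conj_eq (Pr : Measure Ω) [IsProbabilityMeasure Pr]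
    {X P : Ω → Matrix (Fin n) (Fin n) 𝕜} (hXm : Measurable X) (hPm : Measurable P)
    (hindep : IndepFun X P Pr) (hinv : ConjInvariant Pr X ∨ ConjInvariant Pr P)
    {F : Matrix (Fin n) (Fin n) 𝕜 × Matrix (Fin n) (Fin n) 𝕜 → ENNReal} (hF : Measurable F)
    (hFinv : ∀ U ∈ unitaryGroup (Fin n) 𝕜, ∀ x p, F (U * x * star U, U * p * star U) = F (x, p))
    {U : Matrix (Fin n) (Fin n) 𝕜} (hU : U ∈ unitaryGroup (Fin n) 𝕜) :
    ∫⁻ ω, F (U * X ω * star U, P ω) ∂Pr = ∫⁻ ω, F (X ω, P ω) ∂Pr := by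
  have hconj : ∀ V : Matrix (Fin n) (Fin n) 𝕜,
      Measurable fun M : Matrix (Fin n) (Fin n) 𝕜 => V * M * star V := fun V =>
    Continuous.measurable (by fun_prop)
  have hlaw : ∀ Y Z : Ω → Matrix (Fin n) (Fin n) 𝕜, Measurable Y → Measurable Z →
      IndepFun Y Z Pr →
      ∫⁻ ω, F (Y ω, Z ω) ∂Pr = ∫⁻ q, F q ∂((Pr.map Y).prod (Pr.map Z)) := by
    intro Y Z hY hZ hYZ
    rw [← (indepFun_iff_map_prod_eq_prod_map_map hY.aemeasurable hZ.aemeasurable).mp hYZ,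
      lintegral_map hF (hY.prodMk hZ)]
  rcases hinv with h | h
  · rw [hlaw (fun ω => U * X ω * star U) _ ((hconj U).comp hXm) hPm
      (hindep.comp (hconj U) measurable_id),
      hlaw _ _ hXm hPm hindep, ← h U hU]
  · have hU' : star U ∈ unitaryGroup (Fin n) 𝕜 := Unitary.star_mem hU
    have e : ∀ ω, F (U * X ω * star U, P ω) = F (X ω, star U * P ω * star (star U)) := by
      intro ω
      rw [← hFinv _ hU']
      congr 2
      rw [star_star]
      calc _ = (star U * U) * X ω * (star U * U) := by simp only [mul_assoc]
        _ = _ := by rw [mem_unitaryGroup_iff'.mp hU, one_mul, mul_one]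
    simp only [e]
    rw [hlaw _ (fun ω => star U * P ω * star (star U)) hXm ((hconj (star U)).comp hPm)
      (hindep.comp measurable_id (hconj (star U))),
      hlaw _ _ hXm hPm hindep, ← h (star U) hU']

/-- The expectation does not change when X is rotated by a fixed U, hence equals its Haar average
over U. Tonelli puts the Haar integral inside, where the deterministic bound applies for each ω. -/
theorem lintegral_compression_le (Pr : Measure Ω) [IsProbabilityMeasure Pr]
    {X P : Ω → Matrix (Fin n) (Fin n) 𝕜} (hXm : Measurable X) (hPm : Measurable P)
    (hX : ∀ ω, (X ω).IsHermitian) (hP : ∀ ω, (P ω).IsHermitian)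
    (hindep : IndepFun X P Pr) (hinv : ConjInvariant Pr X ∨ ConjInvariant Pr P) {S : ℝ}
    (hS : ∀ᵐ ω ∂Pr, ∑ i, (hP ω).eigenvalues i ^ 2 = S) (k : ℕ) :
    ∫⁻ ω, ENNReal.ofReal (compression k (X ω) (P ω)) ∂Pr ≤
      ENNReal.ofReal (20736 * S ^ 4 / (n : ℝ) ^ 2) := by
  have hF : Measurable fun q : Matrix (Fin n) (Fin n) 𝕜 × Matrix (Fin n) (Fin n) 𝕜 =>
      ENNReal.ofReal (compression k q.1 q.2) :=
    (continuous_compression k).measurable.ennreal_ofReal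
  have hinvU : ∀ U : unitaryGroup (Fin n) 𝕜,
      ∫⁻ ω, ENNReal.ofReal (compression k ((U : Matrix (Fin n) (Fin n) 𝕜) * X ω *
        star (U : Matrix (Fin n) (Fin n) 𝕜)) (P ω)) ∂Pr =
      ∫⁻ ω, ENNReal.ofReal (compression k (X ω) (P ω)) ∂Pr := fun U =>
    lintegral_conj_eq Pr hXm hPm hindep hinv hF
      (fun V hV x p => by simp only [compression_conj hV]) U.2
  have hcont : Continuous fun z : unitaryGroup (Fin n) 𝕜 ×
      (Matrix (Fin n) (Fin n) 𝕜 × Matrix (Fin n) (Fin n) 𝕜) =>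
      compression k ((z.1 : Matrix (Fin n) (Fin n) 𝕜) * z.2.1 *
        star (z.1 : Matrix (Fin n) (Fin n) 𝕜)) z.2.2 :=
    continuous_compression_conj k
  have hjoint : Measurable fun z : unitaryGroup (Fin n) 𝕜 × Ω =>
      ENNReal.ofReal (compression k ((z.1 : Matrix (Fin n) (Fin n) 𝕜) * X z.2 *
        star (z.1 : Matrix (Fin n) (Fin n) 𝕜)) (P z.2)) := by
    have hpair : Measurable fun z : unitaryGroup (Fin n) 𝕜 × Ω => (z.1, (X z.2, P z.2)) :=
      measurable_fst.prodMk ((hXm.comp measurable_snd).prodMk (hPm.comp measurable_snd))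
    have hm := hcont.measurable.comp hpair
    simp only [Function.comp_def] at hm
    exact hm.ennreal_ofReal
  calc ∫⁻ ω, ENNReal.ofReal (compression k (X ω) (P ω)) ∂Pr
      = ∫⁻ U : unitaryGroup (Fin n) 𝕜, ∫⁻ ω, ENNReal.ofReal (compression k
          ((U : Matrix (Fin n) (Fin n) 𝕜) * X ω * star (U : Matrix (Fin n) (Fin n) 𝕜)) (P ω)) ∂Pr
          ∂(haarUnitary 𝕜 n) := by simp [hinvU]
    _ = ∫⁻ ω, ∫⁻ U : unitaryGroup (Fin n) 𝕜, ENNReal.ofReal (compression k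
          ((U : Matrix (Fin n) (Fin n) 𝕜) * X ω * star (U : Matrix (Fin n) (Fin n) 𝕜)) (P ω))
          ∂(haarUnitary 𝕜 n) ∂Pr := lintegral_lintegral_swap hjoint.aemeasurable
    _ ≤ ∫⁻ ω, ENNReal.ofReal (20736 * S ^ 4 / (n : ℝ) ^ 2) ∂Pr := by
        refine lintegral_mono_ae (hS.mono fun ω hω => ?_)
        rw [← ofReal_integral_eq_lintegral_ofReal]
        · refine ENNReal.ofReal_le_ofReal ?_
          rw [← hω]
          exact integral_compression_le (hX ω) (hP ω) k
        · have hpair : Continuous fun U : unitaryGroup (Fin n) 𝕜 => (U, (X ω, P ω)) := by fun_prop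
          have hc := hcont.comp hpair
          simp only [Function.comp_def] at hc
          exact integrable_haarUnitary hc
        · exact Eventually.of_forall fun U => compression_nonneg _ _ _
    _ = _ := by simp

/-- Almost surely, all compressed centered powers tend to zero. -/
theorem ae_tendsto_compression (Pr : Measure Ω) [IsProbabilityMeasure Pr]
    (X P : (n : ℕ) → Ω → Matrix (Fin n) (Fin n) 𝕜)
    (hXm : ∀ n, Measurable (X n)) (hPm : ∀ n, Measurable (P n))
    (hX : ∀ n ω, (X n ω).IsHermitian) (hP : ∀ n ω, (P n ω).IsHermitian)
    {r : ℕ} (θ : Fin r → ℝ)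
    (hPθ : ∀ n, r ≤ n → ∀ᵐ ω ∂Pr, NonzeroEigenvaluesAre (hP n ω) θ)
    (hindep : ∀ n, r ≤ n → IndepFun (X n) (P n) Pr)
    (hinv : ∀ n, r ≤ n → ConjInvariant Pr (X n) ∨ ConjInvariant Pr (P n)) :
    ∀ᵐ ω ∂Pr, ∀ k, Tendsto (fun n => compression k (X n ω) (P n ω)) atTop (𝓝 0) := by
  rw [ae_all_iff]
  intro k
  set S := ∑ j, θ j ^ 2
  have hbound : ∀ n, ∫⁻ ω, ENNReal.ofReal (compression k (X (n + r) ω) (P (n + r) ω)) ∂Pr ≤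
      ENNReal.ofReal (20736 * S ^ 4 * (1 / ((n + r : ℕ) : ℝ) ^ 2)) := by
    intro n
    have h := lintegral_compression_le Pr (hXm (n + r)) (hPm (n + r)) (hX (n + r)) (hP (n + r))
      (hindep _ (Nat.le_add_left _ _)) (hinv _ (Nat.le_add_left _ _))
      ((hPθ _ (Nat.le_add_left _ _)).mono fun ω hω => sum_eigenvalues_sq _ hω) k
    rwa [mul_one_div]
  have hmeas : ∀ n, Measurable fun ω =>
      ENNReal.ofReal (compression k (X (n + r) ω) (P (n + r) ω)) := fun n =>
    ((continuous_compression (𝕜 := 𝕜) (n := n + r) k).measurable.comp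
      ((hXm (n + r)).prodMk (hPm (n + r)))).ennreal_ofReal
  have hsummable : Summable fun n : ℕ => 20736 * S ^ 4 * (1 / ((n + r : ℕ) : ℝ) ^ 2) :=
    ((summable_nat_add_iff r).mpr (Real.summable_one_div_nat_pow.mpr one_lt_two)).mul_left _
  -- Borel–Cantelli in summed form: the expected sum is finite because Σ n⁻² is, so almost surely
  -- the series converges and its terms vanish. The shift by r keeps to the sizes where the
  -- assumptions hold.
  have hfin : ∫⁻ ω, ∑' n, ENNReal.ofReal (compression k (X (n + r) ω) (P (n + r) ω)) ∂Pr ≠ ⊤ := by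
    rw [lintegral_tsum fun n => (hmeas n).aemeasurable]
    refine ne_top_of_le_ne_top hsummable.tsum_ofReal_ne_top (ENNReal.tsum_le_tsum hbound)
  filter_upwards [ae_lt_top (Measurable.tsum hmeas) hfin] with ω hω
  have h0 := ENNReal.tendsto_atTop_zero_of_tsum_ne_top hω.ne
  have h1 := (ENNReal.tendsto_toReal ENNReal.zero_ne_top).comp h0
  simp only [ENNReal.toReal_zero] at h1
  refine (tendsto_add_atTop_iff_nat r).mp (h1.congr fun n => ?_)
  exact ENNReal.toReal_ofReal (compression_nonneg _ _ _)

end SpikedModel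

end

/-! ### Functional calculus in an eigenbasis -/

noncomputable section

namespace SpikedModel

section SpectralCalculus

variable {𝕜 : Type*} [RCLike 𝕜] {E : Type*} [NormedAddCommGroup E] [InnerProductSpace 𝕜 E]
  {ι : Type*} [Fintype ι]

/-- The function `f` of the self-adjoint operator with eigenbasis `b` and eigenvalues `l`. -/
def spectralFun (b : OrthonormalBasis ι 𝕜 E) (l : ι → ℝ) (f : ℝ → ℝ) : E →ₗ[𝕜] E where
  toFun x := ∑ i, ((f (l i) : ℝ) : 𝕜) • inner 𝕜 (b i) x • b i
  map_add' x y := by simp [inner_add_right, add_smul, smul_add, Finset.sum_add_distrib]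
  map_smul' c x := by
    simp only [inner_smul_right, RingHom.id_apply, Finset.smul_sum, smul_smul]
    exact Finset.sum_congr rfl fun i _ => by congr 1; ring

variable (b : OrthonormalBasis ι 𝕜 E) (l : ι → ℝ)

theorem spectralFun_apply (f : ℝ → ℝ) (x : E) :
    spectralFun b l f x = ∑ i, ((f (l i) : ℝ) : 𝕜) • inner 𝕜 (b i) x • b i := rfl

theorem inner_spectralFun_basis (f : ℝ → ℝ) (x : E) (i : ι) :
    inner 𝕜 (b i) (spectralFun b l f x) = ((f (l i) : ℝ) : 𝕜) * inner 𝕜 (b i) x := by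
  classical
  rw [spectralFun_apply, inner_sum]
  simp [inner_smul_right, b.inner_eq_ite]

theorem spectralFun_basis (f : ℝ → ℝ) (i : ι) :
    spectralFun b l f (b i) = ((f (l i) : ℝ) : 𝕜) • b i := by
  classical
  rw [spectralFun_apply]
  simp [b.inner_eq_ite]

theorem inner_spectralFun (f : ℝ → ℝ) (x y : E) :
    inner 𝕜 x (spectralFun b l f y) =
      ∑ i, ((f (l i) : ℝ) : 𝕜) * (inner 𝕜 x (b i) * inner 𝕜 (b i) y) := by
  rw [spectralFun_apply, inner_sum]
  simp only [inner_smul_right]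
  exact Finset.sum_congr rfl fun i _ => by ring

theorem spectralFun_congr {f g : ℝ → ℝ} (h : ∀ i, f (l i) = g (l i)) :
    spectralFun b l f = spectralFun b l g := by
  ext x
  simp only [spectralFun_apply, h]

theorem spectralFun_mul (f g : ℝ → ℝ) (x : E) :
    spectralFun b l f (spectralFun b l g x) = spectralFun b l (fun t => f t * g t) x := by
  rw [spectralFun_apply]
  simp only [inner_spectralFun_basis]
  simp only [spectralFun_apply, RCLike.ofReal_mul, smul_smul]
  exact Finset.sum_congr rfl fun i _ => by congr 1; ring

theorem spectralFun_one (x : E) : spectralFun b l (fun _ => 1) x = x := by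
  simp only [spectralFun_apply, RCLike.ofReal_one, one_smul]
  exact b.sum_repr' x

theorem spectralFun_symm (f : ℝ → ℝ) (x y : E) :
    inner 𝕜 (spectralFun b l f x) y = inner 𝕜 x (spectralFun b l f y) := by
  rw [inner_spectralFun, ← inner_conj_symm, inner_spectralFun, map_sum]
  refine Finset.sum_congr rfl fun i _ => ?_
  simp only [map_mul, RCLike.conj_ofReal, inner_conj_symm]
  ring

theorem spectralFun_sub (f g : ℝ → ℝ) (x : E) :
    spectralFun b l (fun t => f t - g t) x = spectralFun b l f x - spectralFun b l g x := by
  simp only [spectralFun_apply, RCLike.ofReal_sub, sub_smul, Finset.sum_sub_distrib]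

theorem spectralFun_add (f g : ℝ → ℝ) (x : E) :
    spectralFun b l (fun t => f t + g t) x = spectralFun b l f x + spectralFun b l g x := by
  simp only [spectralFun_apply, RCLike.ofReal_add, add_smul, Finset.sum_add_distrib]

theorem spectralFun_const_mul (c : ℝ) (f : ℝ → ℝ) (x : E) :
    spectralFun b l (fun t => c * f t) x = (c : 𝕜) • spectralFun b l f x := by
  simp only [spectralFun_apply, RCLike.ofReal_mul, mul_smul, Finset.smul_sum]

/-- Parseval together with 2st ≤ s² + t². Only the values of f at the eigenvalues enter, so uniform
control of f near the limiting support is enough. -/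
theorem norm_inner_spectralFun_le {f : ℝ → ℝ} {C : ℝ} (hC : 0 ≤ C)
    (hf : ∀ i, |f (l i)| ≤ C) (x y : E)
    (hx : ‖x‖ ≤ 1) (hy : ‖y‖ ≤ 1) : ‖inner 𝕜 x (spectralFun b l f y)‖ ≤ C := by
  rw [inner_spectralFun]
  have hsx := b.sum_sq_norm_inner_right x
  have hsy := b.sum_sq_norm_inner_right y
  calc _ ≤ ∑ i, C * ((‖inner 𝕜 (b i) x‖ ^ 2 + ‖inner 𝕜 (b i) y‖ ^ 2) / 2) := by
        refine (norm_sum_le _ _).trans (Finset.sum_le_sum fun i _ => ?_)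
        rw [norm_mul, norm_mul, RCLike.norm_ofReal, norm_inner_symm x]
        refine mul_le_mul (hf i) ?_ (by positivity) hC
        nlinarith [sq_nonneg (‖inner 𝕜 (b i) x‖ - ‖inner 𝕜 (b i) y‖)]
    _ = C * ((‖x‖ ^ 2 + ‖y‖ ^ 2) / 2) := by
        rw [← Finset.mul_sum, ← Finset.sum_div, Finset.sum_add_distrib, hsx, hsy]
    _ ≤ C * 1 := by
        refine mul_le_mul_of_nonneg_left ?_ hC
        nlinarith [norm_nonneg x, norm_nonneg y]
    _ = C := mul_one C

variable {b l} {T : E →ₗ[𝕜] E}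

theorem eq_spectralFun_id (hT : ∀ i, T (b i) = ((l i : ℝ) : 𝕜) • b i) :
    T = spectralFun b l id := by
  refine b.toBasis.ext fun i => ?_
  simp [hT, spectralFun_basis]

theorem pow_eq_spectralFun (hT : ∀ i, T (b i) = ((l i : ℝ) : 𝕜) • b i) (k : ℕ) :
    T ^ k = spectralFun b l (fun t => t ^ k) := by
  induction k with
  | zero => ext x; simp [spectralFun_one]
  | succ k ih =>
    ext x
    rw [pow_succ, Module.End.mul_apply, ih, eq_spectralFun_id hT, spectralFun_mul]
    simp [pow_succ]

theorem re_inner_eq_sum (hT : ∀ i, T (b i) = ((l i : ℝ) : 𝕜) • b i) (x : E) :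
    RCLike.re (inner 𝕜 x (T x)) = ∑ i, l i * ‖inner 𝕜 (b i) x‖ ^ 2 := by
  rw [eq_spectralFun_id hT, inner_spectralFun, map_sum]
  refine Finset.sum_congr rfl fun i _ => ?_
  rw [RCLike.re_ofReal_mul, inner_mul_symm_re_eq_norm, norm_mul, norm_inner_symm x, id]
  ring

end SpectralCalculus

/-! ### Courant–Fischer bounds -/

section CourantFischer

variable {𝕜 : Type*} [RCLike 𝕜] {E : Type*} [NormedAddCommGroup E] [InnerProductSpace 𝕜 E]
  [FiniteDimensional 𝕜 E] {n : ℕ} {b : OrthonormalBasis (Fin n) 𝕜 E} {l : Fin n → ℝ}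
  {T : E →ₗ[𝕜] E}

theorem exists_mem_inner_eq_zero (v : Fin n → E) (W : Submodule 𝕜 E) (s : Finset (Fin n))
    (hs : s.card < Module.finrank 𝕜 W) : ∃ u ∈ W, u ≠ 0 ∧ ∀ j ∈ s, inner 𝕜 (v j) u = 0 := by
  let f : W →ₗ[𝕜] (s → 𝕜) :=
    LinearMap.pi fun j => (innerₛₗ 𝕜 (v j)).comp W.subtype
  have hker : LinearMap.ker f ≠ ⊥ := LinearMap.ker_ne_bot_of_finrank_lt (by simpa using hs)
  obtain ⟨u, hu, hu0⟩ := Submodule.exists_mem_ne_zero_of_ne_bot hker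
  refine ⟨u, u.2, by simpa using hu0, fun j hj => ?_⟩
  have := congrFun (LinearMap.mem_ker.mp hu) ⟨j, hj⟩
  simpa [f] using this

/-- A space of dimension exceeding i contains a nonzero vector orthogonal to the first i
eigenvectors, and there the form is at most l i times the squared norm. -/
theorem le_eigenvalue_of_le_form (hl : Antitone l)
    (hT : ∀ i, T (b i) = ((l i : ℝ) : 𝕜) • b i) (i : Fin n) {W : Submodule 𝕜 E}
    (hW : (i : ℕ) + 1 ≤ Module.finrank 𝕜 W) {y : ℝ}
    (h : ∀ u ∈ W, y * ‖u‖ ^ 2 ≤ RCLike.re (inner 𝕜 u (T u))) : y ≤ l i := by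
  obtain ⟨u, huW, hu0, hu⟩ := exists_mem_inner_eq_zero b W (Finset.Iio i) (by simpa using hW)
  have h1 := h u huW
  rw [re_inner_eq_sum hT, ← b.sum_sq_norm_inner_right u, Finset.mul_sum] at h1
  have h2 : ∑ j, l j * ‖inner 𝕜 (b j) u‖ ^ 2 ≤ ∑ j, l i * ‖inner 𝕜 (b j) u‖ ^ 2 := by
    refine Finset.sum_le_sum fun j _ => ?_
    by_cases hj : j < i
    · rw [hu j (by simpa using hj)]; simp
    · exact mul_le_mul_of_nonneg_right (hl (not_lt.mp hj)) (sq_nonneg _)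
  have h3 := h1.trans h2
  rw [← Finset.mul_sum, ← Finset.mul_sum, b.sum_sq_norm_inner_right u] at h3
  exact le_of_mul_le_mul_right h3 (by positivity)

/-- Same dimension count, against the eigenvectors after position i. -/
theorem eigenvalue_le_of_form_le (hl : Antitone l)
    (hT : ∀ i, T (b i) = ((l i : ℝ) : 𝕜) • b i) (i : Fin n) {W : Submodule 𝕜 E}
    (hW : n ≤ Module.finrank 𝕜 W + i) {y : ℝ}
    (h : ∀ u ∈ W, RCLike.re (inner 𝕜 u (T u)) ≤ y * ‖u‖ ^ 2) : l i ≤ y := by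
  obtain ⟨u, huW, hu0, hu⟩ := exists_mem_inner_eq_zero b W (Finset.Ioi i) (by
    rw [Fin.card_Ioi]; omega)
  have h1 := h u huW
  rw [re_inner_eq_sum hT, ← b.sum_sq_norm_inner_right u, Finset.mul_sum] at h1
  have h2 : ∑ j, l i * ‖inner 𝕜 (b j) u‖ ^ 2 ≤ ∑ j, l j * ‖inner 𝕜 (b j) u‖ ^ 2 := by
    refine Finset.sum_le_sum fun j _ => ?_
    by_cases hj : i < j
    · rw [hu j (by simpa using hj)]; simp
    · exact mul_le_mul_of_nonneg_right (hl (not_lt.mp hj)) (sq_nonneg _)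
  have h3 := h2.trans h1
  rw [← Finset.mul_sum, ← Finset.mul_sum, b.sum_sq_norm_inner_right u] at h3
  exact le_of_mul_le_mul_right h3 (by positivity)

end CourantFischer

/-! ### Comparing a positive form with a finite-rank perturbation -/

section Location

variable {𝕜 : Type*} [RCLike 𝕜] {E : Type*} [NormedAddCommGroup E] [InnerProductSpace 𝕜 E]
  {r : ℕ}

theorem sum_norm_sq_le_card_mul (c : Fin r → 𝕜) :
    (∑ j, ‖c j‖) ^ 2 ≤ r * ∑ j, ‖c j‖ ^ 2 := by
  simpa using sq_sum_le_card_mul_sum_sq (s := (Finset.univ : Finset (Fin r))) (f := fun j => ‖c j‖)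

theorem norm_inner_sum_sub_le {v x : Fin r → E} {g η : ℝ}
    (hM : ∀ i j, ‖inner 𝕜 (v i) (x j) - (if i = j then (g : 𝕜) else 0)‖ ≤ η) (c : Fin r → 𝕜)
    (i : Fin r) : ‖inner 𝕜 (v i) (∑ j, c j • x j) - (g : 𝕜) * c i‖ ≤ η * ∑ j, ‖c j‖ := by
  have e : inner 𝕜 (v i) (∑ j, c j • x j) - (g : 𝕜) * c i =
      ∑ j, c j * (inner 𝕜 (v i) (x j) - (if i = j then (g : 𝕜) else 0)) := by
    simp [inner_sum, inner_smul_right, mul_sub, Finset.sum_sub_distrib, mul_comm]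
  rw [e, Finset.mul_sum]
  refine (norm_sum_le _ _).trans (Finset.sum_le_sum fun j _ => ?_)
  rw [norm_mul, mul_comm]
  exact mul_le_mul_of_nonneg_right (hM i j) (norm_nonneg _)

/-- Since x j plays the role of D⁻¹ v j, the form of D at Σ c_j x_j is the form of the matrix ⟨v_i,
D⁻¹ v_j⟩ at c. An entrywise error η costs at most rη, by Σ_{i,j} |c_i||c_j| ≤ r Σ |c_j|². -/
theorem re_inner_sum_le {D : E →ₗ[𝕜] E} (hD : D.IsSymmetric) {v x : Fin r → E}
    (hx : ∀ j, D (x j) = v j) {g η : ℝ} (hη : 0 ≤ η)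
    (hM : ∀ i j, ‖inner 𝕜 (v i) (x j) - (if i = j then (g : 𝕜) else 0)‖ ≤ η) (c : Fin r → 𝕜) :
    RCLike.re (inner 𝕜 (∑ j, c j • x j) (D (∑ j, c j • x j))) ≤
      (g + r * η) * ∑ j, ‖c j‖ ^ 2 := by
  set u := ∑ j, c j • x j with hu
  have hDu : D u = ∑ j, c j • v j := by simp [hu, map_sum, hx]
  have e : inner 𝕜 u (D u) = ∑ i, starRingEnd 𝕜 (c i) * inner 𝕜 (v i) u := by
    rw [← hD, hDu, sum_inner]
    simp [inner_smul_left]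
  rw [e, map_sum]
  have hi : ∀ i, RCLike.re (starRingEnd 𝕜 (c i) * inner 𝕜 (v i) u) ≤
      g * ‖c i‖ ^ 2 + ‖c i‖ * (η * ∑ j, ‖c j‖) := by
    intro i
    have h1 := norm_inner_sum_sub_le hM c i
    have h2 : starRingEnd 𝕜 (c i) * inner 𝕜 (v i) u =
        ((g * ‖c i‖ ^ 2 : ℝ) : 𝕜) + starRingEnd 𝕜 (c i) * (inner 𝕜 (v i) u - (g : 𝕜) * c i) := by
      have : starRingEnd 𝕜 (c i) * c i = ((‖c i‖ ^ 2 : ℝ) : 𝕜) := by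
        rw [RCLike.conj_mul]; push_cast; rfl
      rw [mul_sub, RCLike.ofReal_mul, ← this]
      ring
    rw [h2, map_add, RCLike.ofReal_re]
    gcongr
    refine (RCLike.re_le_norm _).trans ?_
    rw [norm_mul, RCLike.norm_conj]
    gcongr
  refine (Finset.sum_le_sum fun i _ => hi i).trans ?_
  rw [Finset.sum_add_distrib, ← Finset.mul_sum, ← Finset.sum_mul]
  nlinarith [sum_norm_sq_le_card_mul c]

/-- If the resolvent matrix of `D` along `v` is close to `g` and `θ j * g > 1` on `J`, then the
perturbation dominates `D` on a subspace of dimension `#J`. -/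
theorem exists_subspace_form_le {D : E →ₗ[𝕜] E} (hD : D.IsSymmetric) {v x : Fin r → E}
    (hv : Orthonormal 𝕜 v) (hx : ∀ j, D (x j) = v j) {g η τ K : ℝ} (hη : 0 ≤ η) (hg : 0 ≤ g)
    (hM : ∀ i j, ‖inner 𝕜 (v i) (x j) - (if i = j then (g : 𝕜) else 0)‖ ≤ η)
    {θ : Fin r → ℝ} (hK : ∀ j, |θ j| ≤ K) {J : Finset (Fin r)} (hJ : ∀ j ∈ J, τ ≤ θ j)
    (hK0 : 0 ≤ K)
    (hsmall : g + r * η + K * (2 * g * (r * η) + r * (r * η ^ 2)) ≤ g ^ 2 * τ) :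
    ∃ W : Submodule 𝕜 E, Module.finrank 𝕜 W = J.card ∧
      ∀ u ∈ W, RCLike.re (inner 𝕜 u (D u)) ≤ ∑ j, θ j * ‖inner 𝕜 (v j) u‖ ^ 2 := by
  classical
  have hli : LinearIndependent 𝕜 x := by
    refine LinearIndependent.of_comp D ?_
    have : (D ∘ x) = v := funext hx
    rw [this]
    exact hv.linearIndependent
  -- On the span of D⁻¹ v_j, j ∈ J, the form of D is about g|c|², while ⟨v_j, u⟩ ≈ g c_j makes the
  -- perturbation at least about g² τ |c|². The hypothesis `hsmall` is this comparison with all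
  -- error terms included.
  refine ⟨Submodule.span 𝕜 (x '' J), ?_, fun u hu => ?_⟩
  · have h1 := finrank_span_eq_card (hli.comp (fun j : J => (j : Fin r)) Subtype.val_injective)
    rw [Set.range_comp, Subtype.range_coe_subtype] at h1
    simpa using h1
  · obtain ⟨c₀, hc₀⟩ := (Submodule.mem_span_image_finset_iff_exists_fun 𝕜).mp hu
    -- The coefficients vanish off J, so the uncontrolled θ j with j ∉ J enter only through the
    -- error terms, bounded with K.
    set c : Fin r → 𝕜 := fun j => if h : j ∈ J then c₀ ⟨j, h⟩ else 0 with hc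
    have huc : u = ∑ j, c j • x j := by
      rw [← hc₀, ← Finset.sum_subset J.subset_univ (fun j _ hj => by simp [hc, hj]),
        ← Finset.sum_coe_sort J]
      exact Finset.sum_congr rfl fun j _ => by simp [hc]
    have h1 := re_inner_sum_le hD hx hη hM c
    rw [← huc] at h1
    refine h1.trans ?_
    set t := ∑ j, ‖c j‖
    set s := ∑ j, ‖c j‖ ^ 2 with hs
    have ht : t ^ 2 ≤ r * s := sum_norm_sq_le_card_mul c
    have ht0 : 0 ≤ t := Finset.sum_nonneg fun _ _ => norm_nonneg _
    have hs0 : 0 ≤ s := Finset.sum_nonneg fun _ _ => sq_nonneg _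
    have hi : ∀ i, g ^ 2 * τ * ‖c i‖ ^ 2 - K * (2 * g * ‖c i‖ * (η * t) + (η * t) ^ 2) ≤
        θ i * ‖inner 𝕜 (v i) u‖ ^ 2 := by
      intro i
      have h2 := norm_inner_sum_sub_le hM c i
      rw [← huc] at h2
      set z := inner 𝕜 (v i) u
      have hgc : ‖(g : 𝕜) * c i‖ = g * ‖c i‖ := by
        rw [norm_mul, RCLike.norm_ofReal, abs_of_nonneg hg]
      have h3 : |‖z‖ - g * ‖c i‖| ≤ η * t := by
        rw [← hgc]
        exact (abs_norm_sub_norm_le _ _).trans h2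
      have h4 : |‖z‖ ^ 2 - (g * ‖c i‖) ^ 2| ≤ 2 * g * ‖c i‖ * (η * t) + (η * t) ^ 2 := by
        have : ‖z‖ ^ 2 - (g * ‖c i‖) ^ 2 =
            2 * (g * ‖c i‖) * (‖z‖ - g * ‖c i‖) + (‖z‖ - g * ‖c i‖) ^ 2 := by ring
        rw [this]
        refine (abs_add_le _ _).trans ?_
        rw [abs_mul, abs_of_nonneg (by positivity : 0 ≤ 2 * (g * ‖c i‖)), abs_pow]
        have : 2 * (g * ‖c i‖) = 2 * g * ‖c i‖ := by ring
        rw [this]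
        gcongr
      have h5 : -(K * (2 * g * ‖c i‖ * (η * t) + (η * t) ^ 2)) ≤
          θ i * (‖z‖ ^ 2 - (g * ‖c i‖) ^ 2) := by
        refine (neg_le_neg ?_).trans (neg_abs_le _)
        rw [abs_mul]
        exact mul_le_mul (hK i) h4 (abs_nonneg _) hK0
      have h6 : g ^ 2 * τ * ‖c i‖ ^ 2 ≤ θ i * (g * ‖c i‖) ^ 2 := by
        by_cases hiJ : i ∈ J
        · have := mul_le_mul_of_nonneg_right (hJ i hiJ) (sq_nonneg (g * ‖c i‖))
          nlinarith
        · simp [hc, hiJ]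
      nlinarith
    refine le_trans ?_ (Finset.sum_le_sum fun i _ => hi i)
    have e : ∑ i, (g ^ 2 * τ * ‖c i‖ ^ 2 - K * (2 * g * ‖c i‖ * (η * t) + (η * t) ^ 2)) =
        g ^ 2 * τ * s - K * (2 * g * η * t ^ 2 + r * (η ^ 2 * t ^ 2)) := by
      rw [Finset.sum_sub_distrib, ← Finset.mul_sum, ← Finset.mul_sum, Finset.sum_add_distrib,
        ← Finset.sum_mul, ← Finset.mul_sum]
      simp
      ring
    rw [e]
    have h7 : K * (2 * g * η * t ^ 2 + r * (η ^ 2 * t ^ 2)) ≤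
        K * (2 * g * η * (r * s) + r * (η ^ 2 * (r * s))) := by gcongr
    have h8 := mul_le_mul_of_nonneg_right hsmall hs0
    nlinarith

/-- If the resolvent matrix of `D` along `v` is close to `g` and `θ j * g < 1` off `J`, then `D`
dominates the perturbation on a subspace of codimension at most `#J`. -/
theorem exists_subspace_le_form [FiniteDimensional 𝕜 E] {D : E →ₗ[𝕜] E} (hD : D.IsSymmetric)
    (hpos : ∀ u, 0 ≤ RCLike.re (inner 𝕜 u (D u))) {v x : Fin r → E}
    (hx : ∀ j, D (x j) = v j) {g η τ : ℝ} (hη : 0 ≤ η) (hτ : 0 ≤ τ)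
    (hM : ∀ i j, ‖inner 𝕜 (v i) (x j) - (if i = j then (g : 𝕜) else 0)‖ ≤ η)
    {θ : Fin r → ℝ} {J : Finset (Fin r)} (hJ : ∀ j ∉ J, θ j ≤ τ)
    (hsmall : τ * (g + r * η) ≤ 1) :
    ∃ W : Submodule 𝕜 E, Module.finrank 𝕜 E ≤ Module.finrank 𝕜 W + J.card ∧
      ∀ u ∈ W, ∑ j, θ j * ‖inner 𝕜 (v j) u‖ ^ 2 ≤ RCLike.re (inner 𝕜 u (D u)) := by
  -- The subspace is the orthogonal complement of the v j with j ∈ J, so only the θ j below τ remain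
  -- in the perturbation.
  let f : E →ₗ[𝕜] (J → 𝕜) := LinearMap.pi fun j => innerₛₗ 𝕜 (v j)
  refine ⟨LinearMap.ker f, ?_, fun u hu => ?_⟩
  · have h1 := f.finrank_range_add_finrank_ker
    have h2 := Submodule.finrank_le (LinearMap.range f)
    simp only [Module.finrank_fintype_fun_eq_card, Fintype.card_coe] at h2
    omega
  · have hu0 : ∀ j ∈ J, inner 𝕜 (v j) u = 0 := fun j hj => by
      simpa [f] using congrFun (LinearMap.mem_ker.mp hu) ⟨j, hj⟩
    set c : Fin r → 𝕜 := fun j => inner 𝕜 (v j) u with hc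
    set s := ∑ j, ‖c j‖ ^ 2 with hs
    have hs0 : 0 ≤ s := Finset.sum_nonneg fun _ _ => sq_nonneg _
    have h1 : ∑ j, θ j * ‖c j‖ ^ 2 ≤ τ * s := by
      rw [hs, Finset.mul_sum]
      refine Finset.sum_le_sum fun j _ => ?_
      by_cases hj : j ∈ J
      · simp [hc, hu0 j hj]
      · exact mul_le_mul_of_nonneg_right (hJ j hj) (sq_nonneg _)
    refine h1.trans ?_
    set w := ∑ j, c j • x j with hw
    have h2 := re_inner_sum_le hD hx hη hM c
    rw [← hw, ← hs] at h2
    have hDw : D w = ∑ j, c j • v j := by simp [hw, map_sum, hx]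
    have h3 : inner 𝕜 (D w) u = ((s : ℝ) : 𝕜) := by
      rw [hDw, sum_inner, hs, RCLike.ofReal_sum]
      refine Finset.sum_congr rfl fun j _ => ?_
      rw [inner_smul_left, RCLike.conj_mul]
      push_cast; rfl
    have h4 : inner 𝕜 w (D u) = ((s : ℝ) : 𝕜) := by rw [← hD, h3]
    have h5 : inner 𝕜 u (D w) = ((s : ℝ) : 𝕜) := by
      rw [← inner_conj_symm, h3, RCLike.conj_ofReal]
    -- Completing the square with w = Σ ⟨v_j, u⟩ D⁻¹ v_j: positivity of D at u - τw gives ⟨u, Du⟩ ≥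
    -- 2τs - τ²⟨w, Dw⟩, and the last term is at most τs by `hsmall`.
    have h6 := hpos (u - (τ : 𝕜) • w)
    have e : RCLike.re (inner 𝕜 (u - (τ : 𝕜) • w) (D (u - (τ : 𝕜) • w))) =
        RCLike.re (inner 𝕜 u (D u)) - 2 * τ * s + τ ^ 2 * RCLike.re (inner 𝕜 w (D w)) := by
      rw [map_sub, map_smul, inner_sub_left, inner_sub_right, inner_sub_right, inner_smul_left,
        inner_smul_left, inner_smul_right, inner_smul_right, h4, h5]
      simp only [map_sub, RCLike.conj_ofReal, RCLike.re_ofReal_mul, RCLike.ofReal_re]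
      ring
    rw [e] at h6
    have h7 : τ ^ 2 * RCLike.re (inner 𝕜 w (D w)) ≤ τ ^ 2 * ((g + r * η) * s) := by gcongr
    have h8 := mul_le_mul_of_nonneg_left hsmall (mul_nonneg hτ hs0)
    nlinarith

end Location

end SpikedModel

end

/-! ### The Cauchy transform off the support -/

noncomputable section

namespace SpikedModel

section Cauchy

theorem ae_mem_Icc_edge (μ : Measure ℝ) (hμ : IsCompact μ.support) :
    ∀ᵐ t ∂μ, t ∈ Set.Icc (edgeInf μ) (edgeSup μ) := by
  filter_upwards [Measure.support_mem_ae (μ := μ)] with t ht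
  exact ⟨csInf_le hμ.bddBelow ht, le_csSup hμ.bddAbove ht⟩

theorem exists_pos_le_abs_sub {a b z : ℝ} (hz : z ∉ Set.Icc a b) :
    ∃ δ > 0, ∀ t ∈ Set.Icc a b, δ ≤ |z - t| := by
  rw [Set.mem_Icc, not_and_or, not_le, not_le] at hz
  rcases hz with hz | hz
  · refine ⟨a - z, sub_pos.mpr hz, fun t ht => ?_⟩
    rw [abs_sub_comm]
    exact le_trans (by linarith [ht.1]) (le_abs_self _)
  · refine ⟨z - b, sub_pos.mpr hz, fun t ht => ?_⟩
    exact le_trans (by linarith [ht.2]) (le_abs_self _)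

variable {μ : Measure ℝ} [IsProbabilityMeasure μ] {a b : ℝ}

theorem exists_mem_Icc_of_ae (h : ∀ᵐ t ∂μ, t ∈ Set.Icc a b) : a ≤ b := by
  obtain ⟨t, ht⟩ := h.exists
  exact ht.1.trans ht.2

theorem integrable_of_ae_mem_Icc (h : ∀ᵐ t ∂μ, t ∈ Set.Icc a b) {f : ℝ → ℝ} (hf : Measurable f)
    {C : ℝ} (hC : ∀ t ∈ Set.Icc a b, |f t| ≤ C) : Integrable f μ :=
  Integrable.of_bound hf.aestronglyMeasurable C (h.mono fun t ht => hC t ht)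

theorem integral_pos_of_ae_pos {f : ℝ → ℝ} (hf : Integrable f μ) (hpos : ∀ᵐ t ∂μ, 0 < f t) :
    0 < ∫ t, f t ∂μ := by
  refine lt_of_le_of_ne (integral_nonneg_of_ae (hpos.mono fun t ht => ht.le)) fun h0 => ?_
  have h1 := (integral_eq_zero_iff_of_nonneg_ae (hpos.mono fun t ht => ht.le) hf).mp h0.symm
  obtain ⟨t, ht, ht'⟩ := (h1.and hpos).exists
  exact ht'.ne' ht

theorem integrable_cauchy (h : ∀ᵐ t ∂μ, t ∈ Set.Icc a b) {z : ℝ} (hz : z ∉ Set.Icc a b) :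
    Integrable (fun t => 1 / (z - t)) μ := by
  obtain ⟨δ, hδ, hd⟩ := exists_pos_le_abs_sub hz
  refine integrable_of_ae_mem_Icc h (by fun_prop) (C := 1 / δ) fun t ht => ?_
  rw [abs_div, abs_one]
  exact one_div_le_one_div_of_le hδ (hd t ht)

theorem integrable_cauchy_sq (h : ∀ᵐ t ∂μ, t ∈ Set.Icc a b) {z : ℝ} (hz : z ∉ Set.Icc a b) :
    Integrable (fun t => 1 / (z - t) ^ 2) μ := by
  obtain ⟨δ, hδ, hd⟩ := exists_pos_le_abs_sub hz
  refine integrable_of_ae_mem_Icc h (by fun_prop) (C := 1 / δ ^ 2) fun t ht => ?_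
  rw [abs_div, abs_one, abs_pow]
  exact one_div_le_one_div_of_le (by positivity) (pow_le_pow_left₀ hδ.le (hd t ht) 2)

theorem hasDerivAt_cauchyG (h : ∀ᵐ t ∂μ, t ∈ Set.Icc a b) {z : ℝ} (hz : z ∉ Set.Icc a b) :
    HasDerivAt (cauchyG μ) (-∫ t, 1 / (z - t) ^ 2 ∂μ) z := by
  obtain ⟨δ, hδ, hd⟩ := exists_pos_le_abs_sub hz
  rw [← integral_neg]
  have hsub : ∀ t ∈ Set.Icc a b, ∀ w ∈ Metric.ball z (δ / 2), δ / 2 ≤ |w - t| := by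
    intro t ht w hw
    rw [Metric.mem_ball, Real.dist_eq] at hw
    have h1 := hd t ht
    have h2 : |z - t| ≤ |w - z| + |w - t| := by
      have := abs_sub_le z w t
      rwa [abs_sub_comm z w] at this
    linarith
  -- Points within δ/2 of z stay at distance at least δ/2 from [a,b], which gives a constant
  -- dominating function.
  refine (hasDerivAt_integral_of_dominated_loc_of_deriv_le (F := fun w t => 1 / (w - t))
    (F' := fun w t => -(1 / (w - t) ^ 2)) (bound := fun _ => 1 / (δ / 2) ^ 2)
    (Metric.ball_mem_nhds z (half_pos hδ)) (Eventually.of_forall fun w => ?_)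
    (integrable_cauchy h hz) ?_ ?_ (integrable_const _) ?_).2
  · exact (show Measurable fun t : ℝ => 1 / (w - t) by fun_prop).aestronglyMeasurable
  · exact (show Measurable fun t : ℝ => -(1 / (z - t) ^ 2) by fun_prop).aestronglyMeasurable
  · filter_upwards [h] with t ht w hw
    rw [norm_neg, Real.norm_eq_abs, abs_div, abs_one, abs_pow]
    exact one_div_le_one_div_of_le (by positivity)
      (pow_le_pow_left₀ (half_pos hδ).le (hsub t ht w hw) 2)
  · filter_upwards [h] with t ht w hw
    have hne : w - t ≠ 0 := fun h0 => by
      have := hsub t ht w hw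
      rw [h0, abs_zero] at this
      linarith
    have h1 := ((hasDerivAt_id w).sub_const t).inv hne
    simp only [id] at h1
    have e : (fun x : ℝ => 1 / (x - t)) = (fun x => x - t)⁻¹ := by ext x; simp
    change HasDerivAt (fun x : ℝ => 1 / (x - t)) (-(1 / (w - t) ^ 2)) w
    rw [e, ← neg_div]
    exact h1

theorem integral_cauchy_sq_pos (h : ∀ᵐ t ∂μ, t ∈ Set.Icc a b) {z : ℝ} (hz : z ∉ Set.Icc a b) :
    0 < ∫ t, 1 / (z - t) ^ 2 ∂μ := by
  refine integral_pos_of_ae_pos (integrable_cauchy_sq h hz) (h.mono fun t ht => ?_)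
  have : z - t ≠ 0 := fun h0 => hz (by rwa [sub_eq_zero.mp h0])
  positivity

theorem cauchyG_pos (h : ∀ᵐ t ∂μ, t ∈ Set.Icc a b) {z : ℝ} (hz : b < z) : 0 < cauchyG μ z := by
  refine integral_pos_of_ae_pos (integrable_cauchy h fun hm => hz.not_ge hm.2)
    (h.mono fun t ht => ?_)
  exact one_div_pos.mpr (by linarith [ht.2])

theorem cauchyG_neg (h : ∀ᵐ t ∂μ, t ∈ Set.Icc a b) {z : ℝ} (hz : z < a) : cauchyG μ z < 0 := by
  have h1 := integrable_cauchy h (z := z) fun hm => hz.not_ge hm.1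
  have := integral_pos_of_ae_pos h1.neg (h.mono fun t ht => by
    have : 1 / (z - t) < 0 := one_div_neg.mpr (by linarith [ht.1])
    simpa using this)
  simp only [Pi.neg_apply, integral_neg] at this
  unfold cauchyG
  linarith

theorem continuousOn_cauchyG (h : ∀ᵐ t ∂μ, t ∈ Set.Icc a b) :
    ContinuousOn (cauchyG μ) (Set.Icc a b)ᶜ := fun _ hz =>
  (hasDerivAt_cauchyG h hz).continuousAt.continuousWithinAt

theorem Ioi_subset_compl : Set.Ioi b ⊆ (Set.Icc a b)ᶜ := fun _ hz hm =>
  (Set.mem_Ioi.mp hz).not_ge hm.2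

theorem Iio_subset_compl : Set.Iio a ⊆ (Set.Icc a b)ᶜ := fun _ hz hm =>
  (Set.mem_Iio.mp hz).not_ge hm.1

theorem strictAntiOn_cauchyG (h : ∀ᵐ t ∂μ, t ∈ Set.Icc a b) {D : Set ℝ} (hD : Convex ℝ D)
    (hsub : D ⊆ (Set.Icc a b)ᶜ) : StrictAntiOn (cauchyG μ) D := by
  refine strictAntiOn_of_deriv_neg hD ((continuousOn_cauchyG h).mono hsub) fun z hz => ?_
  have hz' := hsub (interior_subset hz)
  rw [(hasDerivAt_cauchyG h hz').deriv]
  linarith [integral_cauchy_sq_pos h hz']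

theorem cauchyG_le (h : ∀ᵐ t ∂μ, t ∈ Set.Icc a b) {z : ℝ} (hz : b < z) :
    cauchyG μ z ≤ 1 / (z - b) := by
  have h1 := integrable_cauchy h (z := z) fun hm => hz.not_ge hm.2
  refine (integral_mono_ae h1 (integrable_const (1 / (z - b))) (h.mono fun t ht => ?_)).trans
    (by simp)
  exact one_div_le_one_div_of_le (sub_pos.mpr hz) (by linarith [ht.2])

theorem le_cauchyG (h : ∀ᵐ t ∂μ, t ∈ Set.Icc a b) {z : ℝ} (hz : z < a) :
    1 / (z - a) ≤ cauchyG μ z := by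
  have h1 := integrable_cauchy h (z := z) fun hm => hz.not_ge hm.1
  refine le_trans (by simp) (integral_mono_ae (integrable_const (1 / (z - a))) h1
    (h.mono fun t ht => ?_))
  exact one_div_le_one_div_of_neg_of_le (sub_neg.mpr hz) (by linarith [ht.1])

/-- `Function.rightLim` is a genuine limit only when that limit exists. Here it does, because G is
antitone beyond the edge and `EReal` is complete, so G exceeds y somewhere close to the edge. -/
theorem exists_gt_of_lt_cauchyAtSup (hμ : IsCompact μ.support) {y : ℝ}
    (hy : (y : EReal) < cauchyAtSup μ) : ∃ z, edgeSup μ < z ∧ y < cauchyG μ z := by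
  have h := ae_mem_Icc_edge μ hμ
  have hanti : AntitoneOn (fun z => (cauchyG μ z : EReal)) (Set.Ioi (edgeSup μ)) :=
    fun x hx w hw hxw => EReal.coe_le_coe_iff.mpr
      ((strictAntiOn_cauchyG h (convex_Ioi _) Ioi_subset_compl).antitoneOn hx hw hxw)
  have ht := tendsto_rightLim_of_tendsto ⟨_, hanti.tendsto_nhdsGT (OrderTop.bddAbove _)⟩
  have hev := (ht.eventually (lt_mem_nhds hy)).and self_mem_nhdsWithin
  obtain ⟨z, hz1, hz2⟩ := hev.exists
  exact ⟨z, hz2, EReal.coe_lt_coe_iff.mp hz1⟩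

theorem exists_lt_of_cauchyAtInf_lt (hμ : IsCompact μ.support) {y : ℝ}
    (hy : cauchyAtInf μ < (y : EReal)) : ∃ z, z < edgeInf μ ∧ cauchyG μ z < y := by
  have h := ae_mem_Icc_edge μ hμ
  have hanti : AntitoneOn (fun z => (cauchyG μ z : EReal)) (Set.Iio (edgeInf μ)) :=
    fun x hx w hw hxw => EReal.coe_le_coe_iff.mpr
      ((strictAntiOn_cauchyG h (convex_Iio _) Iio_subset_compl).antitoneOn hx hw hxw)
  have ht := tendsto_leftLim_of_tendsto ⟨_, hanti.tendsto_nhdsLT (OrderBot.bddBelow _)⟩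
  have hev := (ht.eventually (gt_mem_nhds hy)).and self_mem_nhdsWithin
  obtain ⟨z, hz1, hz2⟩ := hev.exists
  exact ⟨z, hz2, EReal.coe_lt_coe_iff.mp hz1⟩

theorem exists_unique_cauchyG_eq (hμ : IsCompact μ.support) {θ : ℝ} (hθ : θ ≠ 0)
    (hmem : ((1 / θ : ℝ) : EReal) ∈ Set.Ioo (cauchyAtInf μ) (cauchyAtSup μ)) :
    ∃ ρ, ρ ∉ Set.Icc (edgeInf μ) (edgeSup μ) ∧ cauchyG μ ρ = 1 / θ ∧
      ∀ z ∉ Set.Icc (edgeInf μ) (edgeSup μ), cauchyG μ z = 1 / θ → z = ρ := by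
  have h := ae_mem_Icc_edge μ hμ
  set a := edgeInf μ
  set b := edgeSup μ
  have hcont := continuousOn_cauchyG h
  rcases lt_or_gt_of_ne hθ with hneg | hpos
  · have hinv : 1 / θ < 0 := one_div_neg.mpr hneg
    obtain ⟨z₁, hz₁, hg₁⟩ := exists_lt_of_cauchyAtInf_lt hμ hmem.1
    -- At distance 2|θ| below the edge, |G| ≤ 1/(2|θ|), which is less than 1/|θ|. This is the second
    -- endpoint for the intermediate value theorem; the first comes from the one-sided limit at the
    -- edge.
    have hz₂ : a + 2 * θ < a := by linarith
    have hg₂ : 1 / θ < cauchyG μ (a + 2 * θ) := by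
      refine lt_of_lt_of_le ?_ (le_cauchyG h hz₂)
      have : a + 2 * θ - a = 2 * θ := by ring
      rw [this]
      exact one_div_lt_one_div_of_neg_of_lt hneg (by linarith)
    obtain ⟨ρ, hρ, hgρ⟩ := isPreconnected_Iio.intermediate_value (Set.mem_Iio.mpr hz₁)
      (Set.mem_Iio.mpr hz₂) (hcont.mono Iio_subset_compl) ⟨hg₁.le, hg₂.le⟩
    refine ⟨ρ, Iio_subset_compl hρ, hgρ, fun z hz hgz => ?_⟩
    rw [Set.mem_Icc, not_and_or, not_le, not_le] at hz
    rcases hz with hz | hz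
    · exact (strictAntiOn_cauchyG h (convex_Iio _) Iio_subset_compl).injOn hz hρ
        (hgz.trans hgρ.symm)
    -- A solution on the other side of [a,b] is excluded by the sign of G.
    · have := cauchyG_pos h hz
      linarith
  · have hinv : 0 < 1 / θ := one_div_pos.mpr hpos
    obtain ⟨z₁, hz₁, hg₁⟩ := exists_gt_of_lt_cauchyAtSup hμ hmem.2
    have hz₂ : b < b + 2 * θ := by linarith
    have hg₂ : cauchyG μ (b + 2 * θ) < 1 / θ := by
      refine lt_of_le_of_lt (cauchyG_le h hz₂) ?_
      have : b + 2 * θ - b = 2 * θ := by ring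
      rw [this]
      exact one_div_lt_one_div_of_lt hpos (by linarith)
    obtain ⟨ρ, hρ, hgρ⟩ := isPreconnected_Ioi.intermediate_value (Set.mem_Ioi.mpr hz₂)
      (Set.mem_Ioi.mpr hz₁) (hcont.mono Ioi_subset_compl) ⟨hg₂.le, hg₁.le⟩
    refine ⟨ρ, Ioi_subset_compl hρ, hgρ, fun z hz hgz => ?_⟩
    rw [Set.mem_Icc, not_and_or, not_le, not_le] at hz
    rcases hz with hz | hz
    · have := cauchyG_neg h hz
      linarith
    · exact (strictAntiOn_cauchyG h (convex_Ioi _) Ioi_subset_compl).injOn hz hρ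
        (hgz.trans hgρ.symm)

end Cauchy

end SpikedModel

end

/-! ### Ordered spectrum, traces and Hilbert–Schmidt bounds -/

noncomputable section

namespace SpikedModel

open Matrix

section Spectrum

variable {𝕜 : Type*} [RCLike 𝕜] {n : ℕ} {A : Matrix (Fin n) (Fin n) 𝕜}

/-- The reordering of the eigenvalues of a Hermitian matrix in decreasing order. -/
def sortEquiv (n : ℕ) : Fin n ≃ Fin n :=
  (finCongr (Fintype.card_fin n).symm).trans (Fintype.equivOfCardEq (Fintype.card_fin _))

theorem lam_succ_eq_eigenvalues (hA : A.IsHermitian) (i : Fin n) :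
    lam hA (i + 1) = hA.eigenvalues (sortEquiv n i) := by
  have h : 1 ≤ (i : ℕ) + 1 ∧ (i : ℕ) + 1 ≤ n := ⟨by omega, i.2⟩
  rw [lam, dif_pos h]
  simp only [IsHermitian.eigenvalues, sortEquiv, Equiv.trans_apply, Equiv.symm_apply_apply]
  rfl

/-- An orthonormal basis of eigenvectors, in decreasing order of the eigenvalues. -/
def sortedBasis (hA : A.IsHermitian) : OrthonormalBasis (Fin n) 𝕜 (EuclideanSpace 𝕜 (Fin n)) :=
  hA.eigenvectorBasis.reindex (sortEquiv n).symm

theorem toEuclideanLin_eigenvectorBasis (hA : A.IsHermitian) (i : Fin n) :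
    toEuclideanLin A (hA.eigenvectorBasis i) =
      ((hA.eigenvalues i : ℝ) : 𝕜) • hA.eigenvectorBasis i := by
  rw [toLpLin_apply, hA.mulVec_eigenvectorBasis, RCLike.real_smul_eq_coe_smul (K := 𝕜)]
  rfl

theorem toEuclideanLin_sortedBasis (hA : A.IsHermitian) (i : Fin n) :
    toEuclideanLin A (sortedBasis hA i) = ((lam hA (i + 1) : ℝ) : 𝕜) • sortedBasis hA i := by
  rw [lam_succ_eq_eigenvalues, sortedBasis, OrthonormalBasis.reindex_apply, Equiv.symm_symm]
  exact toEuclideanLin_eigenvectorBasis hA _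

theorem lam_succ_antitone (hA : A.IsHermitian) : Antitone fun i : Fin n => lam hA (i + 1) := by
  intro i j hij
  have h : ∀ i : Fin n, 1 ≤ (i : ℕ) + 1 ∧ (i : ℕ) + 1 ≤ n := fun i => ⟨by omega, i.2⟩
  simp only [lam, dif_pos (h _)]
  refine hA.eigenvalues₀_antitone ?_
  simpa using hij

theorem trace_pow_eq_sum (hA : A.IsHermitian) (k : ℕ) :
    (A ^ k).trace = ((∑ i : Fin n, lam hA (i + 1) ^ k : ℝ) : 𝕜) := by
  have h : A = (hA.eigenvectorUnitary : Matrix (Fin n) (Fin n) 𝕜) *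
      diagonal (fun i => ((hA.eigenvalues i : ℝ) : 𝕜)) *
      star (hA.eigenvectorUnitary : Matrix (Fin n) (Fin n) 𝕜) := by
    have := hA.spectral_theorem
    rwa [Unitary.conjStarAlgAut_apply] at this
  conv_lhs => rw [h]
  rw [pow_conj hA.eigenvectorUnitary.2, trace_conj hA.eigenvectorUnitary.2, diagonal_pow,
    trace_diagonal]
  simp only [lam_succ_eq_eigenvalues, Pi.pow_apply]
  rw [Equiv.sum_comp (sortEquiv n) (fun i => hA.eigenvalues i ^ k)]
  push_cast
  rfl

theorem hsSq_pow_eq_sum (hA : A.IsHermitian) (k : ℕ) :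
    hsSq (A ^ k) = ∑ i : Fin n, lam hA (i + 1) ^ (k + k) := by
  apply RCLike.ofReal_injective (K := 𝕜)
  rw [hsSq_eq_trace, ← trace_pow_eq_sum, pow_add]
  congr 2
  exact (hA.pow k).eq

theorem norm_toEuclideanLin_sq_le (M : Matrix (Fin n) (Fin n) 𝕜) (x : EuclideanSpace 𝕜 (Fin n)) :
    ‖toEuclideanLin M x‖ ^ 2 ≤ hsSq M * ‖x‖ ^ 2 := by
  rw [EuclideanSpace.norm_sq_eq, EuclideanSpace.norm_sq_eq, hsSq, Finset.sum_mul]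
  refine Finset.sum_le_sum fun i _ => ?_
  rw [toLpLin_apply]
  have h1 : ‖(M *ᵥ x.ofLp) i‖ ≤ ∑ j, ‖M i j‖ * ‖x j‖ := by
    change ‖∑ j, M i j * x j‖ ≤ _
    refine (norm_sum_le _ _).trans (Finset.sum_le_sum fun j _ => ?_)
    rw [norm_mul]
  calc ‖(M *ᵥ x.ofLp) i‖ ^ 2 ≤ (∑ j, ‖M i j‖ * ‖x j‖) ^ 2 :=
        pow_le_pow_left₀ (norm_nonneg _) h1 2
    _ ≤ _ := Finset.sum_mul_sq_le_sq_mul_sq _ _ _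

/-- Between eigenvectors of P, the form of PXP is st times that of X, and the operator norm is at
most the Hilbert–Schmidt norm. For nonzero s and t, a bound on PXP thus controls the entries of X in
any choice of eigenvectors. -/
theorem norm_inner_centered_sq_le {X P : Matrix (Fin n) (Fin n) 𝕜} (hP : P.IsHermitian)
    {x y : EuclideanSpace 𝕜 (Fin n)} (hx : ‖x‖ = 1) (hy : ‖y‖ = 1) {s t : ℝ}
    (hPx : toEuclideanLin P x = (s : 𝕜) • x) (hPy : toEuclideanLin P y = (t : 𝕜) • y) :
    (s * t) ^ 2 * ‖inner 𝕜 x (toEuclideanLin X y)‖ ^ 2 ≤ hsSq (P * X * P) := by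
  have h1 : inner 𝕜 x (toEuclideanLin (P * X * P) y) =
      ((s * t : ℝ) : 𝕜) * inner 𝕜 x (toEuclideanLin X y) := by
    rw [toLpLin_mul_same, toLpLin_mul_same, LinearMap.comp_apply, LinearMap.comp_apply, hPy,
      map_smul, map_smul, inner_smul_right, ← (isSymmetric_toEuclideanLin_iff.mpr hP), hPx,
      inner_smul_left, RCLike.conj_ofReal]
    push_cast
    ring
  have h2 := norm_toEuclideanLin_sq_le (P * X * P) y
  have h3 := norm_inner_le_norm (𝕜 := 𝕜) x (toEuclideanLin (P * X * P) y)
  rw [hx, one_mul, h1, norm_mul, RCLike.norm_ofReal] at h3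
  rw [hy, one_pow, mul_one] at h2
  calc _ = (|s * t| * ‖inner 𝕜 x (toEuclideanLin X y)‖) ^ 2 := by rw [mul_pow |s * t|, sq_abs]
    _ ≤ ‖toEuclideanLin (P * X * P) y‖ ^ 2 := pow_le_pow_left₀ (by positivity) h3 2
    _ ≤ _ := h2

theorem inner_centered (X : Matrix (Fin n) (Fin n) 𝕜) (x y : EuclideanSpace 𝕜 (Fin n)) :
    inner 𝕜 x (toEuclideanLin (centered X) y) =
      inner 𝕜 x (toEuclideanLin X y) - X.trace / n * inner 𝕜 x y := by
  rw [centered, map_sub, map_smul, toLpLin_one, LinearMap.sub_apply, inner_sub_right,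
    LinearMap.smul_apply, inner_smul_right, LinearMap.id_apply]

end Spectrum

/-! ### Eigenvectors and eigenspaces of the perturbation -/

section Perturbation

variable {𝕜 : Type*} [RCLike 𝕜] {n r : ℕ} {P : Matrix (Fin n) (Fin n) 𝕜} {θ : Fin r → ℝ}

/-- Equality of multisets says that the fibres over each value have equal cardinality; gluing
bijections of fibres gives a labelling by `Fin r`. -/
theorem exists_index_of_nonzeroEigenvaluesAre (hP : P.IsHermitian)
    (h : NonzeroEigenvaluesAre hP θ) :
    ∃ f : Fin r → Fin n, Function.Injective f ∧ (∀ j, hP.eigenvalues (f j) = θ j) ∧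
      ∀ k, hP.eigenvalues k ≠ 0 → k ∈ Set.range f := by
  classical
  have hcard : ∀ t, Fintype.card {j // θ j = t} =
      Fintype.card {k : {k // hP.eigenvalues k ≠ 0} // hP.eigenvalues k = t} := by
    intro t
    have h1 := congrArg (Multiset.count t) h
    have h2 : Multiset.count t (Finset.univ.val.map θ) = Fintype.card {j // θ j = t} := by
      rw [Multiset.count_map, Fintype.card_subtype, Finset.card_def, Finset.filter_val]
      simp only [eq_comm]
    rw [← h2, ← h1]
    by_cases ht : t = 0
    · rw [Multiset.count_filter_of_neg (by simpa using ht)]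
      refine (Fintype.card_eq_zero_iff.mpr ⟨fun k => ?_⟩).symm
      exact k.1.2 (k.2.trans ht)
    · rw [Multiset.count_filter_of_pos (p := fun x => x ≠ 0) ht, Multiset.count_map]
      have e : {k : {k // hP.eigenvalues k ≠ 0} // hP.eigenvalues k = t} ≃
          {k // hP.eigenvalues k = t} :=
        { toFun := fun k => ⟨k.1.1, k.2⟩
          invFun := fun k => ⟨⟨k.1, by rw [k.2]; exact ht⟩, k.2⟩
          left_inv := fun k => rfl
          right_inv := fun k => rfl }
      rw [Fintype.card_congr e, Fintype.card_subtype, Finset.card_def, Finset.filter_val]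
      simp only [eq_comm]
  let e : Fin r ≃ {k // hP.eigenvalues k ≠ 0} :=
    Equiv.ofFiberEquiv (g := fun k : {k // hP.eigenvalues k ≠ 0} => hP.eigenvalues k)
      fun t => Fintype.equivOfCardEq (hcard t)
  refine ⟨fun j => (e j).1, fun i j hij => e.injective (Subtype.ext hij),
    fun j => Equiv.ofFiberEquiv_map
      (g := fun k : {k // hP.eigenvalues k ≠ 0} => hP.eigenvalues k) _ j,
      fun k hk => ⟨e.symm ⟨k, hk⟩, by simp⟩⟩

theorem exists_eigenvectors (hP : P.IsHermitian) (h : NonzeroEigenvaluesAre hP θ) :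
    ∃ v : Fin r → EuclideanSpace 𝕜 (Fin n), Orthonormal 𝕜 v ∧
      ∀ u, toEuclideanLin P u = ∑ j, ((θ j : 𝕜) * inner 𝕜 (v j) u) • v j := by
  obtain ⟨f, hf, hfθ, hf0⟩ := exists_index_of_nonzeroEigenvaluesAre hP h
  refine ⟨fun j => hP.eigenvectorBasis (f j), hP.eigenvectorBasis.orthonormal.comp f hf,
    fun u => ?_⟩
  rw [eq_spectralFun_id (toEuclideanLin_eigenvectorBasis hP), spectralFun_apply]
  simp only [id, smul_smul, ← hfθ]
  symm
  refine Fintype.sum_of_injective f hf _ _ (fun k hk => ?_) fun j => rfl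
  have : hP.eigenvalues k = 0 := by
    by_contra h0
    exact hk (hf0 k h0)
  simp [this]

theorem toEuclideanLin_eigenvector {v : Fin r → EuclideanSpace 𝕜 (Fin n)} (hv : Orthonormal 𝕜 v)
    (hPv : ∀ u, toEuclideanLin P u = ∑ j, ((θ j : 𝕜) * inner 𝕜 (v j) u) • v j) (i : Fin r) :
    toEuclideanLin P (v i) = (θ i : 𝕜) • v i := by
  classical
  rw [hPv, Finset.sum_eq_single i]
  · simp [inner_self_eq_norm_sq_to_K, hv.1 i]
  · intro j _ hj
    simp [hv.2 hj]
  · simp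

theorem re_inner_perturbation {v : Fin r → EuclideanSpace 𝕜 (Fin n)}
    (hPv : ∀ u, toEuclideanLin P u = ∑ j, ((θ j : 𝕜) * inner 𝕜 (v j) u) • v j)
    (u : EuclideanSpace 𝕜 (Fin n)) :
    RCLike.re (inner 𝕜 u (toEuclideanLin P u)) = ∑ j, θ j * ‖inner 𝕜 (v j) u‖ ^ 2 := by
  rw [hPv, inner_sum, map_sum]
  refine Finset.sum_congr rfl fun j _ => ?_
  rw [inner_smul_right, mul_assoc, RCLike.re_ofReal_mul, inner_mul_symm_re_eq_norm, norm_mul,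
    norm_inner_symm u]
  ring

theorem projNorm_span_sq {v : Fin r → EuclideanSpace 𝕜 (Fin n)} (hv : Orthonormal 𝕜 v)
    (S : Finset (Fin r)) (u : EuclideanSpace 𝕜 (Fin n)) :
    projNorm u (Submodule.span 𝕜 (v '' S)) ^ 2 = ∑ j ∈ S, ‖inner 𝕜 (v j) u‖ ^ 2 := by
  have h : (Submodule.span 𝕜 (v '' S)).starProjection u = ∑ j ∈ S, inner 𝕜 (v j) u • v j := by
    have hm : ∑ j ∈ S, inner 𝕜 (v j) u • v j ∈ Submodule.span 𝕜 (v '' S) :=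
      Submodule.sum_mem _ fun j hj => Submodule.smul_mem _ _
        (Submodule.subset_span (Set.mem_image_of_mem v hj))
    refine Submodule.eq_starProjection_of_mem_of_inner_eq_zero hm fun w hw => ?_
    induction hw using Submodule.span_induction with
    | mem w hw =>
      obtain ⟨i, hi, rfl⟩ := hw
      rw [inner_sub_left, hv.inner_left_sum _ hi, inner_conj_symm, sub_self]
    | zero => simp
    | add w₁ w₂ _ _ h₁ h₂ => rw [inner_add_right, h₁, h₂, add_zero]
    | smul c w _ h => rw [inner_smul_right, h, mul_zero]
  rw [projNorm, h, ← RCLike.ofReal_inj (K := 𝕜), RCLike.ofReal_pow, ← inner_self_eq_norm_sq_to_K,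
    hv.inner_sum, RCLike.ofReal_sum]
  refine Finset.sum_congr rfl fun j _ => ?_
  rw [RCLike.conj_mul]
  push_cast
  rfl

/-- An eigenvector for t ≠ 0 lies in the range of P, hence in the span of the v j, and its
components with θ j ≠ t vanish. -/
theorem eigKer_eq_span {v : Fin r → EuclideanSpace 𝕜 (Fin n)} (hv : Orthonormal 𝕜 v)
    (hPv : ∀ u, toEuclideanLin P u = ∑ j, ((θ j : 𝕜) * inner 𝕜 (v j) u) • v j) {t : ℝ}
    (ht : t ≠ 0) : eigKer P t = Submodule.span 𝕜 (v '' {j | θ j = t}) := by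
  have hmem : ∀ u, u ∈ eigKer P t ↔ toEuclideanLin P u = (t : 𝕜) • u := by
    intro u
    rw [eigKer, LinearMap.mem_ker, map_sub, map_smul, toLpLin_one, LinearMap.sub_apply,
      LinearMap.smul_apply, LinearMap.id_apply, sub_eq_zero, eq_comm]
  have ht' : (t : 𝕜) ≠ 0 := RCLike.ofReal_ne_zero.mpr ht
  refine le_antisymm (fun u hu => ?_) (Submodule.span_le.mpr ?_)
  · rw [hmem] at hu
    have h1 : u = (t : 𝕜)⁻¹ • ∑ j, ((θ j : 𝕜) * inner 𝕜 (v j) u) • v j := by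
      rw [← hPv, hu, smul_smul, inv_mul_cancel₀ ht', one_smul]
    rw [h1]
    refine Submodule.smul_mem _ _ (Submodule.sum_mem _ fun j _ => ?_)
    by_cases hj : θ j = t
    · exact Submodule.smul_mem _ _ (Submodule.subset_span ⟨j, hj, rfl⟩)
    · have h2 : (θ j : 𝕜) * inner 𝕜 (v j) u = (t : 𝕜) * inner 𝕜 (v j) u := by
        rw [← inner_smul_right (v j) u (t : 𝕜), ← hu, hPv, hv.inner_right_fintype]
      have h3 : inner 𝕜 (v j) u = 0 := by
        have : ((θ j : 𝕜) - t) * inner 𝕜 (v j) u = 0 := by rw [sub_mul, h2, sub_self]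
        rcases mul_eq_zero.mp this with h | h
        · rw [sub_eq_zero, RCLike.ofReal_inj] at h
          exact absurd h hj
        · exact h
      rw [h3, mul_zero, zero_smul]
      exact Submodule.zero_mem _
  · rintro _ ⟨j, hj, rfl⟩
    rw [SetLike.mem_coe, hmem, toEuclideanLin_eigenvector hv hPv, show θ j = t from hj]

theorem projNorm_eigKer_sq {v : Fin r → EuclideanSpace 𝕜 (Fin n)} (hv : Orthonormal 𝕜 v)
    (hPv : ∀ u, toEuclideanLin P u = ∑ j, ((θ j : 𝕜) * inner 𝕜 (v j) u) • v j) {t : ℝ}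
    (ht : t ≠ 0) (u : EuclideanSpace 𝕜 (Fin n)) :
    projNorm u (eigKer P t) ^ 2 = ∑ j with θ j = t, ‖inner 𝕜 (v j) u‖ ^ 2 := by
  rw [eigKer_eq_span hv hPv ht, ← projNorm_span_sq hv]
  simp

theorem projNorm_iSup_eigKer_sq {v : Fin r → EuclideanSpace 𝕜 (Fin n)} (hv : Orthonormal 𝕜 v)
    (hPv : ∀ u, toEuclideanLin P u = ∑ j, ((θ j : 𝕜) * inner 𝕜 (v j) u) • v j)
    (hθ : ∀ i, θ i ≠ 0) (t : ℝ) (u : EuclideanSpace 𝕜 (Fin n)) :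
    projNorm u (⨆ (i : Fin r) (_ : θ i ≠ t), eigKer P (θ i)) ^ 2 =
      ∑ j with θ j ≠ t, ‖inner 𝕜 (v j) u‖ ^ 2 := by
  have h : (⨆ (i : Fin r) (_ : θ i ≠ t), eigKer P (θ i)) =
      Submodule.span 𝕜 (v '' {j | θ j ≠ t}) := by
    simp only [eigKer_eq_span hv hPv (hθ _)]
    refine le_antisymm (iSup₂_le fun i hi => Submodule.span_mono (Set.image_mono fun j hj => ?_))
      (Submodule.span_le.mpr ?_)
    · rw [Set.mem_ofPred_eq] at hj ⊢
      rwa [hj]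
    · rintro _ ⟨j, hj, rfl⟩
      exact Submodule.mem_iSup_of_mem j (Submodule.mem_iSup_of_mem hj
        (Submodule.subset_span ⟨j, rfl, rfl⟩))
  rw [h, ← projNorm_span_sq hv]
  simp

end Perturbation

end SpikedModel

end

/-! ### Limits of ⟨v_i, f(X) v_j⟩ along a fixed path -/

noncomputable section

namespace SpikedModel

open Matrix

/-- The almost sure properties of one realization of the model: `v n` is an orthonormal family of
eigenvectors of `P n` for the eigenvalues `θ`. -/
structure IsSpikedPath {𝕜 : Type*} [RCLike 𝕜] {r : ℕ} (X P : (n : ℕ) → Matrix (Fin n) (Fin n) 𝕜)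
    (hX : ∀ n, (X n).IsHermitian) (μ : Measure ℝ) (θ : Fin r → ℝ)
    (v : (n : ℕ) → Fin r → EuclideanSpace 𝕜 (Fin n)) : Prop where
  compact : IsCompact μ.support
  weak : WeaklyConverges (fun n => empiricalSpectral (hX n)) μ
  max : Tendsto (fun n => lam (hX n) 1) atTop (𝓝 (edgeSup μ))
  min : Tendsto (fun n => lam (hX n) n) atTop (𝓝 (edgeInf μ))
  ne_zero : ∀ j, θ j ≠ 0
  hermitian : ∀ n, (P n).IsHermitian
  orthonormal : ∀ n, r ≤ n → Orthonormal 𝕜 (v n)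
  perturbation : ∀ n, r ≤ n → ∀ u, toEuclideanLin (P n) u =
    ∑ j, ((θ j : 𝕜) * inner 𝕜 (v n j) u) • v n j
  compression : ∀ k, Tendsto (fun n => compression k (X n) (P n)) atTop (𝓝 0)

namespace IsSpikedPath

variable {𝕜 : Type*} [RCLike 𝕜] {r : ℕ} {X P : (n : ℕ) → Matrix (Fin n) (Fin n) 𝕜}
  {hX : ∀ n, (X n).IsHermitian} {μ : Measure ℝ} {θ : Fin r → ℝ}
  {v : (n : ℕ) → Fin r → EuclideanSpace 𝕜 (Fin n)}

theorem eventually_lam_mem (h : IsSpikedPath X P hX μ θ v) {ε : ℝ} (hε : 0 < ε) :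
    ∀ᶠ n in atTop, ∀ i : Fin n,
      lam (hX n) (i + 1) ∈ Set.Icc (edgeInf μ - ε) (edgeSup μ + ε) := by
  filter_upwards [h.max.eventually (gt_mem_nhds (lt_add_of_pos_right _ hε)),
    h.min.eventually (lt_mem_nhds (sub_lt_self _ hε))] with n h1 h2 i
  have hn : 0 < n := i.pos
  constructor
  · have := lam_succ_antitone (hX n) (show i ≤ ⟨n - 1, by omega⟩ from by
      rw [Fin.le_def]; simp only; omega)
    simp only [Nat.sub_add_cancel hn] at this
    linarith
  · have := lam_succ_antitone (hX n) (show (⟨0, hn⟩ : Fin n) ≤ i from Nat.zero_le _)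
    simp only [zero_add] at this
    linarith

theorem integral_empiricalSpectral {n : ℕ} {A : Matrix (Fin n) (Fin n) 𝕜} (hA : A.IsHermitian)
    (f : ℝ →ᵇ ℝ) :
    ∫ t, f t ∂(empiricalSpectral hA) = (n : ℝ)⁻¹ * ∑ i : Fin n, f (lam hA (i + 1)) := by
  rw [empiricalSpectral, integral_smul_measure, integral_finsetSum_measure]
  · simp only [integral_dirac, ENNReal.toReal_inv, ENNReal.toReal_natCast, smul_eq_mul]
    congr 1
    rw [Fin.sum_univ_eq_sum_range (fun i => f (lam hA (i + 1))) n, Finset.range_eq_Ico,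
      Finset.sum_Ico_add' (fun i => f (lam hA i)) 0 n 1]
    rfl
  · intro i _
    exact integrable_dirac (by simp)

theorem inner_eq_ite (h : IsSpikedPath X P hX μ θ v) {n : ℕ} (hn : r ≤ n) (i j : Fin r) :
    inner 𝕜 (v n i) (v n j) = if i = j then 1 else 0 :=
  orthonormal_iff_ite.mp (h.orthonormal n hn) i j

variable [IsProbabilityMeasure μ]

theorem integrable_of_continuous (h : IsSpikedPath X P hX μ θ v) {f : ℝ → ℝ}
    {ε : ℝ} (hε : 0 ≤ ε)
    (hf : ContinuousOn f (Set.Icc (edgeInf μ - ε) (edgeSup μ + ε))) : Integrable f μ := by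
  have h1 := hf.integrableOn_compact (μ := μ) isCompact_Icc
  rw [IntegrableOn, Measure.restrict_eq_self_of_ae_mem] at h1
  · exact h1
  · filter_upwards [ae_mem_Icc_edge μ h.compact] with t ht
    exact ⟨by linarith [ht.1], by linarith [ht.2]⟩

/-- Weak convergence tests only bounded functions. Precomposing f with the projection onto [a - 1, b
+ 1] makes it bounded without changing it on the support or, eventually, at the eigenvalues. -/
theorem tendsto_average (h : IsSpikedPath X P hX μ θ v) {f : ℝ → ℝ} (hf : Continuous f) :
    Tendsto (fun n : ℕ => (n : ℝ)⁻¹ * ∑ i : Fin n, f (lam (hX n) (i + 1))) atTop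
      (𝓝 (∫ t, f t ∂μ)) := by
  have hab := exists_mem_Icc_of_ae (ae_mem_Icc_edge μ h.compact)
  set a := edgeInf μ - 1 with ha
  set b := edgeSup μ + 1 with hb
  have hab' : a ≤ b := by linarith
  set F : ℝ →ᵇ ℝ := (BoundedContinuousFunction.mkOfCompact
    (⟨fun t : Set.Icc a b => f t, by fun_prop⟩ : C(Set.Icc a b, ℝ))).compContinuous
    ⟨Set.projIcc a b hab', continuous_projIcc⟩ with hF
  have hFf : ∀ t ∈ Set.Icc a b, F t = f t := by
    intro t ht
    simp [hF, Set.projIcc_of_mem hab' ht]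
  have h1 := h.weak F
  have h2 : ∫ t, F t ∂μ = ∫ t, f t ∂μ := by
    refine integral_congr_ae ?_
    filter_upwards [ae_mem_Icc_edge μ h.compact] with t ht
    exact hFf t ⟨by linarith [ht.1], by linarith [ht.2]⟩
  rw [h2] at h1
  refine h1.congr' ?_
  filter_upwards [h.eventually_lam_mem one_pos] with n hn
  rw [integral_empiricalSpectral]
  congr 1
  exact Finset.sum_congr rfl fun i _ => hFf _ (hn i)

/-- Functions of the unperturbed matrix. -/
def fn (hX : ∀ n, (X n).IsHermitian) (n : ℕ) (f : ℝ → ℝ) :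
    EuclideanSpace 𝕜 (Fin n) →ₗ[𝕜] EuclideanSpace 𝕜 (Fin n) :=
  spectralFun (sortedBasis (hX n)) (fun i => lam (hX n) (i + 1)) f

/-- The denominator in `compression` converges, because hsSq (X ^ k) / n is the 2k-th empirical
moment, so multiplying it back preserves the limit zero. -/
theorem tendsto_hsSq (h : IsSpikedPath X P hX μ θ v) (k : ℕ) :
    Tendsto (fun n => hsSq (P n * centered (X n ^ k) * P n)) atTop (𝓝 0) := by
  have h1 : Tendsto (fun n : ℕ => hsSq (X n ^ k) / n) atTop (𝓝 (∫ t, t ^ (k + k) ∂μ)) := by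
    refine (h.tendsto_average (f := fun t => t ^ (k + k)) (by fun_prop)).congr fun n => ?_
    rw [hsSq_pow_eq_sum (hX n), div_eq_inv_mul]
  have h2 := (h.compression k).mul ((h1.pow 2).const_add 1)
  rw [zero_mul] at h2
  have h3 := h2.sqrt
  rw [Real.sqrt_zero] at h3
  refine h3.congr fun n => ?_
  rw [SpikedModel.compression, div_mul_cancel₀ _ (by positivity), Real.sqrt_sq (hsSq_nonneg _)]

theorem tendsto_inner_centered (h : IsSpikedPath X P hX μ θ v) (k : ℕ) (i j : Fin r) :
    Tendsto (fun n => inner 𝕜 (v n i) (toEuclideanLin (centered (X n ^ k)) (v n j))) atTop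
      (𝓝 0) := by
  rw [tendsto_zero_iff_norm_tendsto_zero]
  have hne : (θ i * θ j) ^ 2 ≠ 0 := pow_ne_zero _ (mul_ne_zero (h.ne_zero i) (h.ne_zero j))
  have h1 := ((h.tendsto_hsSq k).div_const ((θ i * θ j) ^ 2)).sqrt
  rw [zero_div, Real.sqrt_zero] at h1
  refine squeeze_zero' (Eventually.of_forall fun n => norm_nonneg _) ?_ h1
  filter_upwards [eventually_ge_atTop r] with n hn
  have ho := h.orthonormal n hn
  have hp := h.perturbation n hn
  refine Real.le_sqrt_of_sq_le ?_
  rw [le_div_iff₀ (by positivity), mul_comm]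
  exact norm_inner_centered_sq_le (h.hermitian n) (ho.1 i) (ho.1 j)
    (toEuclideanLin_eigenvector ho hp i) (toEuclideanLin_eigenvector ho hp j)

/-- X ^ k is its centered part, whose entries vanish in the limit, plus its normalized trace, which
tends to the k-th moment and multiplies ⟨v_i, v_j⟩. -/
theorem tendsto_inner_pow (h : IsSpikedPath X P hX μ θ v) (k : ℕ) (i j : Fin r) :
    Tendsto (fun n => inner 𝕜 (v n i) (fn hX n (fun t => t ^ k) (v n j))) atTop
      (𝓝 (if i = j then ((∫ t, t ^ k ∂μ : ℝ) : 𝕜) else 0)) := by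
  have h1 := h.tendsto_inner_centered k i j
  have h2 := (RCLike.continuous_ofReal (K := 𝕜)).continuousAt.tendsto.comp
    (h.tendsto_average (f := fun t => t ^ k) (by fun_prop))
  have h3 := h1.add (h2.mul_const (if i = j then 1 else 0 : 𝕜))
  have e : (0 : 𝕜) + ((∫ t, t ^ k ∂μ : ℝ) : 𝕜) * (if i = j then 1 else 0) =
      if i = j then ((∫ t, t ^ k ∂μ : ℝ) : 𝕜) else 0 := by split_ifs <;> simp
  rw [e] at h3
  refine h3.congr' ?_
  filter_upwards [eventually_ge_atTop r] with n hn
  rw [inner_centered, h.inner_eq_ite hn, trace_pow_eq_sum (hX n), fn,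
    ← pow_eq_spectralFun (toEuclideanLin_sortedBasis (hX n)), toLpLin_pow]
  simp only [Function.comp_apply]
  push_cast
  ring

theorem tendsto_inner_polynomial (h : IsSpikedPath X P hX μ θ v) (q : Polynomial ℝ)
    (i j : Fin r) :
    Tendsto (fun n => inner 𝕜 (v n i) (fn hX n (fun t => q.eval t) (v n j))) atTop
      (𝓝 (if i = j then ((∫ t, q.eval t ∂μ : ℝ) : 𝕜) else 0)) := by
  have hInt : ∀ q : Polynomial ℝ, Integrable (fun t => q.eval t) μ := fun q =>
    h.integrable_of_continuous le_rfl (by fun_prop)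
  induction q using Polynomial.induction_on' with
  | add p q hp hq =>
    have h1 := hp.add hq
    have e : ((if i = j then ((∫ t, p.eval t ∂μ : ℝ) : 𝕜) else 0) +
        if i = j then ((∫ t, q.eval t ∂μ : ℝ) : 𝕜) else 0) =
        if i = j then ((∫ t, (p + q).eval t ∂μ : ℝ) : 𝕜) else 0 := by
      simp only [Polynomial.eval_add]
      rw [integral_add (hInt p) (hInt q)]
      split_ifs <;> simp
    rw [e] at h1
    refine h1.congr fun n => ?_
    simp only [fn, Polynomial.eval_add, spectralFun_add, inner_add_right]
  | monomial k c =>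
    have h1 := (h.tendsto_inner_pow k i j).const_mul (c : 𝕜)
    have e : (c : 𝕜) * (if i = j then ((∫ t, t ^ k ∂μ : ℝ) : 𝕜) else 0) =
        if i = j then ((∫ t, (Polynomial.monomial k c).eval t ∂μ : ℝ) : 𝕜) else 0 := by
      simp only [Polynomial.eval_monomial]
      rw [integral_const_mul]
      split_ifs <;> simp
    rw [e] at h1
    refine h1.congr fun n => ?_
    simp only [fn, Polynomial.eval_monomial, spectralFun_const_mul, inner_smul_right]

/-- Weierstrass approximation on a neighbourhood of [a,b] that eventually contains the spectrum. The
function may vary with n, as it must for resolvents taken at the outlier eigenvalue itself. -/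
theorem tendsto_inner_fn (h : IsSpikedPath X P hX μ θ v) {ε : ℝ} (hε : 0 < ε) {f : ℝ → ℝ}
    (hf : ContinuousOn f (Set.Icc (edgeInf μ - ε) (edgeSup μ + ε))) {F : ℕ → ℝ → ℝ}
    (hF : ∀ δ > 0, ∀ᶠ n in atTop, ∀ t ∈ Set.Icc (edgeInf μ - ε) (edgeSup μ + ε),
      |F n t - f t| ≤ δ) (i j : Fin r) :
    Tendsto (fun n => inner 𝕜 (v n i) (fn hX n (F n) (v n j))) atTop
      (𝓝 (if i = j then ((∫ t, f t ∂μ : ℝ) : 𝕜) else 0)) := by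
  rw [Metric.tendsto_nhds]
  intro δ hδ
  -- Error budget: two fifths from `F n` to f to q, one from the limit for q, one from the
  -- integrals; the total stays below δ.
  obtain ⟨q, hq⟩ := exists_polynomial_near_of_continuousOn _ _ f hf (δ / 5) (by positivity)
  have hInt : Integrable (fun t => q.eval t) μ := h.integrable_of_continuous le_rfl (by fun_prop)
  have hfint := h.integrable_of_continuous hε.le hf
  have hqf : |∫ t, q.eval t ∂μ - ∫ t, f t ∂μ| ≤ δ / 5 := by
    rw [← integral_sub hInt hfint]
    have := norm_integral_le_of_norm_le_const (μ := μ) (C := δ / 5)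
      (f := fun t => q.eval t - f t) ?_
    · simpa using this
    · filter_upwards [ae_mem_Icc_edge μ h.compact] with t ht
      exact (hq t ⟨by linarith [ht.1], by linarith [ht.2]⟩).le
  filter_upwards [h.eventually_lam_mem hε, hF (δ / 5) (by positivity), eventually_ge_atTop r,
    (Metric.tendsto_nhds.mp (h.tendsto_inner_polynomial q i j)) (δ / 5) (by positivity)]
    with n h1 h2 h3 h4
  have h5 : ‖inner 𝕜 (v n i) (fn hX n (F n) (v n j)) -
      inner 𝕜 (v n i) (fn hX n (fun t => q.eval t) (v n j))‖ ≤ 2 * (δ / 5) := by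
    rw [← inner_sub_right, fn, fn, ← spectralFun_sub]
    refine norm_inner_spectralFun_le _ _ (by positivity) (fun k => ?_) _ _
      ((h.orthonormal n h3).1 i).le ((h.orthonormal n h3).1 j).le
    have e1 := h2 _ (h1 k)
    have e2 := (hq _ (h1 k)).le
    rw [abs_le] at *
    constructor <;> linarith [e1.1, e1.2, e2.1, e2.2]
  have h6 : ‖(if i = j then ((∫ t, q.eval t ∂μ : ℝ) : 𝕜) else 0) -
      (if i = j then ((∫ t, f t ∂μ : ℝ) : 𝕜) else 0)‖ ≤ δ / 5 := by
    split_ifs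
    · rw [← RCLike.ofReal_sub, RCLike.norm_ofReal]
      exact hqf
    · simp only [sub_zero, norm_zero]; positivity
  rw [dist_eq_norm] at h4 ⊢
  have h7 := norm_sub_le_norm_sub_add_norm_sub (inner 𝕜 (v n i) (fn hX n (F n) (v n j)))
    (inner 𝕜 (v n i) (fn hX n (fun t => q.eval t) (v n j)))
    (if i = j then ((∫ t, f t ∂μ : ℝ) : 𝕜) else 0)
  have h8 := norm_sub_le_norm_sub_add_norm_sub
    (inner 𝕜 (v n i) (fn hX n (fun t => q.eval t) (v n j)))
    (if i = j then ((∫ t, q.eval t ∂μ : ℝ) : 𝕜) else 0)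
    (if i = j then ((∫ t, f t ∂μ : ℝ) : 𝕜) else 0)
  linarith

end IsSpikedPath

/-- A third of the distance from z to the interval: w may use one third, the enlarged interval
another, and the last third remains as a gap. -/
theorem exists_enlarged_gap {a b z : ℝ} (hz : z ∉ Set.Icc a b) :
    ∃ ε > 0, ∃ C > 0, ∀ w, |w - z| ≤ ε → ∀ t ∈ Set.Icc (a - ε) (b + ε),
      w - t ≠ 0 ∧ |1 / (w - t)| ≤ C := by
  rw [Set.mem_Icc, not_and_or, not_le, not_le] at hz
  rcases hz with hz | hz
  · refine ⟨(a - z) / 3, by linarith, 1 / ((a - z) / 3), one_div_pos.mpr (by linarith),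
      fun w hw t ht => ?_⟩
    have h1 := (abs_le.mp hw).2
    have h2 : (a - z) / 3 ≤ t - w := by linarith [ht.1]
    refine ⟨by intro h0; linarith, ?_⟩
    rw [abs_div, abs_one, abs_sub_comm, abs_of_pos (by linarith)]
    exact one_div_le_one_div_of_le (by linarith) h2
  · refine ⟨(z - b) / 3, by linarith, 1 / ((z - b) / 3), one_div_pos.mpr (by linarith),
      fun w hw t ht => ?_⟩
    have h1 := (abs_le.mp hw).1
    have h2 : (z - b) / 3 ≤ w - t := by linarith [ht.2]
    refine ⟨by intro h0; linarith, ?_⟩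
    rw [abs_div, abs_one, abs_of_pos (by linarith)]
    exact one_div_le_one_div_of_le (by linarith) h2

namespace IsSpikedPath

variable {𝕜 : Type*} [RCLike 𝕜] {r : ℕ} {X P : (n : ℕ) → Matrix (Fin n) (Fin n) 𝕜}
  {hX : ∀ n, (X n).IsHermitian} {μ : Measure ℝ} [IsProbabilityMeasure μ] {θ : Fin r → ℝ}
  {v : (n : ℕ) → Fin r → EuclideanSpace 𝕜 (Fin n)}

theorem tendsto_inner_resolvent (h : IsSpikedPath X P hX μ θ v) {z : ℝ}
    (hz : z ∉ Set.Icc (edgeInf μ) (edgeSup μ)) {w : ℕ → ℝ} (hw : Tendsto w atTop (𝓝 z))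
    (i j : Fin r) :
    Tendsto (fun n => inner 𝕜 (v n i) (fn hX n (fun t => 1 / (w n - t)) (v n j))) atTop
      (𝓝 (if i = j then ((cauchyG μ z : ℝ) : 𝕜) else 0)) := by
  obtain ⟨ε, hε, C, hC, hgap⟩ := exists_enlarged_gap hz
  refine h.tendsto_inner_fn hε (f := fun t => 1 / (z - t)) ?_ (fun δ hδ => ?_) i j
  · refine continuousOn_const.div (by fun_prop) fun t ht => (hgap z (by simpa using hε.le) t ht).1
  · have hd : Tendsto (fun n => C ^ 2 * |w n - z|) atTop (𝓝 0) := by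
      have := ((hw.sub_const z).abs).const_mul (C ^ 2)
      simpa using this
    filter_upwards [hd.eventually (gt_mem_nhds hδ),
      hw.eventually (Metric.closedBall_mem_nhds z hε)] with n h1 h2 t ht
    rw [Real.dist_eq] at h2
    obtain ⟨e1, e2⟩ := hgap _ h2 t ht
    obtain ⟨e3, e4⟩ := hgap z (by simpa using hε.le) t ht
    have e : 1 / (w n - t) - 1 / (z - t) = (1 / (w n - t)) * (1 / (z - t)) * (z - w n) := by
      field_simp; ring
    rw [e, abs_mul, abs_mul, abs_sub_comm z]
    refine le_trans ?_ h1.le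
    rw [sq]
    gcongr

theorem tendsto_inner_resolvent_sq (h : IsSpikedPath X P hX μ θ v) {z : ℝ}
    (hz : z ∉ Set.Icc (edgeInf μ) (edgeSup μ)) {w : ℕ → ℝ} (hw : Tendsto w atTop (𝓝 z))
    (i j : Fin r) :
    Tendsto (fun n => inner 𝕜 (v n i) (fn hX n (fun t => 1 / (w n - t) ^ 2) (v n j))) atTop
      (𝓝 (if i = j then ((∫ t, 1 / (z - t) ^ 2 ∂μ : ℝ) : 𝕜) else 0)) := by
  obtain ⟨ε, hε, C, hC, hgap⟩ := exists_enlarged_gap hz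
  refine h.tendsto_inner_fn hε (f := fun t => 1 / (z - t) ^ 2) ?_ (fun δ hδ => ?_) i j
  · refine continuousOn_const.div (by fun_prop) fun t ht =>
      pow_ne_zero _ (hgap z (by simpa using hε.le) t ht).1
  · have hd : Tendsto (fun n => C * C * |w n - z| * (C + C)) atTop (𝓝 0) := by
      have := (((hw.sub_const z).abs).const_mul (C * C)).mul_const (C + C)
      simpa using this
    filter_upwards [hd.eventually (gt_mem_nhds hδ),
      hw.eventually (Metric.closedBall_mem_nhds z hε)] with n h1 h2 t ht
    rw [Real.dist_eq] at h2
    obtain ⟨e1, e2⟩ := hgap _ h2 t ht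
    obtain ⟨e3, e4⟩ := hgap z (by simpa using hε.le) t ht
    have e : 1 / (w n - t) ^ 2 - 1 / (z - t) ^ 2 =
        (1 / (w n - t)) * (1 / (z - t)) * (z - w n) * (1 / (w n - t) + 1 / (z - t)) := by
      field_simp; ring
    rw [e, abs_mul, abs_mul, abs_mul, abs_sub_comm z]
    refine le_trans ?_ h1.le
    have e5 : |1 / (w n - t) + 1 / (z - t)| ≤ C + C := (abs_add_le _ _).trans (add_le_add e2 e4)
    gcongr

end IsSpikedPath

end SpikedModel

end

/-! ### Location of the outlier eigenvalue -/

noncomputable section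

namespace SpikedModel

open Matrix

namespace IsSpikedPath

variable {𝕜 : Type*} [RCLike 𝕜] {r : ℕ} {X P : (n : ℕ) → Matrix (Fin n) (Fin n) 𝕜}
  {hX : ∀ n, (X n).IsHermitian} {μ : Measure ℝ} {θ : Fin r → ℝ}
  {v : (n : ℕ) → Fin r → EuclideanSpace 𝕜 (Fin n)}

theorem re_inner_fn_affine (hX : ∀ n, (X n).IsHermitian) (n : ℕ) (σ y : ℝ)
    (u : EuclideanSpace 𝕜 (Fin n)) :
    RCLike.re (inner 𝕜 u (fn hX n (fun t => σ * (y - t)) u)) =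
      σ * (y * ‖u‖ ^ 2 - RCLike.re (inner 𝕜 u (toEuclideanLin (X n) u))) := by
  have h1 : fn hX n (fun t => σ * (y - t)) u =
      (σ : 𝕜) • ((y : 𝕜) • u - toEuclideanLin (X n) u) := by
    rw [eq_spectralFun_id (toEuclideanLin_sortedBasis (hX n)), fn, spectralFun_const_mul,
      spectralFun_sub]
    congr 2
    have := spectralFun_const_mul (sortedBasis (hX n)) (fun i => lam (hX n) (i + 1)) y
      (fun _ => 1) u
    simpa [spectralFun_one] using this
  rw [h1, inner_smul_right, inner_sub_right, inner_smul_right, RCLike.re_ofReal_mul, map_sub,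
    RCLike.re_ofReal_mul, inner_self_eq_norm_sq]

theorem re_inner_add (h : IsSpikedPath X P hX μ θ v) {n : ℕ} (hn : r ≤ n)
    (u : EuclideanSpace 𝕜 (Fin n)) :
    RCLike.re (inner 𝕜 u (toEuclideanLin (X n + P n) u)) =
      RCLike.re (inner 𝕜 u (toEuclideanLin (X n) u)) + ∑ j, θ j * ‖inner 𝕜 (v n j) u‖ ^ 2 := by
  rw [map_add, LinearMap.add_apply, inner_add_right, map_add,
    re_inner_perturbation (h.perturbation n hn)]

theorem eventually_sign_pos (h : IsSpikedPath X P hX μ θ v) {σ y : ℝ}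
    (hσ : σ = 1 ∨ σ = -1) (ha : 0 < σ * (y - edgeInf μ)) (hb : 0 < σ * (y - edgeSup μ)) :
    ∀ᶠ n in atTop, ∀ i : Fin n, 0 < σ * (y - lam (hX n) (i + 1)) := by
  rcases hσ with rfl | rfl
  · filter_upwards [h.eventually_lam_mem (ε := (y - edgeSup μ) / 2) (by linarith)] with n hn i
    linarith [(hn i).2]
  · filter_upwards [h.eventually_lam_mem (ε := (edgeInf μ - y) / 2) (by linarith)] with n hn i
    linarith [(hn i).1]

variable [IsProbabilityMeasure μ]

theorem notMem_of_sign {σ y a b : ℝ} (hσ : σ = 1 ∨ σ = -1)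
    (ha : 0 < σ * (y - a)) (hb : 0 < σ * (y - b)) : y ∉ Set.Icc a b := by
  rintro ⟨h1, h2⟩
  rcases hσ with rfl | rfl <;> linarith

/-- The sign σ treats both sides of [a,b] at once: σ(y - X) is eventually positive with inverse σ(y
- X)⁻¹, as σ² = 1. This supplies the data of the form comparison with g = σ G(y). -/
theorem eventually_resolvent (h : IsSpikedPath X P hX μ θ v) {σ y : ℝ}
    (hσ : σ = 1 ∨ σ = -1) (ha : 0 < σ * (y - edgeInf μ)) (hb : 0 < σ * (y - edgeSup μ))
    {η : ℝ} (hη : 0 < η) :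
    ∀ᶠ n in atTop, (∀ u, 0 ≤ RCLike.re (inner 𝕜 u (fn hX n (fun t => σ * (y - t)) u))) ∧
      ∃ x : Fin r → EuclideanSpace 𝕜 (Fin n),
        (∀ j, fn hX n (fun t => σ * (y - t)) (x j) = v n j) ∧
        ∀ i j, ‖inner 𝕜 (v n i) (x j) -
          (if i = j then ((σ * cauchyG μ y : ℝ) : 𝕜) else 0)‖ ≤ η := by
  have hy := notMem_of_sign hσ ha hb
  have hM : ∀ i j, ∀ᶠ n in atTop, ‖inner 𝕜 (v n i)
      (fn hX n (fun t => σ * (1 / (y - t))) (v n j)) -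
        (if i = j then ((σ * cauchyG μ y : ℝ) : 𝕜) else 0)‖ ≤ η := by
    intro i j
    have h1 := (h.tendsto_inner_resolvent hy (tendsto_const_nhds (x := y)) i j).const_mul (σ : 𝕜)
    have e : (σ : 𝕜) * (if i = j then ((cauchyG μ y : ℝ) : 𝕜) else 0) =
        if i = j then ((σ * cauchyG μ y : ℝ) : 𝕜) else 0 := by split_ifs <;> simp
    rw [e] at h1
    filter_upwards [h1.eventually (Metric.closedBall_mem_nhds _ hη)] with n hn
    rw [dist_eq_norm] at hn
    rwa [fn, spectralFun_const_mul, inner_smul_right]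
  filter_upwards [h.eventually_sign_pos hσ ha hb, eventually_all.mpr fun i =>
    eventually_all.mpr (hM i)] with n h1 h2
  refine ⟨fun u => ?_, fun j => fn hX n (fun t => σ * (1 / (y - t))) (v n j), fun j => ?_, h2⟩
  · have hT := fun i : Fin n => spectralFun_basis (sortedBasis (hX n))
      (fun i : Fin n => lam (hX n) (i + 1)) (fun t => σ * (y - t)) i
    rw [fn, re_inner_eq_sum (b := sortedBasis (hX n))
      (l := fun i : Fin n => σ * (y - lam (hX n) (i + 1))) hT]
    exact Finset.sum_nonneg fun i _ => mul_nonneg (h1 i).le (sq_nonneg _)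
  · rw [fn, fn, spectralFun_mul]
    refine Eq.trans ?_ (spectralFun_one (sortedBasis (hX n)) (fun i => lam (hX n) (i + 1)) (v n j))
    refine congrFun (congrArg DFunLike.coe (spectralFun_congr _ _ fun i => ?_)) (v n j)
    have hne : y - lam (hX n) (i + 1) ≠ 0 := fun h0 => by
      have := h1 i
      rw [h0, mul_zero] at this
      exact lt_irrefl _ this
    rcases hσ with rfl | rfl <;> field_simp

theorem fn_isSymmetric (hX : ∀ n, (X n).IsHermitian) (n : ℕ) (f : ℝ → ℝ) :
    (fn hX n f).IsSymmetric := fun x y => spectralFun_symm _ _ f x y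

/-- The outlier is beyond `y` when `y` lies before the predicted location. -/
theorem eventually_exists_form_nonneg (h : IsSpikedPath X P hX μ θ v) {σ y τ : ℝ}
    (hσ : σ = 1 ∨ σ = -1) (ha : 0 < σ * (y - edgeInf μ)) (hb : 0 < σ * (y - edgeSup μ))
    {J : Finset (Fin r)} (hJ : ∀ j ∈ J, τ ≤ σ * θ j) (hg : 0 < σ * cauchyG μ y)
    (hτ : 1 < τ * (σ * cauchyG μ y)) :
    ∀ᶠ n in atTop, ∃ W : Submodule 𝕜 (EuclideanSpace 𝕜 (Fin n)),
      Module.finrank 𝕜 W = J.card ∧ ∀ u ∈ W,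
        0 ≤ σ * (RCLike.re (inner 𝕜 u (toEuclideanLin (X n + P n) u)) - y * ‖u‖ ^ 2) := by
  set g := σ * cauchyG μ y with hgdef
  set K := ∑ j, |σ * θ j| with hKdef
  have hK : ∀ j, |σ * θ j| ≤ K := fun j =>
    Finset.single_le_sum (f := fun j => |σ * θ j|) (fun _ _ => abs_nonneg _) (Finset.mem_univ j)
  have hK0 : 0 ≤ K := Finset.sum_nonneg fun _ _ => abs_nonneg _
  -- At η = 0 the inequality is g < g² τ, which is strict because τ g > 1; continuity gives room for
  -- a positive η.
  obtain ⟨η, hη, hsmall⟩ : ∃ η > 0,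
      g + r * η + K * (2 * g * (r * η) + r * (r * η ^ 2)) ≤ g ^ 2 * τ := by
    have hc : Continuous fun η : ℝ => g + r * η + K * (2 * g * (r * η) + r * (r * η ^ 2)) := by
      fun_prop
    have h0 : g + r * 0 + K * (2 * g * (r * 0) + r * (r * 0 ^ 2)) < g ^ 2 * τ := by
      have : g * 1 < g * (τ * g) := mul_lt_mul_of_pos_left hτ hg
      nlinarith
    have hev := (hc.tendsto 0).eventually (gt_mem_nhds h0)
    have hev2 := (hev.filter_mono (nhdsWithin_le_nhds (s := Set.Ioi 0))).and self_mem_nhdsWithin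
    obtain ⟨η, h1, h2⟩ := hev2.exists
    exact ⟨η, h2, h1.le⟩
  filter_upwards [h.eventually_resolvent hσ ha hb hη, eventually_ge_atTop r] with n hn hr
  obtain ⟨-, x, hx, hM⟩ := hn
  obtain ⟨W, hW, hu⟩ := exists_subspace_form_le (fn_isSymmetric hX n _) (h.orthonormal n hr) hx
    hη.le hg.le hM hK hJ hK0 hsmall
  refine ⟨W, hW, fun u huW => ?_⟩
  have h1 := hu u huW
  rw [re_inner_fn_affine] at h1
  rw [h.re_inner_add hr]
  simp only [mul_assoc] at h1
  rw [← Finset.mul_sum] at h1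
  linarith

/-- For y past the predicted location, τ σ G(y) < 1: after the directions in J are removed, the
perturbation is too weak to push the form beyond y. -/
theorem eventually_exists_form_nonpos (h : IsSpikedPath X P hX μ θ v) {σ y τ : ℝ}
    (hσ : σ = 1 ∨ σ = -1) (ha : 0 < σ * (y - edgeInf μ)) (hb : 0 < σ * (y - edgeSup μ))
    {J : Finset (Fin r)} (hJ : ∀ j ∉ J, σ * θ j ≤ τ) (hτ0 : 0 < τ)
    (hτ : τ * (σ * cauchyG μ y) < 1) :
    ∀ᶠ n in atTop, ∃ W : Submodule 𝕜 (EuclideanSpace 𝕜 (Fin n)),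
      n ≤ Module.finrank 𝕜 W + J.card ∧ ∀ u ∈ W,
        σ * (RCLike.re (inner 𝕜 u (toEuclideanLin (X n + P n) u)) - y * ‖u‖ ^ 2) ≤ 0 := by
  set g := σ * cauchyG μ y with hgdef
  obtain ⟨η, hη, hsmall⟩ : ∃ η > 0, τ * (g + r * η) ≤ 1 := by
    have hc : Continuous fun η : ℝ => τ * (g + r * η) := by fun_prop
    have h0 : τ * (g + r * 0) < 1 := by simpa using hτ
    have hev := (hc.tendsto 0).eventually (gt_mem_nhds h0)
    have hev2 := (hev.filter_mono (nhdsWithin_le_nhds (s := Set.Ioi 0))).and self_mem_nhdsWithin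
    obtain ⟨η, h1, h2⟩ := hev2.exists
    exact ⟨η, h2, h1.le⟩
  filter_upwards [h.eventually_resolvent hσ ha hb hη, eventually_ge_atTop r] with n hn hr
  obtain ⟨hpos, x, hx, hM⟩ := hn
  obtain ⟨W, hW, hu⟩ := exists_subspace_le_form (fn_isSymmetric hX n _) hpos hx
    hη.le hτ0.le hM hJ hsmall
  refine ⟨W, by simpa using hW, fun u huW => ?_⟩
  have h1 := hu u huW
  rw [re_inner_fn_affine] at h1
  rw [h.re_inner_add hr]
  simp only [mul_assoc] at h1
  rw [← Finset.mul_sum] at h1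
  linarith

theorem lam_outlierPos_pos {n : ℕ} {A : Matrix (Fin n) (Fin n) 𝕜} (hA : A.IsHermitian)
    {i₀ : Fin r} (hpos : 0 < θ i₀) (hr : r ≤ n) :
    lam hA (outlierPos n θ i₀) = lam hA ((⟨i₀, i₀.2.trans_le hr⟩ : Fin n) + 1) := by
  rw [outlierPos, if_pos hpos]

theorem lam_outlierPos_neg {n : ℕ} {A : Matrix (Fin n) (Fin n) 𝕜} (hA : A.IsHermitian)
    {i₀ : Fin r} (hneg : θ i₀ < 0) (hr : r ≤ n) :
    lam hA (outlierPos n θ i₀) = lam hA ((⟨n - r + i₀, by omega⟩ : Fin n) + 1) := by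
  rw [outlierPos, if_neg hneg.not_gt]
  rfl

/-- Convergence of the outlier eigenvalue. -/
theorem tendsto_outlier (h : IsSpikedPath X P hX μ θ v) (hθ : Antitone θ) {i₀ : Fin r} {ρ : ℝ}
    (hρ : ρ ∉ Set.Icc (edgeInf μ) (edgeSup μ)) (hG : cauchyG μ ρ = 1 / θ i₀) :
    Tendsto (fun n => lam ((hX n).add (h.hermitian n)) (outlierPos n θ i₀)) atTop (𝓝 ρ) := by
  have hae := ae_mem_Icc_edge μ h.compact
  have hab := exists_mem_Icc_of_ae hae
  set a := edgeInf μ with ha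
  set b := edgeSup μ with hb
  rw [Set.mem_Icc, not_and_or, not_le, not_le] at hρ
  rcases hρ with hρ | hρ
  · have hneg : θ i₀ < 0 := by
      have := cauchyG_neg hae hρ
      rw [hG] at this
      exact one_div_neg.mp this
    have hmul : θ i₀ * cauchyG μ ρ = 1 := by rw [hG, mul_one_div_cancel (h.ne_zero i₀)]
    have hanti := strictAntiOn_cauchyG hae (convex_Iio a) Iio_subset_compl
    -- Below the spectrum σ = -1 reverses the order, so the spikes at least as strong as i₀ are
    -- those with index j ≥ i₀, and G(y) < G(ρ) makes θ_{i₀} G(y) > 1.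
    have key1 : ∀ y, ρ < y → y < a → ∀ᶠ n in atTop,
        lam ((hX n).add (h.hermitian n)) (outlierPos n θ i₀) ≤ y := by
      intro y hy hya
      have hGy : cauchyG μ y < cauchyG μ ρ := hanti hρ hya hy
      have hGn := cauchyG_neg hae hya
      filter_upwards [h.eventually_exists_form_nonneg (σ := -1) (y := y) (τ := -θ i₀) (Or.inr rfl)
        (by rw [← ha]; linarith) (by rw [← hb]; linarith) (J := Finset.Ici i₀)
        (fun j hj => by linarith [hθ (Finset.mem_Ici.mp hj)]) (by linarith) (by nlinarith),
        eventually_ge_atTop r] with n ⟨W, hW, hu⟩ hr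
      rw [lam_outlierPos_neg _ hneg hr]
      refine eigenvalue_le_of_form_le (lam_succ_antitone ((hX n).add (h.hermitian n)))
        (toEuclideanLin_sortedBasis _) ⟨n - r + i₀, by omega⟩ (W := W) ?_ fun u huW => ?_
      -- The dimension r - i₀ and the 0-based position n - r + i₀ add up to n, as Courant–Fischer
      -- requires.
      · rw [hW, Fin.card_Ici]
        have := i₀.2
        simp only
        omega
      · linarith [hu u huW]
    have key2 : ∀ y < ρ, ∀ᶠ n in atTop,
        y ≤ lam ((hX n).add (h.hermitian n)) (outlierPos n θ i₀) := by
      intro y hy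
      have hya : y < a := hy.trans hρ
      have hGy : cauchyG μ ρ < cauchyG μ y := hanti hya hρ hy
      filter_upwards [h.eventually_exists_form_nonpos (σ := -1) (y := y) (τ := -θ i₀) (Or.inr rfl)
        (by rw [← ha]; linarith) (by rw [← hb]; linarith) (J := Finset.Ioi i₀)
        (fun j hj => by
          have := hθ (not_lt.mp fun hlt => hj (Finset.mem_Ioi.mpr hlt))
          linarith) (by linarith) (by nlinarith),
        eventually_ge_atTop r] with n ⟨W, hW, hu⟩ hr
      rw [lam_outlierPos_neg _ hneg hr]
      refine le_eigenvalue_of_le_form (lam_succ_antitone ((hX n).add (h.hermitian n)))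
        (toEuclideanLin_sortedBasis _) ⟨n - r + i₀, by omega⟩ (W := W) ?_ fun u huW => ?_
      -- Only the r - 1 - i₀ strictly stronger spikes are removed, which leaves dimension at least n
      -- - r + i₀ + 1.
      · rw [Fin.card_Ioi] at hW
        have := i₀.2
        simp only
        omega
      · linarith [hu u huW]
    rw [tendsto_order]
    refine ⟨fun y hy => ?_, fun y hy => ?_⟩
    · obtain ⟨y', h1, h2⟩ := exists_between hy
      exact (key2 y' h2).mono fun n hn => h1.trans_le hn
    · obtain ⟨y', h1, h2⟩ := exists_between (lt_min hy hρ)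
      exact (key1 y' h1 (h2.trans_le (min_le_right _ _))).mono fun n hn =>
        hn.trans_lt (h2.trans_le (min_le_left _ _))
  · have hpos : 0 < θ i₀ := by
      have := cauchyG_pos hae hρ
      rw [hG] at this
      exact one_div_pos.mp this
    have hmul : θ i₀ * cauchyG μ ρ = 1 := by rw [hG, mul_one_div_cancel (h.ne_zero i₀)]
    have hanti := strictAntiOn_cauchyG hae (convex_Ioi b) Ioi_subset_compl
    -- Above the spectrum the order is direct: `Finset.Iic i₀` gives dimension i₀ + 1 for the lower
    -- bound, and `Finset.Iio i₀` gives codimension at most i₀ for the upper one.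
    have key1 : ∀ y < ρ, b < y → ∀ᶠ n in atTop,
        y ≤ lam ((hX n).add (h.hermitian n)) (outlierPos n θ i₀) := by
      intro y hy hyb
      have hGy : cauchyG μ ρ < cauchyG μ y := hanti hyb hρ hy
      have hGp := cauchyG_pos hae hyb
      filter_upwards [h.eventually_exists_form_nonneg (σ := 1) (y := y) (τ := θ i₀) (Or.inl rfl)
        (by rw [← ha]; linarith) (by rw [← hb]; linarith) (J := Finset.Iic i₀)
        (fun j hj => by linarith [hθ (Finset.mem_Iic.mp hj)]) (by linarith) (by nlinarith),
        eventually_ge_atTop r] with n ⟨W, hW, hu⟩ hr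
      rw [lam_outlierPos_pos _ hpos hr]
      refine le_eigenvalue_of_le_form (lam_succ_antitone ((hX n).add (h.hermitian n)))
        (toEuclideanLin_sortedBasis _) ⟨i₀, i₀.2.trans_le hr⟩ (W := W) ?_ fun u huW => ?_
      · rw [hW, Fin.card_Iic]
      · linarith [hu u huW]
    have key2 : ∀ y, ρ < y → ∀ᶠ n in atTop,
        lam ((hX n).add (h.hermitian n)) (outlierPos n θ i₀) ≤ y := by
      intro y hy
      have hyb : b < y := hρ.trans hy
      have hGy : cauchyG μ y < cauchyG μ ρ := hanti hρ hyb hy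
      filter_upwards [h.eventually_exists_form_nonpos (σ := 1) (y := y) (τ := θ i₀) (Or.inl rfl)
        (by rw [← ha]; linarith) (by rw [← hb]; linarith) (J := Finset.Iio i₀)
        (fun j hj => by
          have := hθ (not_lt.mp fun hlt => hj (Finset.mem_Iio.mpr hlt))
          linarith) (by linarith) (by nlinarith),
        eventually_ge_atTop r] with n ⟨W, hW, hu⟩ hr
      rw [lam_outlierPos_pos _ hpos hr]
      refine eigenvalue_le_of_form_le (lam_succ_antitone ((hX n).add (h.hermitian n)))
        (toEuclideanLin_sortedBasis _) ⟨i₀, i₀.2.trans_le hr⟩ (W := W) ?_ fun u huW => ?_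
      · rwa [Fin.card_Iio] at hW
      · linarith [hu u huW]
    rw [tendsto_order]
    refine ⟨fun y hy => ?_, fun y hy => ?_⟩
    · obtain ⟨y', h1, h2⟩ := exists_between (max_lt hy hρ)
      exact (key1 y' h2 ((le_max_right _ _).trans_lt h1)).mono fun n hn =>
        ((le_max_left _ _).trans_lt h1).trans_le hn
    · obtain ⟨y', h1, h2⟩ := exists_between hy
      exact (key2 y' h1).mono fun n hn => hn.trans_lt h2

end IsSpikedPath

end SpikedModel

end

/-! ### Components of the outlier eigenvector -/

noncomputable section

namespace SpikedModel

open Matrix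

theorem tendsto_bounded_mul {𝕜 : Type*} [RCLike 𝕜] {c z : ℕ → 𝕜} {C : ℝ}
    (hc : ∀ᶠ n in atTop, ‖c n‖ ≤ C)
    (hz : Tendsto z atTop (𝓝 0)) : Tendsto (fun n => c n * z n) atTop (𝓝 0) := by
  refine squeeze_zero_norm' (a := fun n => C * ‖z n‖) ?_ ?_
  · filter_upwards [hc] with n hn
    rw [norm_mul]
    exact mul_le_mul_of_nonneg_right hn (norm_nonneg _)
  · simpa using hz.norm.const_mul C

namespace IsSpikedPath

variable {𝕜 : Type*} [RCLike 𝕜] {r : ℕ} {X P : (n : ℕ) → Matrix (Fin n) (Fin n) 𝕜}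
  {hX : ∀ n, (X n).IsHermitian} {μ : Measure ℝ} {θ : Fin r → ℝ}
  {v : (n : ℕ) → Fin r → EuclideanSpace 𝕜 (Fin n)}

variable {u : (n : ℕ) → EuclideanSpace 𝕜 (Fin n)} {w : ℕ → ℝ} {ρ : ℝ} {i₀ : Fin r}

theorem norm_inner_le_one (h : IsSpikedPath X P hX μ θ v)
    (hu : ∀ n, r ≤ n → ‖u n‖ = 1 ∧ toEuclideanLin (X n + P n) (u n) = ((w n : ℝ) : 𝕜) • u n)
    {n : ℕ} (hr : r ≤ n) (j : Fin r) : ‖inner 𝕜 (v n j) (u n)‖ ≤ 1 := by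
  have := norm_inner_le_norm (𝕜 := 𝕜) (v n j) (u n)
  rwa [(h.orthonormal n hr).1 j, (hu n hr).1, one_mul] at this

/-- The eigenvalue equation is (w - X)u = Pu, and w - X is eventually invertible because w tends to
a point outside [a,b]. -/
theorem eventually_eigenvector_eq (h : IsSpikedPath X P hX μ θ v)
    (hρ : ρ ∉ Set.Icc (edgeInf μ) (edgeSup μ)) (hw : Tendsto w atTop (𝓝 ρ)) :
    ∀ᶠ n in atTop, ∀ u : EuclideanSpace 𝕜 (Fin n),
      toEuclideanLin (X n + P n) u = ((w n : ℝ) : 𝕜) • u →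
      u = fn hX n (fun t => 1 / (w n - t)) (∑ j, ((θ j : 𝕜) * inner 𝕜 (v n j) u) • v n j) := by
  obtain ⟨ε, hε, C, hC, hgap⟩ := exists_enlarged_gap hρ
  filter_upwards [h.eventually_lam_mem hε, hw.eventually (Metric.closedBall_mem_nhds ρ hε),
    eventually_ge_atTop r] with n h1 h2 hr u hu
  rw [Real.dist_eq] at h2
  rw [← h.perturbation n hr]
  have hPu : toEuclideanLin (P n) u = fn hX n (fun t => w n - t) u := by
    rw [map_add, LinearMap.add_apply] at hu
    rw [fn, spectralFun_sub]
    have e1 := spectralFun_const_mul (sortedBasis (hX n)) (fun i => lam (hX n) (i + 1)) (w n)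
      (fun _ => 1) u
    simp only [mul_one, spectralFun_one] at e1
    have e2 := congrArg (fun T => T u) (eq_spectralFun_id (toEuclideanLin_sortedBasis (hX n)))
    rw [e1, ← hu]
    change _ = _ - spectralFun (sortedBasis (hX n)) (fun i => lam (hX n) (i + 1)) id u
    rw [← e2]
    abel
  rw [hPu, fn, fn, spectralFun_mul]
  refine (spectralFun_one (sortedBasis (hX n)) (fun i => lam (hX n) (i + 1)) u).symm.trans ?_
  refine congrFun (congrArg DFunLike.coe (spectralFun_congr _ _ fun i => ?_)) u
  have := (hgap _ h2 _ (h1 i)).1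
  field_simp

variable [IsProbabilityMeasure μ]

/-- Pairing u = (w - X)⁻¹ P u with v_i and replacing the resolvent matrix by its limit gives (1 -
θ_i G(ρ))⟨v_i, u⟩ → 0. The factor is 1 - θ_i/θ_{i₀} ≠ 0. -/
theorem tendsto_inner_of_ne (h : IsSpikedPath X P hX μ θ v)
    (hρ : ρ ∉ Set.Icc (edgeInf μ) (edgeSup μ)) (hG : cauchyG μ ρ = 1 / θ i₀)
    (hw : Tendsto w atTop (𝓝 ρ))
    (hu : ∀ n, r ≤ n → ‖u n‖ = 1 ∧ toEuclideanLin (X n + P n) (u n) = ((w n : ℝ) : 𝕜) • u n)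
    {i : Fin r} (hi : θ i ≠ θ i₀) :
    Tendsto (fun n => inner 𝕜 (v n i) (u n)) atTop (𝓝 0) := by
  have hM : ∀ j, Tendsto (fun n => ((θ j : 𝕜) * inner 𝕜 (v n j) (u n)) *
      (inner 𝕜 (v n i) (fn hX n (fun t => 1 / (w n - t)) (v n j)) -
        (if i = j then ((cauchyG μ ρ : ℝ) : 𝕜) else 0))) atTop (𝓝 0) := by
    intro j
    refine tendsto_bounded_mul (C := |θ j|) ?_
      (tendsto_sub_nhds_zero_iff.mpr (h.tendsto_inner_resolvent hρ hw i j))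
    filter_upwards [eventually_ge_atTop r] with n hr
    rw [norm_mul, RCLike.norm_ofReal]
    exact mul_le_of_le_one_right (abs_nonneg _) (h.norm_inner_le_one hu hr j)
  have hS := tendsto_finsetSum Finset.univ fun j _ => hM j
  rw [Finset.sum_const_zero] at hS
  have hfac : (1 : 𝕜) - θ i * cauchyG μ ρ ≠ 0 := by
    rw [hG]
    intro h0
    apply hi
    have h1 : (1 : 𝕜) = ((θ i * (1 / θ i₀) : ℝ) : 𝕜) := by
      push_cast
      rw [sub_eq_zero] at h0
      simpa using h0
    have h2 : (1 : ℝ) = θ i * (1 / θ i₀) := by exact_mod_cast h1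
    have h3 := h.ne_zero i₀
    field_simp at h2
    exact h2.symm
  have hT := hS.const_mul ((1 : 𝕜) - θ i * cauchyG μ ρ)⁻¹
  rw [mul_zero] at hT
  refine hT.congr' ?_
  filter_upwards [h.eventually_eigenvector_eq hρ hw, eventually_ge_atTop r] with n hn hr
  have h1 := hn (u n) (hu n hr).2
  have h2 : inner 𝕜 (v n i) (u n) = ∑ j, ((θ j : 𝕜) * inner 𝕜 (v n j) (u n)) *
      inner 𝕜 (v n i) (fn hX n (fun t => 1 / (w n - t)) (v n j)) := by
    conv_lhs => rw [h1]
    simp only [map_sum, map_smul, inner_sum, inner_smul_right]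
  simp only [mul_sub, Finset.sum_sub_distrib]
  rw [← h2]
  simp only [mul_ite, mul_zero, Finset.sum_ite_eq, Finset.mem_univ, if_true]
  field_simp

/-- The squared norm of u = (w - X)⁻¹ P u is 1 = ⟨Pu, (w - X)⁻² Pu⟩. The matrix of (w - X)⁻² in the
v_j tends to a scalar, and Pu has bounded coordinates θ_j ⟨v_j, u⟩. -/
theorem tendsto_sum_norm_sq (h : IsSpikedPath X P hX μ θ v)
    (hρ : ρ ∉ Set.Icc (edgeInf μ) (edgeSup μ))
    (hw : Tendsto w atTop (𝓝 ρ))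
    (hu : ∀ n, r ≤ n → ‖u n‖ = 1 ∧ toEuclideanLin (X n + P n) (u n) = ((w n : ℝ) : 𝕜) • u n) :
    Tendsto (fun n => (∑ j, θ j ^ 2 * ‖inner 𝕜 (v n j) (u n)‖ ^ 2) *
      ∫ t, 1 / (ρ - t) ^ 2 ∂μ) atTop (𝓝 1) := by
  set m := ∫ t, 1 / (ρ - t) ^ 2 ∂μ with hm
  set d : ℕ → Fin r → 𝕜 := fun n j => (θ j : 𝕜) * inner 𝕜 (v n j) (u n) with hd
  have hdb : ∀ j, ∀ᶠ n in atTop, ‖d n j‖ ≤ |θ j| := by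
    intro j
    filter_upwards [eventually_ge_atTop r] with n hr
    rw [hd, norm_mul, RCLike.norm_ofReal]
    exact mul_le_of_le_one_right (abs_nonneg _) (h.norm_inner_le_one hu hr j)
  have hM : ∀ i j, Tendsto (fun n => (starRingEnd 𝕜 (d n i) * d n j) *
      (inner 𝕜 (v n i) (fn hX n (fun t => 1 / (w n - t) ^ 2) (v n j)) -
        (if i = j then ((m : ℝ) : 𝕜) else 0))) atTop (𝓝 0) := by
    intro i j
    refine tendsto_bounded_mul (C := |θ i| * |θ j|) ?_
      (tendsto_sub_nhds_zero_iff.mpr (h.tendsto_inner_resolvent_sq hρ hw i j))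
    filter_upwards [hdb i, hdb j] with n h1 h2
    rw [norm_mul, RCLike.norm_conj]
    gcongr
  have hS := tendsto_finsetSum Finset.univ fun i _ =>
    tendsto_finsetSum Finset.univ fun j _ => hM i j
  simp only [Finset.sum_const_zero] at hS
  have hS' := (RCLike.continuous_re.tendsto (0 : 𝕜)).comp hS
  rw [map_zero] at hS'
  have hT := hS'.const_sub 1
  rw [sub_zero] at hT
  refine hT.congr' ?_
  filter_upwards [h.eventually_eigenvector_eq hρ hw, eventually_ge_atTop r] with n hn hr
  have h1 := hn (u n) (hu n hr).2
  have h2 : (1 : 𝕜) = ∑ i, ∑ j, (starRingEnd 𝕜 (d n i) * d n j) *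
      inner 𝕜 (v n i) (fn hX n (fun t => 1 / (w n - t) ^ 2) (v n j)) := by
    have h3 : (1 : 𝕜) = inner 𝕜 (u n) (u n) := by
      rw [inner_self_eq_norm_sq_to_K, (hu n hr).1]; simp
    rw [h3]
    conv_lhs => rw [h1]
    rw [fn_isSymmetric hX n, fn, spectralFun_mul]
    have e : (fun t => 1 / (w n - t) * (1 / (w n - t))) = fun t => 1 / (w n - t) ^ 2 := by
      ext t; rw [div_mul_div_comm, one_mul, sq]
    rw [e]
    simp only [map_sum, map_smul, sum_inner, inner_sum, inner_smul_left, inner_smul_right,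
      Finset.mul_sum]
    rw [Finset.sum_comm]
    refine Finset.sum_congr rfl fun i _ => Finset.sum_congr rfl fun j _ => ?_
    simp only [hd, fn]
    ring
  simp only [Function.comp_apply, mul_sub, Finset.sum_sub_distrib]
  rw [← h2]
  simp only [mul_ite, mul_zero, Finset.sum_ite_eq, Finset.mem_univ, if_true, map_sub,
    RCLike.one_re, sub_sub_cancel]
  rw [map_sum, Finset.sum_mul]
  refine Finset.sum_congr rfl fun j _ => ?_
  have e : starRingEnd 𝕜 (d n j) * d n j = ((‖d n j‖ ^ 2 : ℝ) : 𝕜) := by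
    rw [RCLike.conj_mul]; push_cast; rfl
  rw [e, RCLike.re_ofReal_mul, RCLike.ofReal_re, hd, norm_mul, RCLike.norm_ofReal, mul_pow, sq_abs]

theorem tendsto_projNorm_iSup (h : IsSpikedPath X P hX μ θ v)
    (hρ : ρ ∉ Set.Icc (edgeInf μ) (edgeSup μ)) (hG : cauchyG μ ρ = 1 / θ i₀)
    (hw : Tendsto w atTop (𝓝 ρ))
    (hu : ∀ n, r ≤ n → ‖u n‖ = 1 ∧ toEuclideanLin (X n + P n) (u n) = ((w n : ℝ) : 𝕜) • u n) :
    Tendsto (fun n => projNorm (u n) (⨆ (i : Fin r) (_ : θ i ≠ θ i₀), eigKer (P n) (θ i)))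
      atTop (𝓝 0) := by
  have h1 : Tendsto (fun n => ∑ j with θ j ≠ θ i₀, ‖inner 𝕜 (v n j) (u n)‖ ^ 2) atTop (𝓝 0) := by
    have := tendsto_finsetSum (Finset.univ.filter fun j => θ j ≠ θ i₀) fun j hj =>
      ((h.tendsto_inner_of_ne hρ hG hw hu (Finset.mem_filter.mp hj).2).norm.pow 2)
    simpa using this
  have h2 := h1.sqrt
  rw [Real.sqrt_zero] at h2
  refine h2.congr' ?_
  filter_upwards [eventually_ge_atTop r] with n hr
  rw [← projNorm_iSup_eigKer_sq (h.orthonormal n hr) (h.perturbation n hr) h.ne_zero]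
  exact Real.sqrt_sq (norm_nonneg _)

theorem tendsto_projNorm_eigKer (h : IsSpikedPath X P hX μ θ v)
    (hρ : ρ ∉ Set.Icc (edgeInf μ) (edgeSup μ)) (hG : cauchyG μ ρ = 1 / θ i₀)
    (hw : Tendsto w atTop (𝓝 ρ))
    (hu : ∀ n, r ≤ n → ‖u n‖ = 1 ∧ toEuclideanLin (X n + P n) (u n) = ((w n : ℝ) : 𝕜) • u n) :
    Tendsto (fun n => projNorm (u n) (eigKer (P n) (θ i₀)) ^ 2) atTop
      (𝓝 (-1 / (θ i₀ ^ 2 * deriv (cauchyG μ) ρ))) := by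
  have hae := ae_mem_Icc_edge μ h.compact
  have hm := integral_cauchy_sq_pos hae hρ
  rw [(hasDerivAt_cauchyG hae hρ).deriv]
  set m := ∫ t, 1 / (ρ - t) ^ 2 ∂μ with hmdef
  have hθ0 := h.ne_zero i₀
  have h1 := h.tendsto_sum_norm_sq hρ hw hu
  rw [← hmdef] at h1
  have h2 : Tendsto (fun n => ∑ j with θ j ≠ θ i₀, θ j ^ 2 * ‖inner 𝕜 (v n j) (u n)‖ ^ 2) atTop
      (𝓝 0) := by
    have := tendsto_finsetSum (Finset.univ.filter fun j => θ j ≠ θ i₀) fun j hj =>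
      ((h.tendsto_inner_of_ne hρ hG hw hu (Finset.mem_filter.mp hj).2).norm.pow 2).const_mul
        (θ j ^ 2)
    simpa using this
  have h3 := ((h1.div_const m).sub h2).div_const (θ i₀ ^ 2)
  -- Here -m is the derivative of G at ρ, which accounts for the sign in the limit.
  have e : (1 / m - 0) / θ i₀ ^ 2 = -1 / (θ i₀ ^ 2 * -m) := by
    field_simp
    ring
  rw [e] at h3
  refine h3.congr' ?_
  filter_upwards [eventually_ge_atTop r] with n hr
  rw [projNorm_eigKer_sq (h.orthonormal n hr) (h.perturbation n hr) hθ0,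
    mul_div_cancel_right₀ _ hm.ne', ← Finset.sum_filter_add_sum_filter_not Finset.univ
      (fun j => θ j = θ i₀), add_sub_cancel_right, div_eq_iff (pow_ne_zero _ hθ0), Finset.sum_mul]
  refine Finset.sum_congr rfl fun j hj => ?_
  rw [(Finset.mem_filter.mp hj).2, mul_comm]

end IsSpikedPath

end SpikedModel

end

/-! ### The theorem -/

theorem theorem2p2 {𝕜 : Type*} [RCLike 𝕜]
    {Ω : Type*} [MeasurableSpace Ω] (Pr : Measure Ω) [IsProbabilityMeasure Pr]
    -- the random matrix `X n`
    (X : (n : ℕ) → Ω → Matrix (Fin n) (Fin n) 𝕜)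
    (hXm : ∀ n, Measurable (X n))
    (hX : ∀ n ω, (X n ω).IsHermitian)
    -- the limiting spectral distribution and the convergence of the extreme eigenvalues
    (μX : Measure ℝ) [IsProbabilityMeasure μX] (hμX : IsCompact μX.support)
    (hweak : ∀ᵐ ω ∂Pr, SpikedModel.WeaklyConverges
      (fun n => SpikedModel.empiricalSpectral (hX n ω)) μX)
    (hmax : ∀ᵐ ω ∂Pr, Tendsto (fun n => SpikedModel.lam (hX n ω) 1) atTop
      (𝓝 (SpikedModel.edgeSup μX)))
    (hmin : ∀ᵐ ω ∂Pr, Tendsto (fun n => SpikedModel.lam (hX n ω) n) atTop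
      (𝓝 (SpikedModel.edgeInf μX)))
    -- the perturbation `P n`, of rank `r` as soon as `n ≥ r`
    (r : ℕ) (θ : Fin r → ℝ) (hθ : Antitone θ) (hθ0 : ∀ i, θ i ≠ 0)
    (P : (n : ℕ) → Ω → Matrix (Fin n) (Fin n) 𝕜)
    (hPm : ∀ n, Measurable (P n))
    (hP : ∀ n ω, (P n ω).IsHermitian)
    (hPθ : ∀ n, r ≤ n → ∀ᵐ ω ∂Pr, SpikedModel.NonzeroEigenvaluesAre (hP n ω) θ)
    -- independence and invariance
    (hindep : ∀ n, r ≤ n → IndepFun (X n) (P n) Pr)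
    (hinv : ∀ n, r ≤ n → SpikedModel.ConjInvariant Pr (X n) ∨ SpikedModel.ConjInvariant Pr (P n))
    -- the index `i₀` and the unit eigenvectors `u n`
    (i₀ : Fin r)
    (hi₀ : ((1 / θ i₀ : ℝ) : EReal) ∈
      Set.Ioo (SpikedModel.cauchyAtInf μX) (SpikedModel.cauchyAtSup μX))
    (u : (n : ℕ) → Ω → EuclideanSpace 𝕜 (Fin n))
    (hu : ∀ n, r ≤ n → ∀ᵐ ω ∂Pr, ‖u n ω‖ = 1 ∧
      Module.End.HasEigenvector (Matrix.toEuclideanLin (X n ω + P n ω))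
        ((SpikedModel.lam ((hX n ω).add (hP n ω)) (SpikedModel.outlierPos n θ i₀) : ℝ) : 𝕜)
        (u n ω)) :
    ∃ ρ : ℝ,
      -- `ρ` is the unique preimage of `1 / θ i₀` under `G` outside `[a, b]`
      (ρ ∉ Set.Icc (SpikedModel.edgeInf μX) (SpikedModel.edgeSup μX) ∧
        SpikedModel.cauchyG μX ρ = 1 / θ i₀ ∧
        ∀ z ∉ Set.Icc (SpikedModel.edgeInf μX) (SpikedModel.edgeSup μX),
          SpikedModel.cauchyG μX z = 1 / θ i₀ → z = ρ) ∧
      -- and the limit of the outlier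
      (∀ᵐ ω ∂Pr, Tendsto
        (fun n => SpikedModel.lam ((hX n ω).add (hP n ω)) (SpikedModel.outlierPos n θ i₀))
        atTop (𝓝 ρ)) ∧
      -- the derivative in the limit below exists and does not vanish
      (DifferentiableAt ℝ (SpikedModel.cauchyG μX) ρ ∧ deriv (SpikedModel.cauchyG μX) ρ ≠ 0) ∧
      (∀ᵐ ω ∂Pr, Tendsto
        (fun n => SpikedModel.projNorm (u n ω) (SpikedModel.eigKer (P n ω) (θ i₀)) ^ 2)
        atTop (𝓝 (-1 / (θ i₀ ^ 2 * deriv (SpikedModel.cauchyG μX) ρ)))) ∧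
      (∀ᵐ ω ∂Pr, Tendsto
        (fun n => SpikedModel.projNorm (u n ω)
          (⨆ (i : Fin r) (_ : θ i ≠ θ i₀), SpikedModel.eigKer (P n ω) (θ i)))
        atTop (𝓝 0)) := by
  obtain ⟨ρ, hρ, hG, huniq⟩ := SpikedModel.exists_unique_cauchyG_eq hμX (hθ0 i₀) hi₀
  have hae := SpikedModel.ae_mem_Icc_edge μX hμX
  have hderiv := SpikedModel.hasDerivAt_cauchyG hae hρ
  have hcomp := SpikedModel.ae_tendsto_compression Pr X P hXm hPm hX hP θ hPθ hindep hinv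
  have hPθ' : ∀ᵐ ω ∂Pr, ∀ n, r ≤ n → SpikedModel.NonzeroEigenvaluesAre (hP n ω) θ :=
    ae_all_iff.mpr fun n => eventually_imp_distrib_left.mpr (hPθ n)
  have hu' := ae_all_iff.mpr fun n => eventually_imp_distrib_left.mpr (hu n)
  -- From here on ω is fixed: the eigenvectors are chosen separately for each ω and n, with no
  -- measurability needed.
  have hpath : ∀ᵐ ω ∂Pr, ∃ v : (n : ℕ) → Fin r → EuclideanSpace 𝕜 (Fin n),
      SpikedModel.IsSpikedPath (fun n => X n ω) (fun n => P n ω) (fun n => hX n ω) μX θ v := by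
    filter_upwards [hweak, hmax, hmin, hcomp, hPθ'] with ω h1 h2 h3 h4 h5
    have hex : ∀ n, ∃ v : Fin r → EuclideanSpace 𝕜 (Fin n), r ≤ n → Orthonormal 𝕜 v ∧
        ∀ u, Matrix.toEuclideanLin (P n ω) u =
          ∑ j, ((θ j : 𝕜) * inner 𝕜 (v j) u) • v j := by
      intro n
      by_cases hn : r ≤ n
      · obtain ⟨v, hv⟩ := SpikedModel.exists_eigenvectors (hP n ω) (h5 n hn)
        exact ⟨v, fun _ => hv⟩
      · exact ⟨0, fun h => absurd h hn⟩
    choose v hv using hex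
    exact ⟨v, hμX, h1, h2, h3, hθ0, fun n => hP n ω, fun n hn => (hv n hn).1,
      fun n hn => (hv n hn).2, h4⟩
  refine ⟨ρ, ⟨hρ, hG, huniq⟩, ?_, ⟨hderiv.differentiableAt, ?_⟩, ?_, ?_⟩
  · filter_upwards [hpath] with ω ⟨v, h⟩
    exact h.tendsto_outlier hθ hρ hG
  · rw [hderiv.deriv]
    exact neg_ne_zero.mpr (SpikedModel.integral_cauchy_sq_pos hae hρ).ne'
  · filter_upwards [hpath, hu'] with ω ⟨v, h⟩ hω
    exact h.tendsto_projNorm_eigKer hρ hG (h.tendsto_outlier hθ hρ hG)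
      fun n hn => ⟨(hω n hn).1, (hω n hn).2.apply_eq_smul⟩
  · filter_upwards [hpath, hu'] with ω ⟨v, h⟩ hω
    exact h.tendsto_projNorm_iSup hρ hG (h.tendsto_outlier hθ hρ hG)
      fun n hn => ⟨(hω n hn).1, (hω n hn).2.apply_eq_smul⟩
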